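/- **Setting.** Let $\Omega\subset\mathbb R^2$ be a bounded connected open set with Lipschitz boundary, let $h\in L^\infty(\Omega)$ and let $c,\sigma\in L^\infty(\Omega)$ be positive with bounded inverses. Let $\partial\Omega$ be partitioned into measurable sets $\Gamma_N,\Gamma_D,\Gamma_R,\Gamma_\sharp$ (Neumann, Dirichlet, Robin, periodic), where $\Gamma_D\cup\Gamma_R$ is either empty or of positive length, $\Gamma_\sharp$ is a finite union of pairs $F_k$, $F_k+\tau_k$ of measurable sets identified by translations, and let $a$ be a bounded measurable positive function on $\Gamma_R$. The constants are *not controlled* if $\Gamma_D\cup\Gamma_R=\emptyset$. Let $$V=\{s\in H^1(\Omega):\ s=0\text{ on }\Gamma_D,\ s(\cdot+\tau_k)=s\text{ on }F_k\text{ for all }k\}$$ (in the sense of traces), and let $H=V$ if the constants are controlled and $H=V/\mathbb R$ if they are not. On $\mathcal H=L^2(\Omega)\times H$ put $$\big((u,s)\,|\,(u',s')\big)_{\mathcal H}=\int_\Omega c\,uu'+\sigma\nabla s\cdot\nabla s'+\int_{\Gamma_R}a\,ss'.$$ For $s\in H$ and $f\in L^2(\Omega)$, "$\operatorname{div}(\sigma\nabla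 s)=f$ with the lateral boundary conditions" means $\int_\Omega\sigma\nabla s\cdot\nabla v+\int_{\Gamma_R}a\,sv=-\int_\Omega fv$ for all $v\in V$; in that case one writes $s=\Delta_\sigma^{-1}f$. Let $\mathcal A(u,s)=\big(c^{-1}(hu-\operatorname{div}(\sigma\nabla s)),\,u\big)$, with domain the set of $(u,s)\in\mathcal H$ such that $u\in V$ and $\operatorname{div}(\sigma\nabla s)\in L^2(\Omega)$ with the lateral boundary conditions. Let $\pi_+$ and $\pi_-$ be the orthogonal projections of $\mathcal H$ onto the closed linear spans of the eigenvectors of $\mathcal A$ with positive, respectively negative, eigenvalues, let $P(u,s)=(u,0)$, let $\Phi=(1,0)$, and let $B_-=\pi_-(\pi_-P\pi_-)^{-1}\pi_-$, the inverse being taken on the range of $\pi_-$. **Theorem.** The scalar product is definite, $\mathcal H$ is a Hilbert space, and $\pi_-P\pi_-$ is invertible on the range of $\pi_-$, so that $B_-$ is well defined. For $\phi\in\mathcal H$ consider the problem of finding $\psi\in\mathcal H$ with $$P\psi=P\phi\quad\text{and}\quad\pi_+\psi=0.\tag{1}$$ * If the constants are not controlled and $\int_\Omega h>0$, then (1) has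 a solution if and only if $(\Phi-PB_-\Phi\,|\,\phi)_{\mathcal H}=0$. In this case the solution is unique and given by $\psi=B_-P\phi$. * If the constants are not controlled and $\int_\Omega h=0$ (balanced case), then $(\Phi-PB_-\Phi\,|\,\Phi)_{\mathcal H}\neq0$, the vector $\phi_0=(1,\Delta_\sigma^{-1}h)\in\mathcal H$ exists and is unique, and (1) has a unique solution, given by $$\psi=B_-P\phi+\frac{(\Phi-PB_-\Phi\,|\,\phi)_{\mathcal H}}{(\Phi-PB_-\Phi\,|\,\Phi)_{\mathcal H}}\,(\phi_0-B_-\Phi).$$ * In every other case (the constants are controlled, or $\int_\Omega h<0$), $\psi=B_-P\phi$ is the unique solution of (1). -/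

import Mathlib

open MeasureTheory

namespace Graetz

noncomputable section

/-- The Euclidean plane, which contains the cross-section of the pipe. -/
abbrev Plane : Type := EuclideanSpace ℝ (Fin 2)

/-- `Ω` has a Lipschitz boundary: near each boundary point it is, in suitable orthonormal
coordinates, the set of points above the graph of a Lipschitz function. -/
def HasLipschitzBoundary (Ω : Set Plane) : Prop :=
  ∀ p ∈ frontier Ω, ∃ e : Plane ≃ₗᵢ[ℝ] Plane, ∃ γ : ℝ → ℝ, (∃ K, LipschitzWith K γ) ∧
    ∃ U ∈ nhds p, ∀ x ∈ U, (x ∈ Ω ↔ γ ((e x) 0) < (e x) 1)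

/-- The data of the generalized Graetz problem: the section `Ω`, the coefficients `c`, `σ`, the
axial velocity `h`, the Robin coefficient `a`, and the Neumann, Dirichlet, Robin and periodic parts
`ΓN`, `ΓD`, `ΓR`, `ΓP` of the boundary. The periodic part consists of finitely many pairs of faces
`face k`, `face k + τ k`, identified by a translation. -/
structure Data where
  Ω : Set Plane
  isOpen : IsOpen Ω
  isConnected : IsConnected Ω
  isBounded : Bornology.IsBounded Ω
  lipschitz : HasLipschitzBoundary Ω
  c : Plane → ℝ
  c_meas : AEStronglyMeasurable c (volume.restrict Ω)
  c_bounds : ∃ m M : ℝ, 0 < m ∧ ∀ᵐ x ∂(volume.restrict Ω), m ≤ c x ∧ c x ≤ M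
  σ : Plane → ℝ
  σ_meas : AEStronglyMeasurable σ (volume.restrict Ω)
  σ_bounds : ∃ m M : ℝ, 0 < m ∧ ∀ᵐ x ∂(volume.restrict Ω), m ≤ σ x ∧ σ x ≤ M
  h : Plane → ℝ
  h_memLp : MemLp h ⊤ (volume.restrict Ω)
  ΓN : Set Plane
  ΓD : Set Plane
  ΓR : Set Plane
  ΓP : Set Plane
  ΓN_meas : MeasurableSet ΓN
  ΓD_meas : MeasurableSet ΓD
  ΓR_meas : MeasurableSet ΓR
  ΓP_meas : MeasurableSet ΓP
  cover : ΓN ∪ ΓD ∪ ΓR ∪ ΓP = frontier Ω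
  disjoint : [ΓN, ΓD, ΓR, ΓP].Pairwise Disjoint
  /-- A Dirichlet or Robin condition, if there is one, is imposed on a set of positive length. -/
  nondegenerate : (ΓD ∪ ΓR).Nonempty → 0 < μH[1] (ΓD ∪ ΓR)
  a : Plane → ℝ
  a_meas : AEStronglyMeasurable a (μH[1].restrict ΓR)
  a_bounds : ∃ M : ℝ, ∀ᵐ x ∂(μH[1].restrict ΓR), 0 < a x ∧ a x ≤ M
  nfaces : ℕ
  face : Fin nfaces → Set Plane
  τ : Fin nfaces → Plane
  face_meas : ∀ k, MeasurableSet (face k)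
  faces_eq : ΓP = ⋃ k, face k ∪ (fun x => x + τ k) '' face k

/-- The weighted integral `∫ w ⟨f, g⟩ dm'` of two square integrable fields (for scalar fields
`⟨f, g⟩` is the product). -/
def wInner {F : Type*} [NormedAddCommGroup F] [InnerProductSpace ℝ F] {m : Measure Plane}
    (m' : Measure Plane) (w : Plane → ℝ) (f g : Lp F 2 m) : ℝ :=
  ∫ x, w x * inner ℝ (f x) (g x) ∂m'

section WInner

variable {F : Type*} [NormedAddCommGroup F] [InnerProductSpace ℝ F] {m m' : Measure Plane}
  {w : Plane → ℝ}

theorem wInner_integrable (hm : m' ≤ m) (hw : AEStronglyMeasurable w m')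
    (hb : ∃ M, ∀ᵐ x ∂m', ‖w x‖ ≤ M) (f g : Lp F 2 m) :
    Integrable (fun x => w x * inner ℝ (f x) (g x)) m' := by
  obtain ⟨M, hM⟩ := hb
  exact ((L2.integrable_inner (𝕜 := ℝ) f g).mono_measure hm).bdd_mul hw hM

theorem wInner_comm (f g : Lp F 2 m) : wInner m' w f g = wInner m' w g f := by
  unfold wInner
  simp only [real_inner_comm]

theorem wInner_nonneg (hw : ∀ᵐ x ∂m', 0 ≤ w x) (f : Lp F 2 m) : 0 ≤ wInner m' w f f := by
  refine integral_nonneg_of_ae ?_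
  filter_upwards [hw] with x hx
  exact mul_nonneg hx real_inner_self_nonneg

theorem wInner_add (hm : m' ≤ m) (hw : AEStronglyMeasurable w m')
    (hb : ∃ M, ∀ᵐ x ∂m', ‖w x‖ ≤ M) (f f' g : Lp F 2 m) :
    wInner m' w (f + f') g = wInner m' w f g + wInner m' w f' g := by
  unfold wInner
  rw [← integral_add (wInner_integrable hm hw hb f g) (wInner_integrable hm hw hb f' g)]
  refine integral_congr_ae ?_
  filter_upwards [(Measure.absolutelyContinuous_of_le hm).ae_le (Lp.coeFn_add f f')] with x hx
  rw [hx, Pi.add_apply, inner_add_left, mul_add]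

theorem wInner_smul (hm : m' ≤ m) (f g : Lp F 2 m) (r : ℝ) :
    wInner m' w (r • f) g = r * wInner m' w f g := by
  unfold wInner
  rw [← integral_const_mul]
  refine integral_congr_ae ?_
  filter_upwards [(Measure.absolutelyContinuous_of_le hm).ae_le (Lp.coeFn_smul r f)] with x hx
  rw [hx, Pi.smul_apply, real_inner_smul_left]
  ring

end WInner

namespace Data

variable (G : Data)

/-- "The constants are not controlled": there is no Dirichlet or Robin condition. -/
def NotControlled : Prop := G.ΓD ∪ G.ΓR = ∅

/-- Lebesgue measure on `Ω`. -/
abbrev vol : Measure Plane := volume.restrict G.Ω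

/-- Arc length on `∂Ω`. -/
abbrev len : Measure Plane := μH[1].restrict (frontier G.Ω)

/-- Triples consisting of a function on `Ω`, a vector field on `Ω` and a function on `∂Ω`, all of
them square integrable. -/
abbrev Triple : Type := Lp ℝ 2 G.vol × Lp Plane 2 G.vol × Lp ℝ 2 G.len

/-- `g` is the weak gradient of `s` on `Ω`. -/
def IsWeakGradient (s : Lp ℝ 2 G.vol) (g : Lp Plane 2 G.vol) : Prop :=
  ∀ η : Plane → ℝ, ContDiff ℝ (⊤ : ℕ∞) η → HasCompactSupport η → tsupport η ⊆ G.Ω →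
    ∀ v : Plane, ∫ x, s x * fderiv ℝ η x v ∂G.vol = -∫ x, inner ℝ (g x) v * η x ∂G.vol

/-- The triples `(f|_Ω, ∇f|_Ω, f|_∂Ω)` with `f` smooth on the whole plane. -/
def smoothTriples : Submodule ℝ G.Triple where
  carrier := {t | ∃ f : Plane → ℝ, ContDiff ℝ (⊤ : ℕ∞) f ∧
    t.1 =ᵐ[G.vol] f ∧ t.2.1 =ᵐ[G.vol] gradient f ∧ t.2.2 =ᵐ[G.len] f}
  zero_mem' := by
    refine ⟨fun _ => 0, contDiff_const, Lp.coeFn_zero _ _ _, ?_, Lp.coeFn_zero _ _ _⟩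
    filter_upwards [Lp.coeFn_zero Plane 2 G.vol] with x hx
    have : gradient (fun _ : Plane => (0 : ℝ)) x = 0 := by simp [gradient]
    rw [this]
    exact hx
  add_mem' := by
    rintro t t' ⟨f, hf, h1, h2, h3⟩ ⟨f', hf', h1', h2', h3'⟩
    refine ⟨f + f', hf.add hf', (Lp.coeFn_add _ _).trans (h1.add h1'),
      ((Lp.coeFn_add _ _).trans (h2.add h2')).trans (Filter.Eventually.of_forall fun x => ?_),
      (Lp.coeFn_add _ _).trans (h3.add h3')⟩
    have d : DifferentiableAt ℝ f x := (hf.differentiable (by simp)).differentiableAt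
    have d' : DifferentiableAt ℝ f' x := (hf'.differentiable (by simp)).differentiableAt
    simp only [Pi.add_apply, gradient]
    rw [fderiv_add d d', map_add]
  smul_mem' := by
    rintro r t ⟨f, hf, h1, h2, h3⟩
    refine ⟨r • f, hf.const_smul r, (Lp.coeFn_smul _ _).trans (h1.const_smul r),
      ((Lp.coeFn_smul _ _).trans (h2.const_smul r)).trans
        (Filter.Eventually.of_forall fun x => ?_),
      (Lp.coeFn_smul _ _).trans (h3.const_smul r)⟩
    have d : DifferentiableAt ℝ f x := (hf.differentiable (by simp)).differentiableAt
    simp only [Pi.smul_apply, gradient]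
    rw [fderiv_const_smul d, map_smul]

theorem face_subset (k : Fin G.nfaces) : G.face k ⊆ frontier G.Ω := by
  rw [← G.cover, G.faces_eq]
  exact fun x hx => Or.inr (Set.mem_iUnion.2 ⟨k, Or.inl hx⟩)

theorem face_add_subset (k : Fin G.nfaces) :
    (fun x => x + G.τ k) '' G.face k ⊆ frontier G.Ω := by
  rw [← G.cover, G.faces_eq]
  exact fun x hx => Or.inr (Set.mem_iUnion.2 ⟨k, Or.inr hx⟩)

theorem ΓD_subset : G.ΓD ⊆ frontier G.Ω := by
  rw [← G.cover]
  exact fun x hx => Or.inl (Or.inl (Or.inr hx))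

theorem ΓR_subset : G.ΓR ⊆ frontier G.Ω := by
  rw [← G.cover]
  exact fun x hx => Or.inl (Or.inr hx)

theorem ae_face {p : Plane → Prop} (k : Fin G.nfaces) (hp : ∀ᵐ x ∂G.len, p x) :
    ∀ᵐ x ∂(μH[1].restrict (G.face k)), p x :=
  ae_mono (Measure.restrict_mono (G.face_subset k) le_rfl) hp

theorem ae_face_add {p : Plane → Prop} (k : Fin G.nfaces) (hp : ∀ᵐ x ∂G.len, p x) :
    ∀ᵐ x ∂(μH[1].restrict (G.face k)), p (x + G.τ k) := by
  have hp' := ae_mono (Measure.restrict_mono (G.face_add_subset k) le_rfl) hp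
  have hm : MeasurePreserving (IsometryEquiv.addRight (G.τ k)) (μH[1] : Measure Plane) μH[1] :=
    (IsometryEquiv.addRight (G.τ k)).measurePreserving_hausdorffMeasure 1
  have he : MeasurableEmbedding (IsometryEquiv.addRight (G.τ k) : Plane → Plane) :=
    (IsometryEquiv.addRight (G.τ k)).toHomeomorph.measurableEmbedding
  exact (hm.restrict_image_emb he (G.face k)).quasiMeasurePreserving.ae hp'

theorem isWeakGradient_add {s s' : Lp ℝ 2 G.vol} {g g' : Lp Plane 2 G.vol}
    (hs : G.IsWeakGradient s g) (hs' : G.IsWeakGradient s' g') :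
    G.IsWeakGradient (s + s') (g + g') := by
  intro η hη hc ht v
  have e1 := hs η hη hc ht v
  have e2 := hs' η hη hc ht v
  have c1 : Continuous fun x => fderiv ℝ η x v :=
    (hη.continuous_fderiv (by simp)).clm_apply continuous_const
  have m1 : MemLp (fun x => fderiv ℝ η x v) 2 G.vol :=
    c1.memLp_of_hasCompactSupport (hc.fderiv_apply ℝ v)
  have m2 : MemLp η 2 G.vol := hη.continuous.memLp_of_hasCompactSupport hc
  have i1 : ∀ s : Lp ℝ 2 G.vol, Integrable (fun x => s x * fderiv ℝ η x v) G.vol :=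
    fun s => (Lp.memLp s).integrable_mul m1
  have i2 : ∀ g : Lp Plane 2 G.vol, Integrable (fun x => inner ℝ (g x) v * η x) G.vol :=
    fun g => ((Lp.memLp g).inner_const v).integrable_mul m2
  have l : ∫ x, (s + s' : Lp ℝ 2 G.vol) x * fderiv ℝ η x v ∂G.vol =
      ∫ x, s x * fderiv ℝ η x v + s' x * fderiv ℝ η x v ∂G.vol := by
    refine integral_congr_ae ?_
    filter_upwards [Lp.coeFn_add s s'] with x hx
    rw [hx, Pi.add_apply, add_mul]
  have r : ∫ x, inner ℝ ((g + g' : Lp Plane 2 G.vol) x) v * η x ∂G.vol =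
      ∫ x, inner ℝ (g x) v * η x + inner ℝ (g' x) v * η x ∂G.vol := by
    refine integral_congr_ae ?_
    filter_upwards [Lp.coeFn_add g g'] with x hx
    rw [hx, Pi.add_apply, inner_add_left, add_mul]
  rw [l, r, integral_add (i1 s) (i1 s'), integral_add (i2 g) (i2 g'), e1, e2]
  ring

theorem isWeakGradient_smul (r : ℝ) {s : Lp ℝ 2 G.vol} {g : Lp Plane 2 G.vol}
    (hs : G.IsWeakGradient s g) : G.IsWeakGradient (r • s) (r • g) := by
  intro η hη hc ht v
  have e1 := hs η hη hc ht v
  have l : ∫ x, (r • s : Lp ℝ 2 G.vol) x * fderiv ℝ η x v ∂G.vol =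
      ∫ x, r * (s x * fderiv ℝ η x v) ∂G.vol := by
    refine integral_congr_ae ?_
    filter_upwards [Lp.coeFn_smul r s] with x hx
    rw [hx, Pi.smul_apply, smul_eq_mul, mul_assoc]
  have k : ∫ x, inner ℝ ((r • g : Lp Plane 2 G.vol) x) v * η x ∂G.vol =
      ∫ x, r * (inner ℝ (g x) v * η x) ∂G.vol := by
    refine integral_congr_ae ?_
    filter_upwards [Lp.coeFn_smul r g] with x hx
    rw [hx, Pi.smul_apply, real_inner_smul_left, mul_assoc]
  rw [l, k, integral_const_mul, integral_const_mul, e1]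
  ring

/-- The functions `s ∈ H¹(Ω)` with `s = 0` on `ΓD` and `s` periodic on `ΓP`, each recorded with its
weak gradient `t.2.1` and its boundary trace `t.2.2`. The trace is the extension by density of the
restriction to `∂Ω` of functions that are smooth up to the boundary: the triple is a limit
(in `L²(Ω) × L²(Ω)² × L²(∂Ω)`) of smooth triples. -/
def V : Submodule ℝ G.Triple where
  carrier := {t | G.IsWeakGradient t.1 t.2.1 ∧ t ∈ G.smoothTriples.topologicalClosure ∧
    (∀ᵐ x ∂(μH[1].restrict G.ΓD), t.2.2 x = 0) ∧
    ∀ k, ∀ᵐ x ∂(μH[1].restrict (G.face k)), t.2.2 (x + G.τ k) = t.2.2 x}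
  zero_mem' := by
    have h0 : ∀ᵐ x ∂G.len, (0 : Lp ℝ 2 G.len) x = 0 := Lp.coeFn_zero _ _ _
    refine ⟨?_, Submodule.zero_mem _, ae_mono (Measure.restrict_mono G.ΓD_subset le_rfl) h0,
      fun k => ?_⟩
    · intro η hη hc ht v
      have l : ∫ x, (0 : Lp ℝ 2 G.vol) x * fderiv ℝ η x v ∂G.vol = ∫ x, (0 : ℝ) ∂G.vol := by
        refine integral_congr_ae ?_
        filter_upwards [Lp.coeFn_zero ℝ 2 G.vol] with x hx
        rw [hx, Pi.zero_apply, zero_mul]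
      have r : ∫ x, inner ℝ ((0 : Lp Plane 2 G.vol) x) v * η x ∂G.vol =
          ∫ x, (0 : ℝ) ∂G.vol := by
        refine integral_congr_ae ?_
        filter_upwards [Lp.coeFn_zero Plane 2 G.vol] with x hx
        rw [hx, Pi.zero_apply, inner_zero_left, zero_mul]
      exact l.trans (by rw [show (0 : G.Triple).2.1 = 0 from rfl, r]; simp)
    · filter_upwards [G.ae_face k h0, G.ae_face_add k h0] with x h1 h2
      exact h2.trans h1.symm
  add_mem' := by
    rintro t t' ⟨h1, h2, h3, h4⟩ ⟨h1', h2', h3', h4'⟩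
    have ha : ∀ᵐ x ∂G.len, (t.2.2 + t'.2.2 : Lp ℝ 2 G.len) x = t.2.2 x + t'.2.2 x :=
      Lp.coeFn_add _ _
    refine ⟨G.isWeakGradient_add h1 h1', Submodule.add_mem _ h2 h2', ?_, fun k => ?_⟩
    · filter_upwards [ae_mono (Measure.restrict_mono G.ΓD_subset le_rfl) ha, h3, h3']
        with x e e1 e2
      exact e.trans (by rw [e1, e2, add_zero])
    · filter_upwards [G.ae_face k ha, G.ae_face_add k ha, h4 k, h4' k] with x e e' e1 e2
      exact e'.trans (by rw [e1, e2]; exact e.symm)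
  smul_mem' := by
    rintro r t ⟨h1, h2, h3, h4⟩
    have ha : ∀ᵐ x ∂G.len, (r • t.2.2 : Lp ℝ 2 G.len) x = r * t.2.2 x := Lp.coeFn_smul _ _
    refine ⟨G.isWeakGradient_smul r h1, Submodule.smul_mem _ r h2, ?_, fun k => ?_⟩
    · filter_upwards [ae_mono (Measure.restrict_mono G.ΓD_subset le_rfl) ha, h3] with x e e1
      exact e.trans (by rw [e1, mul_zero])
    · filter_upwards [G.ae_face k ha, G.ae_face_add k ha, h4 k] with x e e' e1
      exact e'.trans (by rw [e1]; exact e.symm)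

/-- The function underlying an element of `V`. -/
def fn : G.V →ₗ[ℝ] Lp ℝ 2 G.vol :=
  LinearMap.fst ℝ (Lp ℝ 2 G.vol) (Lp Plane 2 G.vol × Lp ℝ 2 G.len) ∘ₗ G.V.subtype

/-- The weak gradient of an element of `V`. -/
def grad : G.V →ₗ[ℝ] Lp Plane 2 G.vol :=
  LinearMap.fst ℝ (Lp Plane 2 G.vol) (Lp ℝ 2 G.len) ∘ₗ
    LinearMap.snd ℝ (Lp ℝ 2 G.vol) (Lp Plane 2 G.vol × Lp ℝ 2 G.len) ∘ₗ G.V.subtype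

/-- The boundary trace of an element of `V`. -/
def trace : G.V →ₗ[ℝ] Lp ℝ 2 G.len :=
  LinearMap.snd ℝ (Lp Plane 2 G.vol) (Lp ℝ 2 G.len) ∘ₗ
    LinearMap.snd ℝ (Lp ℝ 2 G.vol) (Lp Plane 2 G.vol × Lp ℝ 2 G.len) ∘ₗ G.V.subtype

/-- The form `∫_Ω σ ∇s · ∇s' + ∫_ΓR a s s'`. -/
def energy (s s' : G.V) : ℝ :=
  wInner G.vol G.σ (G.grad s) (G.grad s') +
    wInner (μH[1].restrict G.ΓR) G.a (G.trace s) (G.trace s')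

/-- The pairs `(u, s)` with `u ∈ L²(Ω)` and `s ∈ V`. -/
def PreH : Type := Lp ℝ 2 G.vol × G.V

instance : AddCommGroup G.PreH := inferInstanceAs (AddCommGroup (Lp ℝ 2 G.vol × G.V))

instance : Module ℝ G.PreH := inferInstanceAs (Module ℝ (Lp ℝ 2 G.vol × G.V))

/-- `PreH` is the space of pairs, without the norm of the product. -/
def ofPair : (Lp ℝ 2 G.vol × G.V) ≃ₗ[ℝ] G.PreH := LinearEquiv.refl ℝ _

/-- The component `u` of `(u, s)`. -/
def uPart : G.PreH →ₗ[ℝ] Lp ℝ 2 G.vol := LinearMap.fst ℝ (Lp ℝ 2 G.vol) G.V ∘ₗ G.ofPair.symm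

/-- The component `s` of `(u, s)`. -/
def sPart : G.PreH →ₗ[ℝ] G.V := LinearMap.snd ℝ (Lp ℝ 2 G.vol) G.V ∘ₗ G.ofPair.symm

/-- The (positive semidefinite) scalar product
`((u, s) | (u', s')) = ∫_Ω c u u' + σ ∇s · ∇s' + ∫_ΓR a s s'`. -/
def form (φ φ' : G.PreH) : ℝ :=
  wInner G.vol G.c (G.uPart φ) (G.uPart φ') + G.energy (G.sPart φ) (G.sPart φ')

theorem norm_bound {m' : Measure Plane} {w : Plane → ℝ}
    (hw : ∃ m M : ℝ, 0 < m ∧ ∀ᵐ x ∂m', m ≤ w x ∧ w x ≤ M) :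
    (∃ M, ∀ᵐ x ∂m', ‖w x‖ ≤ M) ∧ ∀ᵐ x ∂m', 0 ≤ w x := by
  obtain ⟨m, M, hm, hb⟩ := hw
  refine ⟨⟨M, ?_⟩, ?_⟩
  · filter_upwards [hb] with x hx
    rw [Real.norm_of_nonneg (hm.le.trans hx.1)]
    exact hx.2
  · filter_upwards [hb] with x hx using hm.le.trans hx.1

theorem a_norm_bound : ∃ M, ∀ᵐ x ∂(μH[1].restrict G.ΓR), ‖G.a x‖ ≤ M := by
  obtain ⟨M, hb⟩ := G.a_bounds
  refine ⟨M, ?_⟩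
  filter_upwards [hb] with x hx
  rw [Real.norm_of_nonneg hx.1.le]
  exact hx.2

theorem a_nonneg : ∀ᵐ x ∂(μH[1].restrict G.ΓR), 0 ≤ G.a x := by
  obtain ⟨M, hb⟩ := G.a_bounds
  filter_upwards [hb] with x hx using hx.1.le

theorem robin_le : μH[1].restrict G.ΓR ≤ G.len := Measure.restrict_mono G.ΓR_subset le_rfl

theorem energy_nonneg (s : G.V) : 0 ≤ G.energy s s :=
  add_nonneg (wInner_nonneg (norm_bound G.σ_bounds).2 _) (wInner_nonneg G.a_nonneg _)

theorem energy_comm (s s' : G.V) : G.energy s s' = G.energy s' s := by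
  unfold energy
  rw [wInner_comm (G.grad s), wInner_comm (G.trace s)]

theorem energy_add (s s' v : G.V) : G.energy (s + s') v = G.energy s v + G.energy s' v := by
  unfold energy
  rw [map_add, map_add, wInner_add le_rfl G.σ_meas (norm_bound G.σ_bounds).1,
    wInner_add G.robin_le G.a_meas G.a_norm_bound]
  ring

theorem energy_smul (r : ℝ) (s v : G.V) : G.energy (r • s) v = r * G.energy s v := by
  unfold energy
  rw [map_smul, map_smul, wInner_smul le_rfl, wInner_smul G.robin_le]
  ring

theorem mass_nonneg (u : Lp ℝ 2 G.vol) : 0 ≤ wInner G.vol G.c u u :=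
  wInner_nonneg (norm_bound G.c_bounds).2 u

instance : PreInnerProductSpace.Core ℝ G.PreH where
  inner φ φ' := G.form φ φ'
  conj_inner_symm φ φ' := by
    simp only [conj_trivial, form]
    rw [wInner_comm (G.uPart φ'), energy_comm]
  re_inner_nonneg φ := add_nonneg (G.mass_nonneg _) (G.energy_nonneg _)
  add_left φ φ' φ'' := by
    simp only [form, map_add, energy_add,
      wInner_add le_rfl G.c_meas (norm_bound G.c_bounds).1]
    ring
  smul_left φ φ' r := by
    simp only [form, map_smul, energy_smul, wInner_smul le_rfl, conj_trivial]
    ring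

instance : SeminormedAddCommGroup G.PreH :=
  InnerProductSpace.Core.toSeminormedAddCommGroup (𝕜 := ℝ)

instance : InnerProductSpace ℝ G.PreH := InnerProductSpace.ofCore inferInstance

/-- The Hilbert space `ℋ` of pairs `(u, s)`, where pairs at distance zero for the scalar product are
identified. If the constants are controlled the scalar product is definite and nothing is
identified; otherwise this is the quotient of the second component by the constants (the main
theorem contains both facts). -/
abbrev Hilb : Type := SeparationQuotient G.PreH

/-- The element `(u, s)` of `ℋ`. -/
def pair (u : Lp ℝ 2 G.vol) (s : G.V) : G.Hilb := SeparationQuotient.mk (G.ofPair (u, s))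

/-- `(u, s) ↦ (u, 0)` before the identification. -/
def preP : G.PreH →L[ℝ] G.PreH :=
  LinearMap.mkContinuous
    (G.ofPair.toLinearMap ∘ₗ LinearMap.inl ℝ (Lp ℝ 2 G.vol) G.V ∘ₗ G.uPart) 1 (fun φ => by
      rw [one_mul]
      change Real.sqrt (wInner G.vol G.c (G.uPart φ) (G.uPart φ) + G.energy 0 0) ≤
        Real.sqrt (wInner G.vol G.c (G.uPart φ) (G.uPart φ) + G.energy (G.sPart φ) (G.sPart φ))
      have z : G.energy 0 0 = 0 := by simpa using G.energy_smul 0 0 0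
      rw [z]
      gcongr
      exact G.energy_nonneg _)

/-- The projection `P (u, s) = (u, 0)` of `ℋ`. -/
def P : G.Hilb →L[ℝ] G.Hilb :=
  SeparationQuotient.liftCLM (SeparationQuotient.mkCLM ℝ G.PreH ∘L G.preP) fun _ _ h =>
    SeparationQuotient.mk_eq_mk.2 (h.map G.preP.continuous)

theorem P_pair (u : Lp ℝ 2 G.vol) (s : G.V) : G.P (G.pair u s) = G.pair u 0 := rfl

theorem inner_pair (u u' : Lp ℝ 2 G.vol) (s s' : G.V) :
    inner ℝ (G.pair u s) (G.pair u' s') = wInner G.vol G.c u u' + G.energy s s' := rfl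

instance : IsFiniteMeasure G.vol :=
  ⟨by rw [Measure.restrict_apply_univ]; exact G.isBounded.measure_lt_top⟩

/-- The constant function `1` in `L²(Ω)`. -/
def one : Lp ℝ 2 G.vol := (memLp_const (1 : ℝ)).toLp (fun _ => 1)

/-- The velocity `h` as an element of `L²(Ω)`. -/
def hL2 : Lp ℝ 2 G.vol := (G.h_memLp.mono_exponent le_top).toLp G.h

/-- `Φ = (1, 0)`. -/
def Phi : G.Hilb := G.pair G.one 0

/-- `div (σ ∇s) = f` in `Ω`, with the lateral boundary conditions on the flux (`σ ∇s · n = 0` on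
`ΓN`, `σ ∇s · n = - a s` on `ΓR`, periodicity on `ΓP`), in the weak sense. -/
def DivEq (s : G.V) (f : Lp ℝ 2 G.vol) : Prop :=
  ∀ v : G.V, G.energy s v = -∫ x, f x * G.fn v x ∂G.vol

/-- `φ₀ = (1, Δ_σ⁻¹ h)`. -/
def IsPhi0 (φ₀ : G.Hilb) : Prop := ∃ s : G.V, G.DivEq s G.hL2 ∧ φ₀ = G.pair G.one s

/-- The graph of the operator `𝒜 (u, s) = (c⁻¹ (h u - div (σ ∇s)), u)`: `φ = (u, s)` lies in the
domain of `𝒜` and `𝒜 φ = φ'`. Here `w` is `u` as an element of `H¹(Ω)` that satisfies the Dirichlet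
and periodicity conditions, and `f = div (σ ∇s)`. -/
def IsA (φ φ' : G.Hilb) : Prop :=
  ∃ (s w : G.V) (f u' : Lp ℝ 2 G.vol), φ = G.pair (G.fn w) s ∧ φ' = G.pair u' w ∧ G.DivEq s f ∧
    ∀ᵐ x ∂G.vol, u' x = (G.c x)⁻¹ * (G.h x * G.fn w x - f x)

/-- The range of `π₋`: the closed span of the eigenvectors of `𝒜` with negative eigenvalue. -/
def negSpace : Submodule ℝ G.Hilb :=
  (Submodule.span ℝ {φ | ∃ l : ℝ, l < 0 ∧ G.IsA φ (l • φ)}).topologicalClosure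

/-- The range of `π₊`: the closed span of the eigenvectors of `𝒜` with positive eigenvalue. -/
def posSpace : Submodule ℝ G.Hilb :=
  (Submodule.span ℝ {φ | ∃ l : ℝ, 0 < l ∧ G.IsA φ (l • φ)}).topologicalClosure

section Complete

variable [CompleteSpace G.Hilb]

instance : G.negSpace.HasOrthogonalProjection :=
  inferInstanceAs (Submodule.topologicalClosure _).HasOrthogonalProjection

instance : G.posSpace.HasOrthogonalProjection :=
  inferInstanceAs (Submodule.topologicalClosure _).HasOrthogonalProjection

/-- The orthogonal projection `π₊`. -/
def piPlus : G.Hilb →L[ℝ] G.Hilb := G.posSpace.starProjection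

/-- The operator `π₋ P π₋` on the range of `π₋`. -/
def compression : G.negSpace →L[ℝ] G.negSpace :=
  G.negSpace.orthogonalProjectionOnto ∘L G.P ∘L G.negSpace.subtypeL

/-- `B₋ = π₋ (π₋ P π₋)⁻¹ π₋`. -/
def Bminus : G.Hilb →L[ℝ] G.Hilb :=
  G.negSpace.subtypeL ∘L G.compression.inverse ∘L G.negSpace.orthogonalProjectionOnto

/-- `ψ` solves the decomposition problem with datum `φ`: `P ψ = P φ` and `π₊ ψ = 0`. -/
def Solves (φ ψ : G.Hilb) : Prop := G.P ψ = G.P φ ∧ G.piPlus ψ = 0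

end Complete

end Data

end

end Graetz

/-! Up to constants, 𝒜 has the partial inverse T(u, s) = (s, Δ_σ⁻¹(h s - c u)), which is compact and
symmetric. Its eigenvectors, together with the finite-dimensional kernel of 𝒜, span ℋ, so π₊ψ = 0
means that ψ lies in the negative space plus the kernel, and the nonzero eigenvalues of 𝒜 have
absolute value at least some positive `gap`.

The invertibility of π₋Pπ₋ comes from the reflection J = 2P - 1, i.e. J(u, s) = (u, -s): the cross
terms of 𝒜 cancel, and (Jx | 𝒜x) = ∫ h u². Let F be a finite-dimensional 𝒜-invariant space spanned
by eigenvectors with negative eigenvalues, and let z be an eigenvector of the compression of P to F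
for its least eigenvalue κ. Then (2κ - 1)(z | 𝒜z) = (Dz | z) ≤ ‖D‖ κ ‖z‖², where D represents ∫ h u
u', while (z | 𝒜z) ≤ -`gap` ‖z‖². This bounds κ from below independently of F
(`coercivity_le_of_invariant`), hence P is coercive on the closed negative space and Lax-Milgram
applies.

What Pφ - P B₋ Pφ fails to reach consists of vectors w = Pw orthogonal to the negative space. Such a
w lies in the positive space plus the kernel, and T is positive definite on the positive space. But
T maps (u, 0) to a pair of the form (0, ·), so (Tw | w) = 0 if the constants are controlled, and w =
0. If they are not, the constant in the first component of T is fixed by the solvability condition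
of the Neumann problem, and (Tw | w) = (Φ | w)² / ∫h when ∫h ≠ 0. For ∫h < 0 this again forces w =
0. For ∫h > 0 it leaves the one obstruction (Φ | w), which is tested by the defect Φ - P B₋ Φ. In
the balanced case 𝒜 has the kernel vector φ₀, whose image under P is Φ, and it corrects the
obstruction because the defect of Φ does not vanish (`dist_sq_le`): 𝒜Φ = DΦ and (DΦ | Φ) = ∫h = 0
turn the same reflection identity into a lower bound for the distance from Φ to the image of the
negative space under P.

The analytic input is that the L² norm on Ω is bounded by finitely many means plus ε times the
gradient norm (`HasLipschitzBoundary.exists_bound`), which gives Rellich compactness, and the trace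
inequality (`HasLipschitzBoundary.exists_trace_bound`). A compactness argument of Peetre's type then
gives the completeness of ℋ. -/

open scoped ENNReal NNReal

/-! ### Abstract spectral theory: coercivity, defect and solvability -/

/-- A symmetric linear relation `graph` on a Hilbert space, together with a projection `P`, a bounded
operator `D` that measures how far the reflection `2 P - 1` is from anticommuting with the relation,
and a compact partial inverse `T`, relative to the kernel `K`. -/
structure SpectralFrame (E : Type*) [NormedAddCommGroup E] [InnerProductSpace ℝ E] where
  graph : Submodule ℝ (E × E)
  P : E →L[ℝ] E
  D : E →L[ℝ] E
  T : E →L[ℝ] E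
  K : Submodule ℝ E
  finite_kernel : FiniteDimensional ℝ K
  P_idem : ∀ x, P (P x) = P x
  P_symm : ∀ x y, inner ℝ (P x) y = inner ℝ x (P y)
  D_symm : ∀ x y, inner ℝ (D x) y = inner ℝ x (D y)
  D_P : ∀ x y, inner ℝ (D (P x)) (P y) = inner ℝ (D x) y
  graph_symm : ∀ x x' y y', (x, x') ∈ graph → (y, y') ∈ graph → inner ℝ x' y = inner ℝ x y'
  -- With J = 2 P - 1 the left side is (Jx | y); for 𝒜 the right side is ∫ h u².
  graph_flip : ∀ x y, (x, y) ∈ graph → 2 * inner ℝ (P x) y - inner ℝ x y = inner ℝ (D x) x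
  graph_zero : ∀ y, (0, y) ∈ graph → y = 0
  T_compact : IsCompactOperator T
  T_symm : ∀ x y, inner ℝ (T x) y = inner ℝ x (T y)
  T_graph : ∀ x ∈ Kᗮ, (T x, x) ∈ graph
  T_kernel : ∀ x ∈ K, T x = 0
  kernel_graph : ∀ x ∈ K, (x, 0) ∈ graph

namespace SpectralFrame

variable {E : Type*} [NormedAddCommGroup E] [InnerProductSpace ℝ E] (S : SpectralFrame E)

/-- The closed span of the eigenvectors with negative eigenvalue. -/
def neg : Submodule ℝ E :=
  (Submodule.span ℝ {x | ∃ l : ℝ, l < 0 ∧ (x, l • x) ∈ S.graph}).topologicalClosure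

/-- The closed span of the eigenvectors with positive eigenvalue. -/
def pos : Submodule ℝ E :=
  (Submodule.span ℝ {x | ∃ l : ℝ, 0 < l ∧ (x, l • x) ∈ S.graph}).topologicalClosure

instance : FiniteDimensional ℝ S.K := S.finite_kernel

theorem mem_neg {x : E} {l : ℝ} (hl : l < 0) (h : (x, l • x) ∈ S.graph) : x ∈ S.neg :=
  Submodule.le_topologicalClosure _ (Submodule.subset_span ⟨l, hl, h⟩)

theorem mem_pos {x : E} {l : ℝ} (hl : 0 < l) (h : (x, l • x) ∈ S.graph) : x ∈ S.pos :=
  Submodule.le_topologicalClosure _ (Submodule.subset_span ⟨l, hl, h⟩)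

theorem T_mem_kernel_orthogonal (x : E) : S.T x ∈ S.Kᗮ := by
  intro y hy
  rw [← S.T_symm, S.T_kernel y hy, inner_zero_left]

/-- By symmetry x is orthogonal to every value of the relation, and `T_graph` makes every vector of
`Kᗮ` such a value. Since `K` is finite dimensional, `Kᗮᗮ = K`. -/
theorem mem_kernel_of_graph {x : E} (h : (x, 0) ∈ S.graph) : x ∈ S.K := by
  rw [← Submodule.orthogonal_orthogonal S.K]
  intro y hy
  have := S.graph_symm _ _ _ _ h (S.T_graph y hy)
  rw [inner_zero_left] at this
  rw [real_inner_comm, ← this]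

theorem inner_eigenvectors {x y : E} {l m : ℝ} (hx : (x, l • x) ∈ S.graph)
    (hy : (y, m • y) ∈ S.graph) (hlm : l ≠ m) : inner ℝ x y = 0 := by
  have := S.graph_symm _ _ _ _ hx hy
  rw [real_inner_smul_left, real_inner_smul_right] at this
  have h2 : (l - m) * inner ℝ x y = 0 := by linarith
  exact (mul_eq_zero.1 h2).resolve_left (sub_ne_zero.2 hlm)

theorem eigenvector_mem_kernel_orthogonal {x : E} {l : ℝ} (hx : (x, l • x) ∈ S.graph)
    (hl : l ≠ 0) : x ∈ S.Kᗮ := by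
  intro y hy
  have h0 : (y, (0 : ℝ) • y) ∈ S.graph := by rw [zero_smul]; exact S.kernel_graph y hy
  exact S.inner_eigenvectors h0 hx hl.symm

/-- The difference `l • T x - x` is sent to zero by the relation, hence lies in `K`; it also lies in
`Kᗮ`. -/
theorem T_eigenvector {x : E} {l : ℝ} (hx : (x, l • x) ∈ S.graph) (hl : l ≠ 0) :
    l • S.T x = x := by
  have hK := S.eigenvector_mem_kernel_orthogonal hx hl
  have h1 := S.graph.sub_mem (S.graph.smul_mem l (S.T_graph x hK)) hx
  rw [Prod.smul_mk, Prod.mk_sub_mk, sub_self] at h1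
  have h2 := S.mem_kernel_of_graph h1
  have h3 : l • S.T x - x ∈ S.Kᗮ :=
    Submodule.sub_mem _ (Submodule.smul_mem _ _ (S.T_mem_kernel_orthogonal x)) hK
  have h4 : inner ℝ (l • S.T x - x) (l • S.T x - x) = 0 := h3 _ h2
  exact sub_eq_zero.1 (inner_self_eq_zero.1 h4)

/-- A lower bound for the absolute values of the nonzero eigenvalues. -/
noncomputable def gap : ℝ := (‖S.T‖ + 1)⁻¹

theorem gap_pos : 0 < S.gap := by unfold gap; positivity

/-- An eigenvalue `l ≠ 0` of the relation gives the eigenvalue `l⁻¹` of `T`, so 1 ≤ |l| ‖T‖. The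
added 1 in `gap` only covers T = 0. -/
theorem gap_le {x : E} {l : ℝ} (hx : (x, l • x) ∈ S.graph) (hl : l ≠ 0) (h0 : x ≠ 0) :
    S.gap ≤ |l| := by
  have h1 : ‖x‖ ≤ |l| * (‖S.T‖ * ‖x‖) := by
    conv_lhs => rw [← S.T_eigenvector hx hl, norm_smul, Real.norm_eq_abs]
    gcongr
    exact S.T.le_opNorm x
  have hx0 : 0 < ‖x‖ := norm_pos_iff.2 h0
  have h2 : 1 ≤ |l| * ‖S.T‖ := by
    by_contra! hc
    nlinarith
  have h3 : 0 ≤ ‖S.T‖ := norm_nonneg _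
  unfold gap
  rw [inv_le_iff_one_le_mul₀ (by positivity)]
  nlinarith [abs_nonneg l]

/-- A vector orthogonal to a set is orthogonal to its closed span. -/
theorem _root_.Submodule.inner_eq_zero_of_mem_closure_span {s : Set E} {y : E}
    (h : ∀ x ∈ s, inner ℝ x y = 0) {x : E}
    (hx : x ∈ (Submodule.span ℝ s).topologicalClosure) : inner ℝ x y = 0 := by
  have h1 : y ∈ (Submodule.span ℝ s)ᗮ := by
    rw [Submodule.mem_orthogonal]
    intro u hu
    induction hu using Submodule.span_induction with
    | mem x hx => exact h x hx
    | zero => simp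
    | add x y _ _ hx hy => rw [inner_add_left, hx, hy, add_zero]
    | smul a x _ hx => rw [real_inner_smul_left, hx, mul_zero]
  rw [← Submodule.orthogonal_closure] at h1
  exact h1 x hx

theorem inner_neg_pos {x y : E} (hx : x ∈ S.neg) (hy : y ∈ S.pos) : inner ℝ x y = 0 := by
  refine Submodule.inner_eq_zero_of_mem_closure_span ?_ hx
  rintro x ⟨l, hl, hx⟩
  rw [real_inner_comm]
  refine Submodule.inner_eq_zero_of_mem_closure_span ?_ hy
  rintro y ⟨m, hm, hy⟩
  exact S.inner_eigenvectors hy hx (by linarith)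

theorem inner_neg_kernel {x y : E} (hx : x ∈ S.neg) (hy : y ∈ S.K) : inner ℝ x y = 0 := by
  refine Submodule.inner_eq_zero_of_mem_closure_span ?_ hx
  rintro x ⟨l, hl, hx⟩
  rw [real_inner_comm]
  exact S.eigenvector_mem_kernel_orthogonal hx hl.ne y hy

theorem inner_pos_kernel {x y : E} (hx : x ∈ S.pos) (hy : y ∈ S.K) : inner ℝ x y = 0 := by
  refine Submodule.inner_eq_zero_of_mem_closure_span ?_ hx
  rintro x ⟨l, hl, hx⟩
  rw [real_inner_comm]
  exact S.eigenvector_mem_kernel_orthogonal hx hl.ne' y hy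

theorem add_mem_pos_orthogonal {n k : E} (hn : n ∈ S.neg) (hk : k ∈ S.K) : n + k ∈ S.posᗮ := by
  intro y hy
  rw [inner_add_right, S.inner_pos_kernel hy hk, real_inner_comm, S.inner_neg_pos hn hy, add_zero]

/-- The inner product of two combinations of pairwise orthogonal vectors. -/
theorem inner_sum_smul_of_orthogonal {ι : Type*} [Fintype ι] {e : ι → E}
    (he : Pairwise fun i j => inner ℝ (e i) (e j) = 0) (a b : ι → ℝ) :
    inner ℝ (∑ i, a i • e i) (∑ i, b i • e i) = ∑ i, a i * b i * ‖e i‖ ^ 2 := by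
  rw [sum_inner]
  refine Finset.sum_congr rfl fun i _ => ?_
  rw [inner_sum, Finset.sum_eq_single i]
  · rw [real_inner_smul_left, real_inner_smul_right, real_inner_self_eq_norm_sq]
    ring
  · intro j _ hj
    rw [real_inner_smul_left, real_inner_smul_right, he hj.symm]
    ring
  · simp

/-- A combination of eigenvectors is a sum of eigenvectors with different eigenvalues. -/
theorem exists_orthogonal_sum {p : ℝ → Prop} {x : E}
    (hx : x ∈ Submodule.span ℝ {x | ∃ l : ℝ, p l ∧ (x, l • x) ∈ S.graph}) :
    ∃ (ι : Type) (_ : Fintype ι) (l : ι → ℝ) (e : ι → E), (∀ i, p (l i)) ∧ (∀ i, e i ≠ 0) ∧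
      (∀ i, (e i, l i • e i) ∈ S.graph) ∧ (Pairwise fun i j => inner ℝ (e i) (e j) = 0) ∧
      x = ∑ i, e i := by
  let eig : {l : ℝ // p l} → Submodule ℝ E := fun l =>
    S.graph.comap (LinearMap.prod LinearMap.id (l.1 • LinearMap.id))
  have hle : Submodule.span ℝ {x | ∃ l : ℝ, p l ∧ (x, l • x) ∈ S.graph} ≤ iSup eig := by
    rw [Submodule.span_le]
    rintro y ⟨l, hl, hy⟩
    exact Submodule.mem_iSup_of_mem ⟨l, hl⟩ hy
  obtain ⟨f, hf, rfl⟩ := (Submodule.mem_iSup_iff_exists_finsupp eig x).1 (hle hx)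
  refine ⟨f.support, inferInstance, fun i => i.1.1, fun i => f i, fun i => i.1.2,
    fun i => Finsupp.mem_support_iff.1 i.2, fun i => hf i, fun i j hij => ?_, ?_⟩
  · exact S.inner_eigenvectors (hf i) (hf j) fun h => hij (Subtype.ext (Subtype.ext h))
  · rw [Finsupp.sum, ← Finset.sum_coe_sort]

/-- Combinations of eigenvectors lie in finite dimensional invariant subspaces, on which the
relation is negative. -/
theorem exists_invariant {x : E}
    (hx : x ∈ Submodule.span ℝ {x | ∃ l : ℝ, l < 0 ∧ (x, l • x) ∈ S.graph}) :
    ∃ F : Submodule ℝ E, FiniteDimensional ℝ F ∧ x ∈ F ∧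
      ∀ z ∈ F, ∃ y ∈ F, (z, y) ∈ S.graph ∧ inner ℝ z y ≤ -(S.gap * ‖z‖ ^ 2) := by
  obtain ⟨ι, _, l, e, hl, he, hg, ho, rfl⟩ := S.exists_orthogonal_sum hx
  refine ⟨LinearMap.range (Fintype.linearCombination ℝ e), inferInstance, ⟨fun _ => 1, ?_⟩, ?_⟩
  · simp [Fintype.linearCombination_apply]
  · rintro _ ⟨a, rfl⟩
    refine ⟨_, ⟨fun i => a i * l i, rfl⟩, ?_, ?_⟩
    · simp only [Fintype.linearCombination_apply]
      rw [show ((∑ i, a i • e i, ∑ i, (a i * l i) • e i) : E × E)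
        = ∑ i, a i • (e i, l i • e i) by
          ext <;> simp [Prod.fst_sum, Prod.snd_sum, smul_smul]]
      exact Submodule.sum_mem _ fun i _ => Submodule.smul_mem _ _ (hg i)
    · simp only [Fintype.linearCombination_apply]
      rw [← real_inner_self_eq_norm_sq, inner_sum_smul_of_orthogonal ho,
        inner_sum_smul_of_orthogonal ho, Finset.mul_sum, ← Finset.sum_neg_distrib]
      refine Finset.sum_le_sum fun i _ => ?_
      have h1 := S.gap_le (hg i) (hl i).ne (he i)
      rw [abs_of_neg (hl i)] at h1
      nlinarith [mul_nonneg (mul_self_nonneg (a i)) (sq_nonneg ‖e i‖)]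

theorem norm_P_sq (x : E) : ‖S.P x‖ ^ 2 = inner ℝ (S.P x) x := by
  rw [← real_inner_self_eq_norm_sq, S.P_symm, S.P_idem, ← S.P_symm]

/-- By `D_P` the form of `D` sees only the component `P x`; the factor ‖P x‖² instead of ‖x‖² is
what bounds κ from below later. -/
theorem inner_D_self_le (x : E) : inner ℝ (S.D x) x ≤ ‖S.D‖ * ‖S.P x‖ ^ 2 := by
  rw [← S.D_P, sq, ← mul_assoc]
  refine (real_inner_le_norm _ _).trans ?_
  gcongr
  exact S.D.le_opNorm _

/-- A lower bound for `P` on the span of the eigenvectors with negative eigenvalue. -/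
noncomputable def coercivity : ℝ := S.gap / (‖S.D‖ + 2 * S.gap)

theorem coercivity_pos : 0 < S.coercivity := by
  have := S.gap_pos
  unfold coercivity
  positivity

/-- At an eigenvector z of the compressed P with least eigenvalue κ, invariance allows replacing (P
z | y) by κ (z | y) in `graph_flip`. If κ < 1/2, negativity of the relation then gives (1 - 2κ)
`gap` ≤ ‖D‖ κ. -/
theorem coercivity_le_of_invariant {F : Submodule ℝ E} [FiniteDimensional ℝ F]
    (hF : ∀ z ∈ F, ∃ y ∈ F, (z, y) ∈ S.graph ∧ inner ℝ z y ≤ -(S.gap * ‖z‖ ^ 2))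
    {x : E} (hx : x ∈ F) : S.coercivity * ‖x‖ ^ 2 ≤ inner ℝ (S.P x) x := by
  rcases eq_or_ne x 0 with rfl | hx0
  · simp
  have : Nontrivial F := ⟨⟨⟨x, hx⟩, 0, fun h => hx0 (congrArg Subtype.val h)⟩⟩
  let C : F →ₗ[ℝ] F := F.orthogonalProjectionOnto.toLinearMap ∘ₗ S.P.toLinearMap ∘ₗ F.subtype
  have hC : ∀ z w : F, inner ℝ (C z) w = inner ℝ (S.P z) (w : E) := fun z w =>
    Submodule.inner_orthogonalProjectionOnto_eq_of_mem_right w (S.P z)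
  have hCs : C.IsSymmetric := fun z w => by
    rw [hC, real_inner_comm (C w) z, hC, S.P_symm, real_inner_comm]
  have hbdd : BddBelow (Set.range fun z : {z : F // z ≠ 0} =>
      RCLike.re (inner ℝ (C z) z) / ‖(z : F)‖ ^ 2) := by
    refine ⟨0, ?_⟩
    rintro _ ⟨z, rfl⟩
    have : 0 ≤ inner ℝ (C z) (z : F) := by
      rw [hC, ← norm_P_sq]
      positivity
    exact div_nonneg this (by positivity)
  -- In finite dimension the infimum of the Rayleigh quotient is attained as an eigenvalue.
  have he := hCs.hasEigenvalue_iInf_of_finiteDimensional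
  set κ : ℝ := ⨅ z : {z : F // z ≠ 0}, RCLike.re (inner ℝ (C z) z) / ‖(z : F)‖ ^ 2
  have hκ : κ ≤ inner ℝ (S.P x) x / ‖x‖ ^ 2 := by
    refine (ciInf_le hbdd ⟨⟨x, hx⟩, fun h => hx0 (congrArg Subtype.val h)⟩).trans_eq ?_
    change inner ℝ (C ⟨x, hx⟩) (⟨x, hx⟩ : F) / ‖x‖ ^ 2 = _
    rw [hC]
  have hxn : 0 < ‖x‖ ^ 2 := by positivity
  suffices S.coercivity ≤ κ by
    rw [le_div_iff₀ hxn] at hκ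
    nlinarith
  obtain ⟨z, hz⟩ := he.exists_hasEigenvector
  have hzC : C z = κ • z := hz.apply_eq_smul
  have hz0 : 0 < ‖(z : E)‖ ^ 2 := by
    have : (z : E) ≠ 0 := fun h => hz.2 (Subtype.ext h)
    positivity
  obtain ⟨y, hy, hg, hle⟩ := hF z z.2
  -- This uses y ∈ F: only there does the compression compute (P z | y).
  have h1 : inner ℝ (S.P z) y = κ * inner ℝ (z : E) y := by
    have := hC z ⟨y, hy⟩
    rw [hzC, real_inner_smul_left] at this
    exact this.symm
  have h2 : ‖S.P z‖ ^ 2 = κ * ‖(z : E)‖ ^ 2 := by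
    have := hC z z
    rw [hzC, real_inner_smul_left, real_inner_self_eq_norm_sq] at this
    rw [norm_P_sq, ← this]
    rfl
  have h3 := S.graph_flip _ _ hg
  have h4 := S.inner_D_self_le z
  rw [← h3, h1, h2] at h4
  have hgap := S.gap_pos
  have hD : 0 ≤ ‖S.D‖ := norm_nonneg _
  unfold coercivity
  rw [div_le_iff₀ (by positivity)]
  by_contra! hc
  have hκ2 : 0 < 1 - 2 * κ := by
    by_contra! h
    nlinarith
  have h5 : (1 - 2 * κ) * (S.gap * ‖(z : E)‖ ^ 2) ≤ ‖S.D‖ * (κ * ‖(z : E)‖ ^ 2) := by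
    nlinarith
  have h6 : (1 - 2 * κ) * S.gap ≤ ‖S.D‖ * κ := by
    by_contra! h
    nlinarith
  nlinarith

theorem coercivity_le {x : E} (hx : x ∈ S.neg) :
    S.coercivity * ‖x‖ ^ 2 ≤ inner ℝ (S.P x) x := by
  have hc : IsClosed {x : E | S.coercivity * ‖x‖ ^ 2 ≤ inner ℝ (S.P x) x} :=
    isClosed_le (by fun_prop) (by fun_prop)
  -- The constant does not depend on the invariant subspace, so the bound passes to the closure.
  refine closure_minimal (fun y hy => ?_) hc hx
  obtain ⟨F, hfd, hyF, hF⟩ := S.exists_invariant hy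
  exact S.coercivity_le_of_invariant hF hyF

/-- `T` is positive semidefinite on the positive subspace. -/
theorem T_nonneg {x : E} (hx : x ∈ S.pos) : 0 ≤ inner ℝ (S.T x) x := by
  have hc : IsClosed {x : E | 0 ≤ inner ℝ (S.T x) x} :=
    isClosed_le (by fun_prop) (by fun_prop)
  refine closure_minimal (fun y hy => ?_) hc hx
  obtain ⟨ι, _, l, e, hl, he, hg, ho, rfl⟩ := S.exists_orthogonal_sum hy
  have h1 : S.T (∑ i, e i) = ∑ i, (l i)⁻¹ • e i := by
    rw [map_sum]
    refine Finset.sum_congr rfl fun i _ => ?_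
    rw [eq_inv_smul_iff₀ (hl i).ne']
    exact S.T_eigenvector (hg i) (hl i).ne'
  have h2 := inner_sum_smul_of_orthogonal ho (fun i => (l i)⁻¹) (fun _ => 1)
  simp only [one_smul] at h2
  rw [Set.mem_ofPred_eq, h1, h2]
  refine Finset.sum_nonneg fun i _ => ?_
  have := hl i
  positivity

/-- `T` is definite on the positive subspace. -/
theorem eq_zero_of_inner_T_nonpos {x : E} (hx : x ∈ S.pos) (h : inner ℝ (S.T x) x ≤ 0) :
    x = 0 := by
  have key : ∀ e ∈ {x | ∃ l : ℝ, 0 < l ∧ (x, l • x) ∈ S.graph}, inner ℝ e x = 0 := by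
    rintro e ⟨l, hl, he⟩
    have hT : S.T e = l⁻¹ • e := by
      rw [eq_inv_smul_iff₀ hl.ne']
      exact S.T_eigenvector he hl.ne'
    -- Cauchy-Schwarz for the semidefinite form of T on the positive space: expand (T(x - t e) | x -
    -- t e) ≥ 0 and take the minimizing t = (e | x) / ‖e‖².
    have h1 : ∀ t : ℝ, 0 ≤ inner ℝ (S.T x) x - 2 * t * (l⁻¹ * inner ℝ e x)
        + t ^ 2 * (l⁻¹ * ‖e‖ ^ 2) := by
      intro t
      have := S.T_nonneg (S.pos.sub_mem hx (S.pos.smul_mem t (S.mem_pos hl he)))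
      rw [map_sub, map_smul, hT, inner_sub_left, inner_sub_right, inner_sub_right,
        real_inner_smul_right, S.T_symm x e, hT, real_inner_smul_left, real_inner_smul_left,
        real_inner_smul_left, real_inner_smul_left, real_inner_smul_right,
        real_inner_smul_right, real_inner_self_eq_norm_sq, real_inner_comm x e] at this
      rw [real_inner_comm x e]
      linarith
    rcases eq_or_ne e 0 with rfl | he0
    · simp
    have hn : 0 < ‖e‖ ^ 2 := by positivity
    have h2 := h1 (inner ℝ e x / ‖e‖ ^ 2)
    have h3 : inner ℝ (S.T x) x - 2 * (inner ℝ e x / ‖e‖ ^ 2) * (l⁻¹ * inner ℝ e x)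
        + (inner ℝ e x / ‖e‖ ^ 2) ^ 2 * (l⁻¹ * ‖e‖ ^ 2)
        = inner ℝ (S.T x) x - inner ℝ e x ^ 2 / (l * ‖e‖ ^ 2) := by
      field_simp
      ring
    rw [h3] at h2
    have h4 : inner ℝ e x ^ 2 / (l * ‖e‖ ^ 2) ≤ 0 := by linarith
    rw [div_le_iff₀ (by positivity), zero_mul] at h4
    nlinarith
  exact inner_self_eq_zero.1 (Submodule.inner_eq_zero_of_mem_closure_span key hx)

theorem norm_P_le (x : E) : ‖S.P x‖ ≤ ‖x‖ := by
  have h := (S.norm_P_sq x).trans_le (real_inner_le_norm _ _)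
  by_contra! hc
  nlinarith [norm_nonneg x, norm_nonneg (S.P x)]

/-- A quantitative form of the fact that a vector `u` on which the form of `D` vanishes is not in
the image of the negative subspace under `P`. -/
theorem dist_sq_le {u : E} (hP : S.P u = u) (hD : inner ℝ (S.D u) u = 0)
    (hg : ∀ x y, (x, y) ∈ S.graph → inner ℝ u y = inner ℝ (S.D u) x) {x : E} (hx : x ∈ S.neg) :
    S.gap * (‖u‖ ^ 2 / (4 * (‖S.D‖ + S.gap))) ≤ ‖u - S.P x‖ ^ 2 := by
  have hc : IsClosed {x : E | S.gap * (‖u‖ ^ 2 / (4 * (‖S.D‖ + S.gap))) ≤ ‖u - S.P x‖ ^ 2} :=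
    isClosed_le (by fun_prop) (by fun_prop)
  refine closure_minimal (fun m hm => ?_) hc hx
  obtain ⟨F, hfd, hmF, hF⟩ := S.exists_invariant hm
  let F' : Submodule ℝ E := F.map (S.P : E →ₗ[ℝ] E)
  -- The best approximation P n of u from P(F), with remainder r. The goal is a lower bound for r
  -- that does not depend on F.
  obtain ⟨q, ⟨n, hn, rfl⟩, r, hr, hur⟩ := F'.exists_add_mem_mem_orthogonal u
  replace hur : u = S.P n + r := hur
  have hru : r = u - S.P n := by rw [hur]; abel
  have hPr : S.P r = r := by rw [hru, map_sub, hP, S.P_idem]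
  -- Since P r = r, orthogonality to P(F) is orthogonality to F itself, in particular to the image
  -- of n under the relation.
  have hrF : ∀ y ∈ F, inner ℝ r y = 0 := fun y hy => by
    rw [← hPr, S.P_symm, real_inner_comm]
    exact hr _ ⟨y, hy, rfl⟩
  obtain ⟨y, hy, hny, hle⟩ := hF n hn
  have h1 := S.graph_flip _ _ hny
  have h2 : inner ℝ (S.P n) y = inner ℝ (S.D u) n := by
    have := hrF y hy
    rw [hru, inner_sub_left, hg _ _ hny] at this
    linarith
  -- The term (D u | u) drops out by hypothesis. With `h1` and `h2` the right side equals -(n | y),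
  -- which is at least `gap` ‖n‖².
  have h3 : inner ℝ (S.D r) r = inner ℝ (S.D n) n - 2 * inner ℝ (S.D u) n := by
    have e1 : inner ℝ (S.D u) (S.P n) = inner ℝ (S.D u) n := by
      conv_lhs => rw [← hP]
      rw [S.D_P]
    have e2 : inner ℝ (S.D (S.P n)) u = inner ℝ (S.D u) n := by
      rw [S.D_symm, real_inner_comm, e1]
    rw [hru, map_sub, inner_sub_left, inner_sub_right, inner_sub_right, hD, S.D_P, e1, e2]
    ring
  have h4 := S.inner_D_self_le r
  rw [hPr] at h4
  have h5 : S.gap * ‖n‖ ^ 2 ≤ ‖S.D‖ * ‖r‖ ^ 2 := by linarith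
  have h6 : ‖u‖ ≤ ‖n‖ + ‖r‖ := by
    rw [hur]
    exact (norm_add_le _ _).trans (add_le_add (S.norm_P_le n) le_rfl)
  -- Pythagoras: P m is no better an approximation than P n.
  have h7 : ‖r‖ ^ 2 ≤ ‖u - S.P m‖ ^ 2 := by
    have e1 : u - S.P m = r + S.P (n - m) := by rw [map_sub, hur]; abel
    have e2 : inner ℝ r (S.P (n - m)) = 0 := by
      rw [← S.P_symm, hPr]
      exact hrF _ (F.sub_mem hn hmF)
    rw [e1, norm_add_sq_real, e2]
    nlinarith [sq_nonneg ‖S.P (n - m)‖]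
  have hgap := S.gap_pos
  have hDn : 0 ≤ ‖S.D‖ := norm_nonneg _
  refine le_trans ?_ h7
  rw [← mul_div_assoc, div_le_iff₀ (by positivity)]
  have h8 : ‖u‖ ^ 2 ≤ 2 * ‖n‖ ^ 2 + 2 * ‖r‖ ^ 2 := by
    nlinarith [norm_nonneg u, norm_nonneg n, norm_nonneg r, sq_nonneg (‖n‖ - ‖r‖)]
  nlinarith [sq_nonneg ‖r‖, mul_nonneg hDn (sq_nonneg ‖r‖), mul_nonneg hgap.le (sq_nonneg ‖r‖)]

variable [CompleteSpace E]

instance : S.neg.HasOrthogonalProjection :=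
  inferInstanceAs (Submodule.topologicalClosure _).HasOrthogonalProjection

instance : S.pos.HasOrthogonalProjection :=
  inferInstanceAs (Submodule.topologicalClosure _).HasOrthogonalProjection

/-- The eigenvectors span a dense subspace. -/
theorem eq_zero_of_orthogonal {x : E} (hn : x ∈ S.negᗮ) (hp : x ∈ S.posᗮ) (hk : x ∈ S.Kᗮ) :
    x = 0 := by
  have hs : (S.T : E →ₗ[ℝ] E).IsSymmetric := fun x y => S.T_symm x y
  have hb := ContinuousLinearMap.orthogonalComplement_iSup_eigenspaces_eq_bot S.T_compact hs
  rw [← Submodule.mem_bot ℝ, ← hb, ← Submodule.iInf_orthogonal, Submodule.mem_iInf]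
  intro μ y hy
  rw [Module.End.mem_eigenspace_iff] at hy
  replace hy : S.T y = μ • y := hy
  rcases eq_or_ne μ 0 with rfl | hμ
  -- The kernel of T is K: the component b of y in Kᗮ satisfies (T b, b) = (0, b), and `graph_zero`
  -- gives b = 0.
  · refine hk y ?_
    obtain ⟨a, ha, b, hb, rfl⟩ := S.K.exists_add_mem_mem_orthogonal y
    have hg := S.T_graph b hb
    rw [map_add, S.T_kernel a ha, zero_add, zero_smul] at hy
    rw [hy] at hg
    rw [S.graph_zero b hg, add_zero]
    exact ha
  -- An eigenvector of T for μ ≠ 0 is an eigenvector of the relation for μ⁻¹, so it is in the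
  -- positive or the negative space.
  · have hyK : y ∈ S.Kᗮ := by
      rw [← inv_smul_smul₀ hμ y, ← hy]
      exact Submodule.smul_mem _ _ (S.T_mem_kernel_orthogonal y)
    have hg := S.graph.smul_mem μ⁻¹ (S.T_graph y hyK)
    rw [hy, Prod.smul_mk, inv_smul_smul₀ hμ] at hg
    rcases lt_or_gt_of_ne hμ with h | h
    · exact hn y (S.mem_neg (inv_lt_zero.2 h) hg)
    · exact hp y (S.mem_pos (inv_pos.2 h) hg)

/-- Project successively on the negative space and on K; what remains is orthogonal to all
eigenvectors and vanishes by `eq_zero_of_orthogonal`. -/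
theorem exists_add_of_mem_pos_orthogonal {x : E} (hx : x ∈ S.posᗮ) :
    ∃ n ∈ S.neg, ∃ k ∈ S.K, x = n + k := by
  obtain ⟨n, hn, a, ha, rfl⟩ := S.neg.exists_add_mem_mem_orthogonal x
  obtain ⟨k, hk, b, hb, rfl⟩ := S.K.exists_add_mem_mem_orthogonal a
  refine ⟨n, hn, k, hk, ?_⟩
  have hb0 : b = 0 := by
    refine S.eq_zero_of_orthogonal (fun y hy => ?_) (fun y hy => ?_) hb
    · have := ha y hy
      rwa [inner_add_right, S.inner_neg_kernel hy hk, zero_add] at this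
    · have := hx y hy
      rwa [inner_add_right, inner_add_right, S.inner_pos_kernel hy hk, real_inner_comm,
        S.inner_neg_pos hn hy, zero_add, zero_add] at this
  rw [hb0, add_zero]

theorem exists_add_of_mem_neg_orthogonal {x : E} (hx : x ∈ S.negᗮ) :
    ∃ p ∈ S.pos, ∃ k ∈ S.K, x = p + k := by
  obtain ⟨p, hp, a, ha, rfl⟩ := S.pos.exists_add_mem_mem_orthogonal x
  obtain ⟨k, hk, b, hb, rfl⟩ := S.K.exists_add_mem_mem_orthogonal a
  refine ⟨p, hp, k, hk, ?_⟩
  have hb0 : b = 0 := by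
    refine S.eq_zero_of_orthogonal (fun y hy => ?_) (fun y hy => ?_) hb
    · have := hx y hy
      rwa [inner_add_right, inner_add_right, S.inner_neg_kernel hy hk,
        S.inner_neg_pos hy hp, zero_add, zero_add] at this
    · have := ha y hy
      rwa [inner_add_right, S.inner_pos_kernel hy hk, zero_add] at this
  rw [hb0, add_zero]

/-- The compression of `P` to the negative subspace. -/
noncomputable def compression : S.neg →L[ℝ] S.neg :=
  S.neg.orthogonalProjectionOnto ∘L S.P ∘L S.neg.subtypeL

theorem inner_compression (x y : S.neg) :
    inner ℝ (S.compression x) y = inner ℝ (S.P x) (y : E) :=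
  Submodule.inner_orthogonalProjectionOnto_eq_of_mem_right y (S.P x)

instance : CompleteSpace S.neg :=
  (Submodule.isClosed_topologicalClosure _).completeSpace_coe

/-- Lax-Milgram for the form (P x | y) on the negative space, coercive by `coercivity_le`. -/
theorem compression_isInvertible : S.compression.IsInvertible := by
  let b : S.neg →L[ℝ] S.neg →L[ℝ] ℝ := (innerSL ℝ) ∘L S.compression
  have hb : ∀ x y, b x y = inner ℝ (S.compression x) y := fun _ _ => rfl
  have hco : IsCoercive b := by
    refine ⟨S.coercivity, S.coercivity_pos, fun x => ?_⟩
    rw [hb, inner_compression, mul_assoc, ← sq]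
    exact S.coercivity_le x.2
  refine ⟨hco.continuousLinearEquivOfBilin, ?_⟩
  ext1 x
  refine ext_inner_right ℝ fun y => ?_
  exact hco.continuousLinearEquivOfBilin_apply x y

/-- The inverse of the compression, extended by zero to the orthogonal complement. -/
noncomputable def B : E →L[ℝ] E :=
  S.neg.subtypeL ∘L S.compression.inverse ∘L S.neg.orthogonalProjectionOnto

theorem B_mem (x : E) : S.B x ∈ S.neg := Subtype.mem _

/-- This is the variational characterization of B₋; the arguments below need only it and `B_mem`. -/
theorem inner_P_B (x : E) {y : E} (hy : y ∈ S.neg) :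
    inner ℝ (S.P (S.B x)) y = inner ℝ x y := by
  have h1 := S.inner_compression (S.compression.inverse (S.neg.orthogonalProjectionOnto x)) ⟨y, hy⟩
  rw [S.compression_isInvertible.self_apply_inverse] at h1
  exact h1.symm.trans
    (Submodule.inner_orthogonalProjectionOnto_eq_of_mem_right (⟨y, hy⟩ : S.neg) x)

/-- Coercivity makes P injective on the negative space, where the difference of the two candidates
lies. -/
theorem eq_B_of_mem {x n : E} (hn : n ∈ S.neg) (h : S.P n = S.P x) : n = S.B (S.P x) := by
  have hd : S.B (S.P x) - n ∈ S.neg := Submodule.sub_mem _ (S.B_mem _) hn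
  have h1 := S.coercivity_le hd
  rw [map_sub, inner_sub_left, S.inner_P_B _ hd, h, sub_self] at h1
  have h2 : ‖S.B (S.P x) - n‖ ^ 2 ≤ 0 := by
    by_contra! hc
    nlinarith [S.coercivity_pos]
  have h3 : ‖S.B (S.P x) - n‖ = 0 := by nlinarith [norm_nonneg (S.B (S.P x) - n)]
  exact (sub_eq_zero.1 (norm_eq_zero.1 h3)).symm

/-- The part of `P x` that cannot be reached from the negative subspace. -/
theorem residual_mem (x : E) : S.P x - S.P (S.B (S.P x)) ∈ S.negᗮ := by
  intro y hy
  rw [real_inner_comm, inner_sub_left, S.inner_P_B _ hy, sub_self]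

theorem inner_B_of_mem_orthogonal (x : E) {w : E} (hP : S.P w = w) (hw : w ∈ S.negᗮ) :
    inner ℝ (S.P (S.B x)) w = 0 := by
  rw [S.P_symm, hP]
  exact hw _ (S.B_mem x)

theorem P_residual (x : E) : S.P (S.P x - S.P (S.B (S.P x))) = S.P x - S.P (S.B (S.P x)) := by
  rw [map_sub, S.P_idem, S.P_idem]

/-- Unique solvability, if the kernel is trivial and no vector of the range of `P` is orthogonal to
the negative subspace. -/
theorem solution_iff_of_forall_eq_zero (hK : S.K = ⊥)
    (h0 : ∀ w, S.P w = w → w ∈ S.negᗮ → w = 0) (x y : E) :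
    S.P y = S.P x ∧ y ∈ S.posᗮ ↔ y = S.B (S.P x) := by
  constructor
  · rintro ⟨h1, h2⟩
    obtain ⟨n, hn, k, hk, rfl⟩ := S.exists_add_of_mem_pos_orthogonal h2
    rw [hK, Submodule.mem_bot] at hk
    rw [hk, add_zero] at h1 ⊢
    exact S.eq_B_of_mem hn h1
  · rintro rfl
    refine ⟨(sub_eq_zero.1 (h0 _ (S.P_residual x) (S.residual_mem x))).symm, ?_⟩
    simpa using S.add_mem_pos_orthogonal (S.B_mem (S.P x)) S.K.zero_mem

theorem inner_defect {u w : E} (hP : S.P w = w) (hw : w ∈ S.negᗮ) :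
    inner ℝ (u - S.P (S.B u)) w = inner ℝ u w := by
  rw [inner_sub_left, S.inner_B_of_mem_orthogonal u hP hw, sub_zero]

theorem P_defect {u : E} (hu : S.P u = u) :
    S.P (u - S.P (S.B u)) = u - S.P (S.B u) := by
  rw [map_sub, S.P_idem, hu]

theorem defect_mem {u : E} (hu : S.P u = u) : u - S.P (S.B u) ∈ S.negᗮ := by
  have := S.residual_mem u
  rwa [hu] at this

theorem inner_defect_P {u : E} (hu : S.P u = u) (x : E) :
    inner ℝ (u - S.P (S.B u)) (S.P x) = inner ℝ (u - S.P (S.B u)) x := by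
  rw [← S.P_symm, S.P_defect hu]

theorem inner_defect_of_mem {u : E} (hu : S.P u = u) {n : E} (hn : n ∈ S.neg) :
    inner ℝ (u - S.P (S.B u)) n = 0 := by
  rw [real_inner_comm]
  exact S.defect_mem hu n hn

/-- The residual and the defect are both in the range of P and orthogonal to the negative space, and
modulo P of that space they represent `P x` and `u`. So the pairing of either with the other vector
gives the same number. -/
theorem inner_residual {u : E} (hu : S.P u = u) (x : E) :
    inner ℝ u (S.P x - S.P (S.B (S.P x))) = inner ℝ (u - S.P (S.B u)) x := by
  rw [← S.inner_defect (S.P_residual x) (S.residual_mem x), inner_sub_right,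
    S.inner_defect_P hu, S.inner_defect_P hu, S.inner_defect_of_mem hu (S.B_mem _), sub_zero]

/-- Solvability under one linear condition, if the kernel is trivial. -/
theorem solution_iff_of_inner_eq_zero {u : E} (hu : S.P u = u)
    (h0 : ∀ w, S.P w = w → w ∈ S.negᗮ → inner ℝ u w = 0 → w = 0)
    (hK : S.K = ⊥) (x : E) :
    ((∃ y, S.P y = S.P x ∧ y ∈ S.posᗮ) ↔ inner ℝ (u - S.P (S.B u)) x = 0) ∧
    (inner ℝ (u - S.P (S.B u)) x = 0 →
      ∀ y, S.P y = S.P x ∧ y ∈ S.posᗮ ↔ y = S.B (S.P x)) := by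
  have key : ∀ y ∈ S.posᗮ, y ∈ S.neg := by
    intro y hy
    obtain ⟨n, hn, k, hk, rfl⟩ := S.exists_add_of_mem_pos_orthogonal hy
    rw [hK, Submodule.mem_bot] at hk
    rwa [hk, add_zero]
  have sol : inner ℝ (u - S.P (S.B u)) x = 0 →
      S.P (S.B (S.P x)) = S.P x ∧ S.B (S.P x) ∈ S.posᗮ := by
    intro hx
    refine ⟨(sub_eq_zero.1 (h0 _ (S.P_residual x) (S.residual_mem x) ?_)).symm, ?_⟩
    · rw [S.inner_residual hu, hx]
    · simpa using S.add_mem_pos_orthogonal (S.B_mem (S.P x)) S.K.zero_mem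
  refine ⟨⟨?_, fun h => ⟨_, sol h⟩⟩, fun h y => ⟨?_, ?_⟩⟩
  · rintro ⟨y, h1, h2⟩
    -- Necessity: the defect is in the range of P, so it sees only P x = P y, and it is orthogonal
    -- to y, which is in the negative space.
    rw [← S.inner_defect_P hu, ← h1, S.inner_defect_P hu, S.inner_defect_of_mem hu (key y h2)]
  · rintro ⟨h1, h2⟩
    exact S.eq_B_of_mem (key y h2) h1
  · rintro rfl
    exact sol h

/-- Unique solvability, if the kernel is spanned by a vector `k` with `P k = u`. -/
theorem solution_iff_of_kernel {u : E} (hu : S.P u = u)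
    (h0 : ∀ w, S.P w = w → w ∈ S.negᗮ → inner ℝ u w = 0 → w = 0)
    {k : E} (hK : S.K = Submodule.span ℝ {k}) (hk : S.P k = u)
    (hd : inner ℝ (u - S.P (S.B u)) u ≠ 0) (x y : E) :
    S.P y = S.P x ∧ y ∈ S.posᗮ ↔ y = S.B (S.P x) +
      (inner ℝ (u - S.P (S.B u)) x / inner ℝ (u - S.P (S.B u)) u) • (k - S.B u) := by
  set v := u - S.P (S.B u) with hv
  have hkK : ∀ t : ℝ, t • k ∈ S.K := fun t => by
    rw [hK]
    exact Submodule.smul_mem _ _ (Submodule.mem_span_singleton_self k)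
  have sol : ∀ t : ℝ, t = inner ℝ v x / inner ℝ v u →
      S.P (S.B (S.P x) + t • (k - S.B u)) = S.P x ∧
        S.B (S.P x) + t • (k - S.B u) ∈ S.posᗮ := by
    rintro t ht
    constructor
    -- The coefficient t makes the residual minus t times the defect orthogonal to u, hence zero by
    -- `h0`; P (k - B u) is exactly the defect.
    · have h1 : S.P x - S.P (S.B (S.P x)) - t • v = 0 := by
        refine h0 _ ?_ ?_ ?_
        · rw [map_sub, S.P_residual, map_smul, S.P_defect hu]
        · exact Submodule.sub_mem _ (S.residual_mem x)
            (Submodule.smul_mem _ _ (S.defect_mem hu))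
        · rw [inner_sub_right, S.inner_residual hu, real_inner_smul_right, ht,
            real_inner_comm v u, div_mul_cancel₀ _ hd, sub_self]
      rw [map_add, map_smul, map_sub, hk, ← hv]
      rw [sub_sub, sub_eq_zero] at h1
      exact h1.symm
    · have := S.add_mem_pos_orthogonal
        (S.neg.sub_mem (S.B_mem (S.P x)) (S.neg.smul_mem t (S.B_mem u))) (hkK t)
      convert this using 1
      rw [smul_sub]
      abel
  constructor
  · rintro ⟨h1, h2⟩
    obtain ⟨s1, s2⟩ := sol _ rfl
    set z := S.B (S.P x) + (inner ℝ v x / inner ℝ v u) • (k - S.B u)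
    obtain ⟨n, hn, k', hk', hyz⟩ :=
      S.exists_add_of_mem_pos_orthogonal (Submodule.sub_mem _ h2 s2)
    rw [hK, Submodule.mem_span_singleton] at hk'
    obtain ⟨t, rfl⟩ := hk'
    have hP : S.P n + t • u = 0 := by
      rw [← hk, ← map_smul, ← map_add, ← hyz, map_sub, h1, s1, sub_self]
    -- Pairing with the defect annihilates P n and leaves t times the nonzero number in `hd`.
    have ht : t = 0 := by
      have h3 : inner ℝ v (S.P n + t • u) = 0 := by rw [hP, inner_zero_right]
      rw [inner_add_right, S.inner_defect_P hu, S.inner_defect_of_mem hu hn, zero_add,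
        real_inner_smul_right] at h3
      exact (mul_eq_zero.1 h3).resolve_right hd
    rw [ht, zero_smul, add_zero] at hP hyz
    have hn0 : n = 0 := by
      have := S.eq_B_of_mem (x := 0) hn (by rw [hP, map_zero])
      rwa [map_zero, map_zero] at this
    rw [hn0] at hyz
    exact sub_eq_zero.1 hyz
  · rintro rfl
    exact sol _ rfl

/-- Orthogonality turns this product into the square norm of the defect, which `dist_sq_le` bounds
from below at the vector `B u`. -/
theorem inner_defect_ne_zero {u : E} (hu : S.P u = u) (hu0 : u ≠ 0)
    (hD : inner ℝ (S.D u) u = 0)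
    (hg : ∀ x y, (x, y) ∈ S.graph → inner ℝ u y = inner ℝ (S.D u) x) :
    inner ℝ (u - S.P (S.B u)) u ≠ 0 := by
  rw [← S.inner_defect (S.P_defect hu) (S.defect_mem hu) |>.trans (real_inner_comm _ _),
    real_inner_self_eq_norm_sq]
  have h1 := S.dist_sq_le hu hD hg (S.B_mem u)
  have h2 := S.gap_pos
  have : 0 < S.gap * (‖u‖ ^ 2 / (4 * (‖S.D‖ + S.gap))) := by positivity
  exact (this.trans_le h1).ne'

end SpectralFrame

/-! ### Squares of L² norms with values in [0, ∞] -/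

/-- Cauchy-Schwarz against the constant function 1. -/
theorem MeasureTheory.lintegral_sq_le_mul_lintegral_sq {α : Type*} [MeasurableSpace α]
    (μ : Measure α) {g : α → ℝ≥0∞} (hg : AEMeasurable g μ) :
    (∫⁻ x, g x ∂μ) ^ 2 ≤ μ Set.univ * ∫⁻ x, g x ^ 2 ∂μ := by
  have h := ENNReal.lintegral_mul_le_Lp_mul_Lq μ Real.HolderConjugate.two_two hg
    (aemeasurable_const (b := (1 : ℝ≥0∞)))
  simp only [Pi.mul_apply, mul_one, lintegral_const, ENNReal.rpow_two, one_pow, one_mul] at h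
  calc (∫⁻ x, g x ∂μ) ^ 2
      ≤ ((∫⁻ x, g x ^ 2 ∂μ) ^ (1 / 2 : ℝ) * μ Set.univ ^ (1 / 2 : ℝ)) ^ 2 := by gcongr
    _ = μ Set.univ * ∫⁻ x, g x ^ 2 ∂μ := by
        rw [mul_pow, ← ENNReal.rpow_two, ← ENNReal.rpow_two, ← ENNReal.rpow_mul,
          ← ENNReal.rpow_mul]
        norm_num
        rw [mul_comm]

theorem ENNReal.add_sq_le (a b : ℝ≥0∞) : (a + b) ^ 2 ≤ 2 * a ^ 2 + 2 * b ^ 2 := by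
  have h := ENNReal.rpow_add_le_mul_rpow_add_rpow a b (p := 2) (by norm_num)
  norm_num at h
  rw [← mul_add]
  exact h

theorem MeasureTheory.Lp.enorm_sq_eq_lintegral {α F : Type*} [MeasurableSpace α]
    [NormedAddCommGroup F] {μ : Measure α} (f : Lp F 2 μ) :
    ‖f‖ₑ ^ 2 = ∫⁻ x, ‖f x‖ₑ ^ 2 ∂μ := by
  rw [Lp.enorm_def, eLpNorm_eq_lintegral_rpow_enorm_toReal (by norm_num) (by norm_num),
    ← ENNReal.rpow_two, ← ENNReal.rpow_mul]
  norm_num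

/-! ### The Poincaré inequality on convex sets -/

namespace Graetz

section Calculus

variable {f : Plane → ℝ}

/-- The difference is the integral of the derivative along the segment; then Cauchy-Schwarz in t. -/
theorem enorm_sub_smul_sq_le (hf : ContDiff ℝ 1 f) (x z : Plane) {s : ℝ} (hs : 0 ≤ s) :
    ‖f (x + s • z) - f x‖ₑ ^ 2 ≤ ENNReal.ofReal s *
      (‖z‖ₑ ^ 2 * ∫⁻ t in Set.Ioc 0 s, ‖fderiv ℝ f (x + t • z)‖ₑ ^ 2) := by
  have hc : Continuous fun t : ℝ => fderiv ℝ f (x + t • z) :=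
    (hf.continuous_fderiv (by simp)).comp (by fun_prop)
  have hd : ∀ t ∈ Set.uIcc 0 s,
      HasDerivAt (fun t : ℝ => f (x + t • z)) (fderiv ℝ f (x + t • z) z) t := by
    intro t _
    have h1 : HasDerivAt (fun t : ℝ => x + t • z) z t := by
      simpa using ((hasDerivAt_id t).smul_const z).const_add x
    exact ((hf.differentiable (by simp)).differentiableAt.hasFDerivAt).comp_hasDerivAt t h1
  have hi := intervalIntegral.integral_eq_sub_of_hasDerivAt hd
    ((hc.clm_apply continuous_const).intervalIntegrable 0 s)
  simp only [zero_smul, add_zero] at hi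
  rw [← hi, intervalIntegral.integral_of_le hs]
  calc ‖∫ t in Set.Ioc 0 s, fderiv ℝ f (x + t • z) z‖ₑ ^ 2
      ≤ (∫⁻ t in Set.Ioc 0 s, ‖fderiv ℝ f (x + t • z)‖ₑ * ‖z‖ₑ) ^ 2 := by
        gcongr
        refine (enorm_integral_le_lintegral_enorm _).trans (lintegral_mono fun t => ?_)
        exact ContinuousLinearMap.le_opENorm _ _
    _ ≤ volume.restrict (Set.Ioc 0 s) Set.univ *
          ∫⁻ t in Set.Ioc 0 s, (‖fderiv ℝ f (x + t • z)‖ₑ * ‖z‖ₑ) ^ 2 :=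
        lintegral_sq_le_mul_lintegral_sq _
          (hc.enorm.measurable.mul_const _).aemeasurable
    _ = ENNReal.ofReal s *
          (‖z‖ₑ ^ 2 * ∫⁻ t in Set.Ioc 0 s, ‖fderiv ℝ f (x + t • z)‖ₑ ^ 2) := by
        simp only [mul_pow]
        rw [lintegral_mul_const _ (hc.enorm.measurable.pow_const 2)]
        simp [mul_comm]

theorem enorm_sub_sq_le (hf : ContDiff ℝ 1 f) (x z : Plane) :
    ‖f (x + z) - f x‖ₑ ^ 2 ≤
      ‖z‖ₑ ^ 2 * ∫⁻ t in Set.Ioc (0 : ℝ) 1, ‖fderiv ℝ f (x + t • z)‖ₑ ^ 2 := by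
  simpa using enorm_sub_smul_sq_le hf x z zero_le_one

/-- The `L²` norm of a difference is controlled by the gradient on the segments. -/
theorem lintegral_sub_sq_le (hf : ContDiff ℝ 1 f) {S D : Set Plane} (hS : MeasurableSet S)
    (hD : MeasurableSet D) {z : Plane} (h : ∀ x ∈ S, ∀ t ∈ Set.Ioc (0 : ℝ) 1, x + t • z ∈ D) :
    ∫⁻ x in S, ‖f (x + z) - f x‖ₑ ^ 2 ≤ ‖z‖ₑ ^ 2 * ∫⁻ x in D, ‖fderiv ℝ f x‖ₑ ^ 2 := by
  have hc : Continuous (fderiv ℝ f) := hf.continuous_fderiv (by simp)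
  have hm : Measurable (fun p : Plane × ℝ => ‖fderiv ℝ f (p.1 + p.2 • z)‖ₑ ^ 2) :=
    ((hc.comp (by fun_prop : Continuous fun p : Plane × ℝ =>
      p.1 + p.2 • z)).enorm.measurable).pow_const 2
  calc ∫⁻ x in S, ‖f (x + z) - f x‖ₑ ^ 2
      ≤ ∫⁻ x in S, ‖z‖ₑ ^ 2 * ∫⁻ t in Set.Ioc (0 : ℝ) 1, ‖fderiv ℝ f (x + t • z)‖ₑ ^ 2 :=
        lintegral_mono fun x => enorm_sub_sq_le hf x z
    _ = ‖z‖ₑ ^ 2 * ∫⁻ t in Set.Ioc (0 : ℝ) 1, ∫⁻ x in S, ‖fderiv ℝ f (x + t • z)‖ₑ ^ 2 := by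
        rw [lintegral_const_mul _ hm.lintegral_prod_right',
          lintegral_lintegral_swap hm.aemeasurable]
    _ ≤ ‖z‖ₑ ^ 2 * ∫⁻ t in Set.Ioc (0 : ℝ) 1, ∫⁻ x in D, ‖fderiv ℝ f x‖ₑ ^ 2 := by
        -- After Fubini, each t contributes an integral over a translate of S contained in D.
        refine mul_le_mul' le_rfl (setLIntegral_mono' measurableSet_Ioc fun t ht => ?_)
        calc ∫⁻ x in S, ‖fderiv ℝ f (x + t • z)‖ₑ ^ 2
            ≤ ∫⁻ x in S, D.indicator (fun y => ‖fderiv ℝ f y‖ₑ ^ 2) (x + t • z) := by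
              refine setLIntegral_mono' hS fun x hx => ?_
              rw [Set.indicator_of_mem (h x hx t ht)]
          _ ≤ ∫⁻ x, D.indicator (fun y => ‖fderiv ℝ f y‖ₑ ^ 2) (x + t • z) :=
              setLIntegral_le_lintegral _ _
          _ = ∫⁻ x in D, ‖fderiv ℝ f x‖ₑ ^ 2 := by
              rw [lintegral_add_right_eq_self (μ := volume)
                (fun y => D.indicator (fun y => ‖fderiv ℝ f y‖ₑ ^ 2) y), lintegral_indicator hD]
    _ = ‖z‖ₑ ^ 2 * ∫⁻ x in D, ‖fderiv ℝ f x‖ₑ ^ 2 := by simp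

/-- The double integral of the squared differences of a function over a convex set. -/
theorem lintegral_lintegral_sub_sq_le (hf : ContDiff ℝ 1 f) {Q : Set Plane} (hQ : MeasurableSet Q)
    (hc : Convex ℝ Q) {R : ℝ} (hR : ∀ x ∈ Q, ∀ y ∈ Q, dist y x < R) :
    ∫⁻ x in Q, ∫⁻ y in Q, ‖f y - f x‖ₑ ^ 2 ≤
      volume (Metric.ball (0 : Plane) R) * (ENNReal.ofReal R ^ 2 *
        ∫⁻ x in Q, ‖fderiv ℝ f x‖ₑ ^ 2) := by
  have hfc := hf.continuous
  have hm : Measurable fun p : Plane × Plane =>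
      Q.indicator (fun y => ‖f y - f p.1‖ₑ ^ 2) (p.1 + p.2) := by
    have e : (fun p : Plane × Plane => Q.indicator (fun y => ‖f y - f p.1‖ₑ ^ 2) (p.1 + p.2)) =
        {p : Plane × Plane | p.1 + p.2 ∈ Q}.indicator
          (fun p => ‖f (p.1 + p.2) - f p.1‖ₑ ^ 2) := by
      ext p
      simp only [Set.indicator, Set.mem_ofPred_eq]
    rw [e]
    refine Measurable.indicator ?_ (measurable_fst.add measurable_snd hQ)
    exact ((by fun_prop : Continuous fun p : Plane × Plane =>
      f (p.1 + p.2) - f p.1).enorm.measurable).pow_const 2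
  calc ∫⁻ x in Q, ∫⁻ y in Q, ‖f y - f x‖ₑ ^ 2
      -- Substitute y = x + z, so that for fixed z the inner integral is that of one difference
      -- quotient; only ‖z‖ < R contributes.
      = ∫⁻ x in Q, ∫⁻ z, Q.indicator (fun y => ‖f y - f x‖ₑ ^ 2) (x + z) := by
        congr 1
        ext x
        rw [lintegral_add_left_eq_self (μ := volume)
          (fun y => Q.indicator (fun y => ‖f y - f x‖ₑ ^ 2) y), lintegral_indicator hQ]
    _ = ∫⁻ z, ∫⁻ x in Q, Q.indicator (fun y => ‖f y - f x‖ₑ ^ 2) (x + z) := by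
        rw [lintegral_lintegral_swap hm.aemeasurable]
    _ ≤ ∫⁻ z, (Metric.ball (0 : Plane) R).indicator (fun _ => ENNReal.ofReal R ^ 2 *
          ∫⁻ x in Q, ‖fderiv ℝ f x‖ₑ ^ 2) z := by
        refine lintegral_mono fun z => ?_
        by_cases hz : z ∈ Metric.ball (0 : Plane) R
        · rw [Set.indicator_of_mem hz]
          have hzR : ‖z‖ₑ ≤ ENNReal.ofReal R := by
            rw [← ofReal_norm]
            exact ENNReal.ofReal_le_ofReal (mem_ball_zero_iff.1 hz).le
          have hs : MeasurableSet {x | x + z ∈ Q} := measurable_id.add_const z hQ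
          calc ∫⁻ x in Q, Q.indicator (fun y => ‖f y - f x‖ₑ ^ 2) (x + z)
              = ∫⁻ x in Q, {x | x + z ∈ Q}.indicator (fun x => ‖f (x + z) - f x‖ₑ ^ 2) x := rfl
            _ = ∫⁻ x in {x | x + z ∈ Q} ∩ Q, ‖f (x + z) - f x‖ₑ ^ 2 := by
                rw [lintegral_indicator hs, Measure.restrict_restrict hs]
            _ ≤ ‖z‖ₑ ^ 2 * ∫⁻ x in Q, ‖fderiv ℝ f x‖ₑ ^ 2 := by
                refine lintegral_sub_sq_le hf (hs.inter hQ) hQ fun x hx t ht => ?_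
                have := hc.add_smul_sub_mem hx.2 hx.1 ⟨ht.1.le, ht.2⟩
                simpa using this
            _ ≤ _ := by gcongr
        · rw [Set.indicator_of_notMem hz]
          refine (setLIntegral_eq_zero hQ ?_).le
          intro x hx
          refine Set.indicator_of_notMem (fun hxz => hz ?_) _
          simpa using hR x hx _ hxz
    _ = _ := by
        rw [lintegral_indicator measurableSet_ball, lintegral_const, Measure.restrict_apply_univ,
          mul_comm]

/-- The Poincaré inequality on a bounded convex set. -/
theorem poincare_convex (hf : ContDiff ℝ 1 f) {Q : Set Plane} (hQ : MeasurableSet Q)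
    (hc : Convex ℝ Q) {R : ℝ} (hR : ∀ x ∈ Q, ∀ y ∈ Q, dist y x < R) (h0 : volume Q ≠ 0) :
    volume Q * ∫⁻ x in Q, ‖f x‖ₑ ^ 2 ≤ 2 * ‖∫ x in Q, f x‖ₑ ^ 2 +
      2 * (volume (Metric.ball (0 : Plane) R) * (ENNReal.ofReal R ^ 2 *
        ∫⁻ x in Q, ‖fderiv ℝ f x‖ₑ ^ 2)) := by
  have hfc := hf.continuous
  have hb : Bornology.IsBounded Q :=
    Metric.isBounded_iff.2 ⟨R, fun x hx y hy => (hR y hy x hx).le⟩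
  have hfin : volume Q ≠ ⊤ := hb.measure_lt_top.ne
  have hfi : IntegrableOn f Q := by
    obtain ⟨r, hr⟩ := hb.subset_closedBall 0
    exact (hfc.continuousOn.integrableOn_compact (isCompact_closedBall 0 r)).mono_set hr
  -- Write |Q| f(x) = ∫ f - ∫ (f(y) - f(x)) dy, square, and apply Cauchy-Schwarz to the second
  -- integral. Integrating over x gives one superfluous factor |Q|, which is cancelled at the end.
  have hpt : ∀ x, volume Q ^ 2 * ‖f x‖ₑ ^ 2 ≤ 2 * ‖∫ y in Q, f y‖ₑ ^ 2 +
      2 * (volume Q * ∫⁻ y in Q, ‖f y - f x‖ₑ ^ 2) := by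
    intro x
    have hci : IntegrableOn (fun _ : Plane => f x) Q :=
      integrableOn_const (C := f x) hfin
    have e1 : volume Q * ‖f x‖ₑ ≤ ‖∫ y in Q, f y‖ₑ + ∫⁻ y in Q, ‖f y - f x‖ₑ := by
      have : ∫ _ in Q, f x = (∫ y in Q, f y) - ∫ y in Q, (f y - f x) := by
        rw [integral_sub hfi hci]
        ring
      calc volume Q * ‖f x‖ₑ = ‖∫ _ in Q, f x‖ₑ := by
            rw [setIntegral_const, smul_eq_mul, enorm_mul,
              Real.enorm_of_nonneg (r := volume.real Q) measureReal_nonneg,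
              ofReal_measureReal hfin]
        _ ≤ ‖∫ y in Q, f y‖ₑ + ‖∫ y in Q, (f y - f x)‖ₑ := by
            rw [this]
            exact enorm_sub_le
        _ ≤ _ := by gcongr; exact enorm_integral_le_lintegral_enorm _
    calc volume Q ^ 2 * ‖f x‖ₑ ^ 2 = (volume Q * ‖f x‖ₑ) ^ 2 := by rw [mul_pow]
      _ ≤ (‖∫ y in Q, f y‖ₑ + ∫⁻ y in Q, ‖f y - f x‖ₑ) ^ 2 := by gcongr
      _ ≤ 2 * ‖∫ y in Q, f y‖ₑ ^ 2 + 2 * (∫⁻ y in Q, ‖f y - f x‖ₑ) ^ 2 := ENNReal.add_sq_le _ _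
      _ ≤ _ := by
        gcongr
        have := lintegral_sq_le_mul_lintegral_sq (volume.restrict Q)
          (g := fun y => ‖f y - f x‖ₑ)
          (by fun_prop : Continuous fun y => f y - f x).enorm.measurable.aemeasurable
        rwa [Measure.restrict_apply_univ] at this
  have hm : Measurable fun x => ∫⁻ y in Q, ‖f y - f x‖ₑ ^ 2 := by
    refine Measurable.lintegral_prod_right' (f := fun p : Plane × Plane => ‖f p.2 - f p.1‖ₑ ^ 2) ?_
    exact ((by fun_prop : Continuous fun p : Plane × Plane =>
      f p.2 - f p.1).enorm.measurable).pow_const 2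
  have hint : volume Q * (volume Q * ∫⁻ x in Q, ‖f x‖ₑ ^ 2) ≤
      volume Q * (2 * ‖∫ x in Q, f x‖ₑ ^ 2 +
        2 * ∫⁻ x in Q, ∫⁻ y in Q, ‖f y - f x‖ₑ ^ 2) := by
    calc volume Q * (volume Q * ∫⁻ x in Q, ‖f x‖ₑ ^ 2)
        = ∫⁻ x in Q, volume Q ^ 2 * ‖f x‖ₑ ^ 2 := by
          rw [lintegral_const_mul _ (hfc.enorm.measurable.pow_const 2)]
          ring
      _ ≤ ∫⁻ x in Q, (2 * ‖∫ y in Q, f y‖ₑ ^ 2 +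
          2 * (volume Q * ∫⁻ y in Q, ‖f y - f x‖ₑ ^ 2)) := lintegral_mono hpt
      _ = _ := by
          rw [lintegral_add_left measurable_const, lintegral_const, Measure.restrict_apply_univ,
            lintegral_const_mul _ (hm.const_mul _), lintegral_const_mul _ hm]
          ring
  refine ((ENNReal.mul_le_mul_iff_right h0 hfin).1 hint).trans ?_
  gcongr
  exact lintegral_lintegral_sub_sq_le hf hQ hc hR

end Calculus

end Graetz

/-! ### The L² norm on compact subsets, by means over small squares -/

theorem MeasureTheory.lintegral_biUnion_finset_le {α β : Type*} [MeasurableSpace α]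
    {μ : Measure α} (t : Finset β) (s : β → Set α) (f : α → ℝ≥0∞) :
    ∫⁻ x in ⋃ i ∈ t, s i, f x ∂μ ≤ ∑ i ∈ t, ∫⁻ x in s i, f x ∂μ := by
  rw [← Finset.sum_coe_sort, ← tsum_fintype (L := .unconditional _)]
  have : ⋃ i ∈ t, s i = ⋃ i : t, s i := by
    ext x
    simp
  rw [this]
  exact lintegral_iUnion_le _ _

namespace Graetz

/-- The half-open square of side `δ` with lower left corner `δ n`. -/
def cell (δ : ℝ) (n : Fin 2 → ℤ) : Set Plane :=
  {x | ∀ i, δ * n i ≤ x i ∧ x i < δ * (n i + 1)}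

section Cell

variable {δ : ℝ}

theorem cell_eq_iInter (n : Fin 2 → ℤ) :
    cell δ n = ⋂ i, {x : Plane | δ * n i ≤ x i} ∩ {x : Plane | x i < δ * (n i + 1)} := by
  ext x
  simp [cell]

theorem measurableSet_cell (n : Fin 2 → ℤ) : MeasurableSet (cell δ n) := by
  rw [cell_eq_iInter]
  refine MeasurableSet.iInter fun i => ?_
  have hc : Continuous fun x : Plane => x i := by fun_prop
  exact (isClosed_le continuous_const hc).measurableSet.inter
    (isOpen_lt hc continuous_const).measurableSet

theorem convex_cell (n : Fin 2 → ℤ) : Convex ℝ (cell δ n) := by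
  intro x hx y hy a b ha hb hab i
  have h1 := hx i
  have h2 := hy i
  simp only [PiLp.add_apply, PiLp.smul_apply, smul_eq_mul]
  obtain rfl : b = 1 - a := by linarith
  constructor
  · nlinarith [mul_le_mul_of_nonneg_left h1.1 ha, mul_le_mul_of_nonneg_left h2.1 hb]
  · rcases ha.eq_or_lt with rfl | h
    · linarith
    · nlinarith [mul_lt_mul_of_pos_left h1.2 h, mul_le_mul_of_nonneg_left h2.2.le hb]

theorem dist_lt_of_mem_cell (hδ : 0 < δ) {n : Fin 2 → ℤ} {x y : Plane} (hx : x ∈ cell δ n)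
    (hy : y ∈ cell δ n) : dist y x < 2 * δ := by
  rw [EuclideanSpace.dist_eq, Fin.sum_univ_two, Real.sqrt_lt' (by positivity), Real.dist_eq,
    Real.dist_eq, sq_abs, sq_abs]
  have h0 := hx 0
  have h1 := hx 1
  have h2 := hy 0
  have h3 := hy 1
  have e1 : (y 0 - x 0) ^ 2 ≤ δ ^ 2 := sq_le_sq' (by linarith) (by linarith)
  have e2 : (y 1 - x 1) ^ 2 ≤ δ ^ 2 := sq_le_sq' (by linarith) (by linarith)
  nlinarith

theorem exists_mem_cell (hδ : 0 < δ) (x : Plane) : x ∈ cell δ fun i => ⌊x i / δ⌋ := by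
  intro i
  have h1 := Int.floor_le (x i / δ)
  have h2 := Int.lt_floor_add_one (x i / δ)
  rw [le_div_iff₀ hδ] at h1
  rw [div_lt_iff₀ hδ] at h2
  constructor <;> linarith

theorem eq_floor_of_mem_cell (hδ : 0 < δ) {n : Fin 2 → ℤ} {x : Plane} (hx : x ∈ cell δ n) :
    n = fun i => ⌊x i / δ⌋ := by
  ext i
  symm
  rw [Int.floor_eq_iff, le_div_iff₀ hδ, div_lt_iff₀ hδ]
  have := hx i
  constructor <;> linarith

theorem ball_subset_cell (n : Fin 2 → ℤ) :
    Metric.ball (WithLp.toLp 2 fun i => δ * (n i + 1 / 2)) (δ / 2) ⊆ cell δ n := by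
  intro x hx i
  rw [Metric.mem_ball, dist_eq_norm] at hx
  have h1 := (PiLp.norm_apply_le (x - WithLp.toLp 2 fun i => δ * ((n i : ℝ) + 1 / 2)) i).trans_lt hx
  rw [PiLp.sub_apply, Real.norm_eq_abs, abs_lt] at h1
  simp only at h1
  constructor <;> linarith

theorem volume_ball_le_volume_cell (n : Fin 2 → ℤ) :
    volume (Metric.ball (0 : Plane) (δ / 2)) ≤ volume (cell δ n) := by
  rw [← Measure.addHaar_ball_center volume (WithLp.toLp 2 fun i => δ * ((n i : ℝ) + 1 / 2))]
  exact measure_mono (ball_subset_cell n)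

theorem volume_cell_ne_zero (hδ : 0 < δ) (n : Fin 2 → ℤ) : volume (cell δ n) ≠ 0 :=
  ((Metric.measure_ball_pos volume (0 : Plane) (by positivity)).trans_le
    (volume_ball_le_volume_cell n)).ne'

/-- The radii 2δ and δ/2 have ratio 4, hence the areas have ratio 16. -/
theorem volume_ball_two_mul_le (hδ : 0 < δ) (n : Fin 2 → ℤ) :
    volume (Metric.ball (0 : Plane) (2 * δ)) ≤ 16 * volume (cell δ n) := by
  refine le_trans ?_ (mul_le_mul' le_rfl (volume_ball_le_volume_cell n))
  rw [Measure.addHaar_ball_of_pos volume _ (by positivity),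
    Measure.addHaar_ball_of_pos volume _ (by positivity : 0 < δ / 2), finrank_euclideanSpace_fin,
    ← mul_assoc]
  gcongr
  rw [show (16 : ℝ≥0∞) = ENNReal.ofReal 16 by norm_num, ← ENNReal.ofReal_mul (by norm_num)]
  exact ENNReal.ofReal_le_ofReal (by nlinarith)

theorem volume_cell_ne_top (hδ : 0 < δ) (n : Fin 2 → ℤ) : volume (cell δ n) ≠ ⊤ :=
  (Metric.isBounded_iff.2 ⟨2 * δ, fun _ hx _ hy =>
    (dist_lt_of_mem_cell hδ hy hx).le⟩).measure_lt_top.ne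

/-- The Poincaré inequality on a square. -/
theorem lintegral_cell_le {f : Plane → ℝ} (hf : ContDiff ℝ 1 f) (hδ : 0 < δ) (n : Fin 2 → ℤ) :
    ∫⁻ x in cell δ n, ‖f x‖ₑ ^ 2 ≤ 2 * (volume (cell δ n))⁻¹ * ‖∫ x in cell δ n, f x‖ₑ ^ 2 +
      ENNReal.ofReal (128 * δ ^ 2) * ∫⁻ x in cell δ n, ‖fderiv ℝ f x‖ₑ ^ 2 := by
  have h0 := volume_cell_ne_zero hδ n
  have ht := volume_cell_ne_top hδ n
  have h1 := poincare_convex hf (measurableSet_cell n) (convex_cell n)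
    (fun x hx y hy => dist_lt_of_mem_cell hδ hx hy) h0
  rw [← ENNReal.mul_le_mul_iff_right h0 ht]
  refine h1.trans ?_
  rw [mul_add]
  gcongr ?_ + ?_
  · rw [← mul_assoc, ← mul_assoc, mul_comm (volume _), mul_assoc 2, ENNReal.mul_inv_cancel h0 ht,
      mul_one]
  -- The constant is 2 · 16 · (2δ)² = 128 δ².
  · calc 2 * (volume (Metric.ball (0 : Plane) (2 * δ)) * (ENNReal.ofReal (2 * δ) ^ 2 *
          ∫⁻ x in cell δ n, ‖fderiv ℝ f x‖ₑ ^ 2))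
        ≤ 2 * (16 * volume (cell δ n) * (ENNReal.ofReal (2 * δ) ^ 2 *
          ∫⁻ x in cell δ n, ‖fderiv ℝ f x‖ₑ ^ 2)) := by
          gcongr
          exact volume_ball_two_mul_le hδ n
      _ = volume (cell δ n) * (32 * ENNReal.ofReal (2 * δ) ^ 2 *
          ∫⁻ x in cell δ n, ‖fderiv ℝ f x‖ₑ ^ 2) := by ring
      _ = _ := by
          congr 2
          rw [← ENNReal.ofReal_pow (by positivity), show (32 : ℝ≥0∞) = ENNReal.ofReal 32 by norm_num,
            ← ENNReal.ofReal_mul (by norm_num)]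
          congr 1
          ring

end Cell

/-- On a compact subset of `Ω`, the `L²` norm is controlled by finitely many means and a small
multiple of the norm of the gradient on `Ω`. -/
theorem exists_interior_bound {Ω K : Set Plane} (hΩ : IsOpen Ω) (hK : IsCompact K) (hKΩ : K ⊆ Ω)
    {ε : ℝ} (hε : 0 < ε) :
    ∃ (s : Finset (Fin 2 → ℤ)) (Q : (Fin 2 → ℤ) → Set Plane) (C : ℝ≥0∞),
      C ≠ ⊤ ∧ (∀ n ∈ s, MeasurableSet (Q n) ∧ Q n ⊆ Ω) ∧
      ∀ f : Plane → ℝ, ContDiff ℝ 1 f → ∫⁻ x in K, ‖f x‖ₑ ^ 2 ≤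
        C * ∑ n ∈ s, ‖∫ x in Q n, f x‖ₑ ^ 2 +
          ENNReal.ofReal ε * ∫⁻ x in Ω, ‖fderiv ℝ f x‖ₑ ^ 2 := by
  obtain ⟨d, hd, hdΩ⟩ := hK.exists_thickening_subset_open hΩ hKΩ
  -- The first bound keeps the squares that meet K inside Ω, because two points of a square are less
  -- than 2δ apart; the second makes the Poincaré constant at most ε. The minimum with 1 gives δ² ≤
  -- δ.
  obtain ⟨δ, hδ, hδd, hδε⟩ : ∃ δ : ℝ, 0 < δ ∧ 2 * δ ≤ d ∧ 128 * δ ^ 2 ≤ ε := by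
    refine ⟨min (d / 2) (min 1 (ε / 128)), by positivity, ?_, ?_⟩
    · linarith [min_le_left (d / 2) (min 1 (ε / 128))]
    · have h0 : 0 < min (d / 2) (min 1 (ε / 128)) := by positivity
      have h1 := (min_le_right (d / 2) (min 1 (ε / 128))).trans (min_le_left _ _)
      have h2 := (min_le_right (d / 2) (min 1 (ε / 128))).trans (min_le_right _ _)
      nlinarith
  have hfin : {n : Fin 2 → ℤ | (cell δ n ∩ K).Nonempty}.Finite := by
    obtain ⟨r, hr⟩ := hK.isBounded.subset_closedBall 0
    refine (Set.finite_Icc (fun _ : Fin 2 => ⌊-r / δ⌋) (fun _ => ⌊r / δ⌋)).subset ?_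
    rintro n ⟨x, hx, hxK⟩
    rw [eq_floor_of_mem_cell hδ hx]
    have hn := mem_closedBall_zero_iff.1 (hr hxK)
    constructor
    · intro i
      have := (abs_le.1 ((PiLp.norm_apply_le x i).trans hn)).1
      exact Int.floor_le_floor (by gcongr)
    · intro i
      have := (abs_le.1 ((PiLp.norm_apply_le x i).trans hn)).2
      exact Int.floor_le_floor (by gcongr)
  have hsub : ∀ n ∈ hfin.toFinset, cell δ n ⊆ Ω := by
    intro n hn x hx
    obtain ⟨y, hy, hyK⟩ := hfin.mem_toFinset.1 hn
    exact hdΩ (Metric.mem_thickening_iff.2 ⟨y, hyK, (dist_lt_of_mem_cell hδ hy hx).trans_le hδd⟩)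
  refine ⟨hfin.toFinset, cell δ, 2 * (volume (Metric.ball (0 : Plane) (δ / 2)))⁻¹, ?_,
    fun n hn => ⟨measurableSet_cell n, hsub n hn⟩, fun f hf => ?_⟩
  · refine ENNReal.mul_ne_top (by norm_num) (ENNReal.inv_ne_top.2 ?_)
    exact (Metric.measure_ball_pos volume (0 : Plane) (by positivity)).ne'
  have hcov : K ⊆ ⋃ n ∈ hfin.toFinset, cell δ n := by
    intro x hx
    have hxc := exists_mem_cell hδ x
    exact Set.mem_biUnion (hfin.mem_toFinset.2 ⟨x, hxc, hx⟩) hxc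
  have hdisj : Set.PairwiseDisjoint (hfin.toFinset : Set (Fin 2 → ℤ)) (cell δ) := by
    intro n _ m _ hnm
    refine Set.disjoint_left.2 fun x hx hx' => hnm ?_
    rw [eq_floor_of_mem_cell hδ hx, eq_floor_of_mem_cell hδ hx']
  have hunion : ∀ g : Plane → ℝ≥0∞, ∫⁻ x in ⋃ n ∈ hfin.toFinset, cell δ n, g x =
      ∑ n ∈ hfin.toFinset, ∫⁻ x in cell δ n, g x := fun g =>
    lintegral_biUnion_finset hdisj (fun n _ => measurableSet_cell n) g
  calc ∫⁻ x in K, ‖f x‖ₑ ^ 2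
      ≤ ∑ n ∈ hfin.toFinset, ∫⁻ x in cell δ n, ‖f x‖ₑ ^ 2 := by
        rw [← hunion]
        exact lintegral_mono_set hcov
    _ ≤ ∑ n ∈ hfin.toFinset, (2 * (volume (Metric.ball (0 : Plane) (δ / 2)))⁻¹ *
          ‖∫ x in cell δ n, f x‖ₑ ^ 2 +
          ENNReal.ofReal ε * ∫⁻ x in cell δ n, ‖fderiv ℝ f x‖ₑ ^ 2) := by
        refine Finset.sum_le_sum fun n _ => (lintegral_cell_le hf hδ n).trans ?_
        gcongr ?_ + ?_
        · have := volume_ball_le_volume_cell (δ := δ) n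
          gcongr 2 * ?_ * _
          exact ENNReal.inv_le_inv.2 this
        · gcongr
    _ = 2 * (volume (Metric.ball (0 : Plane) (δ / 2)))⁻¹ *
          ∑ n ∈ hfin.toFinset, ‖∫ x in cell δ n, f x‖ₑ ^ 2 +
          ENNReal.ofReal ε * ∫⁻ x in ⋃ n ∈ hfin.toFinset, cell δ n, ‖fderiv ℝ f x‖ₑ ^ 2 := by
        rw [Finset.sum_add_distrib, hunion, Finset.mul_sum, Finset.mul_sum]
    _ ≤ _ := by
        gcongr
        exact Set.iUnion₂_subset hsub

/-! ### Lipschitz charts and the L² bound up to the boundary -/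

/-- The unit vector that points into the domain above a graph. -/
theorem apply_symm_add (e : Plane ≃ₗᵢ[ℝ] Plane) (x : Plane) (s : ℝ) :
    (e (x + s • e.symm (EuclideanSpace.single 1 1))) 0 = (e x) 0 ∧
      (e (x + s • e.symm (EuclideanSpace.single 1 1))) 1 = (e x) 1 + s := by
  rw [map_add, map_smul, LinearIsometryEquiv.apply_symm_apply]
  simp

theorem norm_symm_single (e : Plane ≃ₗᵢ[ℝ] Plane) :
    ‖e.symm (EuclideanSpace.single 1 (1 : ℝ))‖ = 1 := by
  rw [LinearIsometryEquiv.norm_map]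
  simp

/-- A boundary chart: translations in the direction of the graph lead into the domain, and the
boundary is the graph. -/
theorem HasLipschitzBoundary.exists_chart {Ω : Set Plane} (hΩ : HasLipschitzBoundary Ω)
    (ho : IsOpen Ω) {p : Plane} (hp : p ∈ frontier Ω) :
    ∃ r > 0, ∃ (e : Plane ≃ₗᵢ[ℝ] Plane) (γ : ℝ → ℝ) (K : NNReal), LipschitzWith K γ ∧
      (∀ x ∈ closure Ω, x ∈ Metric.ball p r → ∀ s ∈ Set.Ioo 0 r,
        x + s • e.symm (EuclideanSpace.single 1 1) ∈ Ω) ∧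
      ∀ x ∈ frontier Ω, x ∈ Metric.ball p r → (e x) 1 = γ ((e x) 0) := by
  obtain ⟨e, γ, ⟨K, hγ⟩, U, hU, h⟩ := hΩ p hp
  obtain ⟨ρ, hρ, hρU⟩ := Metric.mem_nhds_iff.1 hU
  have hc : IsClosed {x : Plane | γ ((e x) 0) ≤ (e x) 1} := by
    have := hγ.continuous
    exact isClosed_le (by fun_prop) (by fun_prop)
  have hcl : ∀ x ∈ closure Ω, x ∈ Metric.ball p ρ → γ ((e x) 0) ≤ (e x) 1 := by
    intro x hx hxp
    refine closure_minimal (s := Metric.ball p ρ ∩ Ω) (fun y hy => ?_) hc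
      (Metric.isOpen_ball.inter_closure ⟨hxp, hx⟩)
    exact ((h y (hρU hy.1)).1 hy.2).le
  -- Half the radius leaves room for a translation by s < ρ/2 inside the ball where the chart is
  -- valid.
  refine ⟨ρ / 2, by positivity, e, γ, K, hγ, fun x hx hxp s hs => ?_, fun x hx hxp => ?_⟩
  · have hxρ : x ∈ Metric.ball p ρ := Metric.ball_subset_ball (by linarith) hxp
    rw [h _ (hρU ?_)]
    · obtain ⟨h0, h1⟩ := apply_symm_add e x s
      rw [h0, h1]
      linarith [hcl x hx hxρ, hs.1]
    · rw [Metric.mem_ball] at hxp ⊢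
      calc dist (x + s • e.symm (EuclideanSpace.single 1 1)) p
          ≤ dist (x + s • e.symm (EuclideanSpace.single 1 1)) x + dist x p := dist_triangle _ _ _
        _ = s + dist x p := by
            rw [dist_self_add_left, norm_smul, norm_symm_single, mul_one,
              Real.norm_of_nonneg hs.1.le]
        _ < ρ := by linarith [hs.2]
  · have hxρ : x ∈ Metric.ball p ρ := Metric.ball_subset_ball (by linarith) hxp
    refine le_antisymm ?_ (hcl x (frontier_subset_closure hx) hxρ)
    rw [ho.frontier_eq] at hx
    -- A boundary point strictly above the graph would belong to Ω, which is open and so does not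
    -- meet its frontier.
    by_contra! hlt
    exact hx.2 ((h x (hρU hxρ)).2 hlt)

/-- Near each point of its closure, a domain with Lipschitz boundary is mapped into itself by small
translations in a suitable direction. -/
theorem HasLipschitzBoundary.exists_direction {Ω : Set Plane} (hΩ : HasLipschitzBoundary Ω)
    (ho : IsOpen Ω) {p : Plane} (hp : p ∈ closure Ω) :
    ∃ r > 0, ∃ v : Plane, ‖v‖ ≤ 1 ∧ ∀ x ∈ closure Ω, x ∈ Metric.ball p r → ∀ s ∈ Set.Ioo 0 r,
      x + s • v ∈ Ω := by
  by_cases hpΩ : p ∈ Ω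
  · obtain ⟨r, hr, hrΩ⟩ := Metric.isOpen_iff.1 ho p hpΩ
    exact ⟨r, hr, 0, by simp, fun x _ hx s _ => by simpa using hrΩ hx⟩
  · have hpf : p ∈ frontier Ω := by
      rw [ho.frontier_eq]
      exact ⟨hp, hpΩ⟩
    obtain ⟨r, hr, e, γ, K, -, h, -⟩ := hΩ.exists_chart ho hpf
    exact ⟨r, hr, _, (norm_symm_single e).le, h⟩

/-- The `L²` norm on a domain with Lipschitz boundary is controlled by finitely many means and a
small multiple of the norm of the gradient. -/
theorem HasLipschitzBoundary.exists_bound {Ω : Set Plane} (hΩ : HasLipschitzBoundary Ω)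
    (ho : IsOpen Ω) (hb : Bornology.IsBounded Ω) {ε : ℝ} (hε : 0 < ε) :
    ∃ (s : Finset (Fin 2 → ℤ)) (Q : (Fin 2 → ℤ) → Set Plane) (C : ℝ≥0∞),
      C ≠ ⊤ ∧ (∀ n ∈ s, MeasurableSet (Q n) ∧ Q n ⊆ Ω) ∧
      ∀ f : Plane → ℝ, ContDiff ℝ 1 f → ∫⁻ x in Ω, ‖f x‖ₑ ^ 2 ≤
        C * ∑ n ∈ s, ‖∫ x in Q n, f x‖ₑ ^ 2 +
          ENNReal.ofReal ε * ∫⁻ x in Ω, ‖fderiv ℝ f x‖ₑ ^ 2 := by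
  have hcomp : IsCompact (closure Ω) := hb.isCompact_closure
  choose! r hr v hv h using fun p (hp : p ∈ closure Ω) => hΩ.exists_direction ho hp
  obtain ⟨t, ht, hcov⟩ := hcomp.elim_nhds_subcover (fun p => Metric.ball p (r p / 2))
    fun p hp => Metric.ball_mem_nhds p (half_pos (hr p hp))
  -- The length d of the shift must be admissible in every patch and small enough that the shift
  -- errors of all patches add up to at most ε/2; the other half of ε goes to the interior bound on
  -- K.
  obtain ⟨d, hd, hdr, hdε⟩ : ∃ d : ℝ, 0 < d ∧ (∀ p ∈ t, d < r p) ∧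
      2 * (t.card + 1) * d ^ 2 ≤ ε / 2 := by
    have h1 : ∀ᶠ d : ℝ in nhdsWithin 0 (Set.Ioi 0), ∀ p ∈ t, d < r p := by
      rw [Finset.eventually_all]
      intro p hp
      exact (eventually_lt_nhds (hr p (ht p hp))).filter_mono nhdsWithin_le_nhds
    have h2 : ∀ᶠ d : ℝ in nhdsWithin 0 (Set.Ioi 0), 2 * (t.card + 1) * d ^ 2 < ε / 2 := by
      have : Filter.Tendsto (fun d : ℝ => 2 * ((t.card : ℝ) + 1) * d ^ 2) (nhds 0) (nhds 0) := by
        have hc : Continuous fun d : ℝ => 2 * ((t.card : ℝ) + 1) * d ^ 2 := by fun_prop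
        simpa using hc.tendsto 0
      exact (this.eventually (eventually_lt_nhds (half_pos hε))).filter_mono nhdsWithin_le_nhds
    obtain ⟨d, hd, h1, h2⟩ := (eventually_mem_nhdsWithin.and (h1.and h2)).exists
    exact ⟨d, hd, h1, h2.le⟩
  -- All patches of the closure, shifted inwards: a compact subset of Ω, to which the interior bound
  -- applies.
  let K : Set Plane := ⋃ p ∈ t, (fun x => x + d • v p) '' (closure Ω ∩ Metric.closedBall p (r p / 2))
  have hK : IsCompact K := t.isCompact_biUnion fun p _ =>
    (hcomp.inter_right Metric.isClosed_closedBall).image (by fun_prop)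
  have hball : ∀ p ∈ t, Metric.closedBall p (r p / 2) ⊆ Metric.ball p (r p) := fun p hp =>
    Metric.closedBall_subset_ball (half_lt_self (hr p (ht p hp)))
  have hKΩ : K ⊆ Ω := by
    refine Set.iUnion₂_subset fun p hp => ?_
    rintro _ ⟨x, ⟨hx, hxp⟩, rfl⟩
    exact h p (ht p hp) x hx (hball p hp hxp) d ⟨hd, hdr p hp⟩
  obtain ⟨s, Q, C, hC, hQ, hint⟩ := exists_interior_bound ho hK hKΩ
    (ε := ε / (4 * (t.card + 1))) (by positivity)
  refine ⟨s, Q, 2 * t.card * C, ENNReal.mul_ne_top (by simp [ENNReal.mul_eq_top]) hC, hQ,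
    fun f hf => ?_⟩
  have hfc := hf.continuous
  set N := ∫⁻ x in Ω, ‖fderiv ℝ f x‖ₑ ^ 2
  -- On each patch, f(x) is f(x + d v) minus a difference; the first is controlled on K, the second
  -- by d² times the gradient integral, as the segments stay in Ω.
  have hloc : ∀ p ∈ t, ∫⁻ x in Ω ∩ Metric.ball p (r p / 2), ‖f x‖ₑ ^ 2 ≤
      2 * (∫⁻ x in K, ‖f x‖ₑ ^ 2) + 2 * (ENNReal.ofReal d ^ 2 * N) := by
    intro p hp
    have hS : MeasurableSet (Ω ∩ Metric.ball p (r p / 2)) :=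
      ho.measurableSet.inter measurableSet_ball
    have hmem : ∀ x ∈ Ω ∩ Metric.ball p (r p / 2), x ∈ closure Ω ∩ Metric.closedBall p (r p / 2) :=
      fun x hx => ⟨subset_closure hx.1, Metric.ball_subset_closedBall hx.2⟩
    have e1 : ∫⁻ x in Ω ∩ Metric.ball p (r p / 2), ‖f (x + d • v p)‖ₑ ^ 2 ≤
        ∫⁻ x in K, ‖f x‖ₑ ^ 2 := by
      calc ∫⁻ x in Ω ∩ Metric.ball p (r p / 2), ‖f (x + d • v p)‖ₑ ^ 2
          ≤ ∫⁻ x in Ω ∩ Metric.ball p (r p / 2),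
              K.indicator (fun y => ‖f y‖ₑ ^ 2) (x + d • v p) := by
            refine setLIntegral_mono' hS fun x hx => ?_
            rw [Set.indicator_of_mem]
            exact Set.mem_biUnion hp ⟨x, hmem x hx, rfl⟩
        _ ≤ ∫⁻ x, K.indicator (fun y => ‖f y‖ₑ ^ 2) (x + d • v p) :=
            setLIntegral_le_lintegral _ _
        _ = ∫⁻ x in K, ‖f x‖ₑ ^ 2 := by
            rw [lintegral_add_right_eq_self (μ := volume)
              (fun y => K.indicator (fun y => ‖f y‖ₑ ^ 2) y), lintegral_indicator hK.measurableSet]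
    have e2 : ∫⁻ x in Ω ∩ Metric.ball p (r p / 2), ‖f (x + d • v p) - f x‖ₑ ^ 2 ≤
        ENNReal.ofReal d ^ 2 * N := by
      refine (lintegral_sub_sq_le hf hS ho.measurableSet fun x hx t' ht' => ?_).trans ?_
      · rw [smul_smul]
        refine h p (ht p hp) x (hmem x hx).1 (hball p hp (hmem x hx).2) _ ⟨?_, ?_⟩
        · exact mul_pos ht'.1 hd
        · nlinarith [hdr p hp, ht'.2]
      · gcongr
        rw [← ofReal_norm, norm_smul, Real.norm_of_nonneg hd.le]
        exact ENNReal.ofReal_le_ofReal (by nlinarith [hv p (ht p hp)])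
    calc ∫⁻ x in Ω ∩ Metric.ball p (r p / 2), ‖f x‖ₑ ^ 2
        ≤ ∫⁻ x in Ω ∩ Metric.ball p (r p / 2),
            (2 * ‖f (x + d • v p)‖ₑ ^ 2 + 2 * ‖f (x + d • v p) - f x‖ₑ ^ 2) := by
          refine lintegral_mono fun x => le_trans ?_ (ENNReal.add_sq_le _ _)
          gcongr
          calc ‖f x‖ₑ = ‖f (x + d • v p) - (f (x + d • v p) - f x)‖ₑ := by rw [sub_sub_cancel]
            _ ≤ _ := enorm_sub_le
      _ = 2 * (∫⁻ x in Ω ∩ Metric.ball p (r p / 2), ‖f (x + d • v p)‖ₑ ^ 2) +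
            2 * ∫⁻ x in Ω ∩ Metric.ball p (r p / 2), ‖f (x + d • v p) - f x‖ₑ ^ 2 := by
          have m1 : Measurable fun x => ‖f (x + d • v p)‖ₑ ^ 2 :=
            (by fun_prop : Continuous fun x => f (x + d • v p)).enorm.measurable.pow_const 2
          have m2 : Measurable fun x => ‖f (x + d • v p) - f x‖ₑ ^ 2 :=
            (by fun_prop : Continuous fun x => f (x + d • v p) - f x).enorm.measurable.pow_const 2
          rw [lintegral_add_left (m1.const_mul _), lintegral_const_mul _ m1,
            lintegral_const_mul _ m2]
      _ ≤ _ := by gcongr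
  have hcard : (t.card : ℝ≥0∞) * (2 * (ENNReal.ofReal (ε / (4 * (t.card + 1)))) +
      2 * ENNReal.ofReal d ^ 2) ≤ ENNReal.ofReal ε := by
    rw [← ENNReal.ofReal_natCast, show (2 : ℝ≥0∞) = ENNReal.ofReal 2 by norm_num,
      ← ENNReal.ofReal_pow hd.le, ← ENNReal.ofReal_mul (by norm_num),
      ← ENNReal.ofReal_mul (by norm_num), ← ENNReal.ofReal_add (by positivity) (by positivity),
      ← ENNReal.ofReal_mul (by positivity)]
    refine ENNReal.ofReal_le_ofReal ?_
    have hc0 : (0 : ℝ) ≤ t.card := by positivity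
    have e1 : (t.card : ℝ) * (2 * (ε / (4 * (t.card + 1)))) ≤ ε / 2 := by
      rw [← mul_div_assoc, ← mul_div_assoc, div_le_iff₀ (by positivity)]
      nlinarith
    nlinarith [sq_nonneg d]
  calc ∫⁻ x in Ω, ‖f x‖ₑ ^ 2
      ≤ ∫⁻ x in ⋃ p ∈ t, Ω ∩ Metric.ball p (r p / 2), ‖f x‖ₑ ^ 2 := by
        refine lintegral_mono_set fun x hx => ?_
        obtain ⟨p, hp, hxp⟩ := Set.mem_iUnion₂.1 (hcov (subset_closure hx))
        exact Set.mem_biUnion hp ⟨hx, hxp⟩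
    _ ≤ ∑ p ∈ t, ∫⁻ x in Ω ∩ Metric.ball p (r p / 2), ‖f x‖ₑ ^ 2 :=
        lintegral_biUnion_finset_le _ _ _
    _ ≤ ∑ p ∈ t, (2 * (∫⁻ x in K, ‖f x‖ₑ ^ 2) + 2 * (ENNReal.ofReal d ^ 2 * N)) :=
        Finset.sum_le_sum hloc
    _ = t.card * (2 * (∫⁻ x in K, ‖f x‖ₑ ^ 2) + 2 * (ENNReal.ofReal d ^ 2 * N)) := by
        rw [Finset.sum_const, nsmul_eq_mul]
    _ ≤ t.card * (2 * (C * ∑ n ∈ s, ‖∫ x in Q n, f x‖ₑ ^ 2 +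
          ENNReal.ofReal (ε / (4 * (t.card + 1))) * N) + 2 * (ENNReal.ofReal d ^ 2 * N)) := by
        gcongr
        exact hint f hf
    _ = 2 * t.card * C * ∑ n ∈ s, ‖∫ x in Q n, f x‖ₑ ^ 2 +
          t.card * (2 * (ENNReal.ofReal (ε / (4 * (t.card + 1)))) + 2 * ENNReal.ofReal d ^ 2) * N :=
        by ring
    _ ≤ _ := by gcongr

end Graetz

/-! ### The trace inequality and the length of the boundary -/

namespace Graetz

/-- The parametrization of a graph, in the coordinates given by `e`. -/
noncomputable def graphMap (e : Plane ≃ₗᵢ[ℝ] Plane) (γ : ℝ → ℝ) (t : ℝ) : Plane :=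
  e.symm !₂[t, γ t]

section GraphMap

variable (e : Plane ≃ₗᵢ[ℝ] Plane) {γ : ℝ → ℝ}

theorem graphMap_add (t s : ℝ) :
    graphMap e γ t + s • e.symm (EuclideanSpace.single 1 1) = e.symm !₂[t, γ t + s] := by
  apply e.injective
  unfold graphMap
  rw [map_add, map_smul, e.apply_symm_apply, e.apply_symm_apply, e.apply_symm_apply]
  ext i
  fin_cases i <;> simp

theorem graphMap_of_mem_graph {x : Plane} (hx : (e x) 1 = γ ((e x) 0)) :
    graphMap e γ ((e x) 0) = x := by
  unfold graphMap
  rw [← hx, LinearIsometryEquiv.symm_apply_eq]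
  ext i
  fin_cases i <;> rfl

theorem lipschitzWith_graphMap {K : ℝ≥0} (hγ : LipschitzWith K γ) :
    LipschitzWith (1 + K) (graphMap e γ) := by
  refine LipschitzWith.of_dist_le_mul fun t s => ?_
  unfold graphMap
  rw [LinearIsometryEquiv.dist_map, EuclideanSpace.dist_eq, Fin.sum_univ_two]
  have h := hγ.dist_le_mul t s
  refine Real.sqrt_le_iff.2 ⟨by positivity, ?_⟩
  simp only [Matrix.cons_val_zero, Matrix.cons_val_one, NNReal.coe_add, NNReal.coe_one]
  have h0 : 0 ≤ dist t s := dist_nonneg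
  have h1 : 0 ≤ dist (γ t) (γ s) := dist_nonneg
  have h2 : (0 : ℝ) ≤ K := K.2
  have h3 : dist (γ t) (γ s) ^ 2 ≤ (K * dist t s) ^ 2 := by gcongr
  nlinarith [mul_nonneg h2 (sq_nonneg (dist t s))]

/-- On the graph, arc length is at most the Lipschitz constant of the parametrization times Lebesgue
measure in the parameter. -/
theorem hausdorffMeasure_restrict_le {K : ℝ≥0} (hγ : LipschitzWith K γ) {S : Set Plane}
    (hg : ∀ x ∈ S, (e x) 1 = γ ((e x) 0)) :
    (μH[1] : Measure Plane).restrict S ≤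
      ((1 + K : ℝ≥0) : ℝ≥0∞) • (volume.restrict (graphMap e γ ⁻¹' S)).map (graphMap e γ) := by
  have hl := lipschitzWith_graphMap e hγ
  have hm : Measurable (graphMap e γ) := hl.continuous.measurable
  refine Measure.le_iff.2 fun A hA => ?_
  rw [Measure.restrict_apply hA, Measure.smul_apply, Measure.map_apply hm hA,
    Measure.restrict_apply (hm hA), ← Set.preimage_inter, smul_eq_mul]
  have himg : A ∩ S = graphMap e γ '' (graphMap e γ ⁻¹' (A ∩ S)) := by
    refine (Set.image_preimage_eq_of_subset ?_).symm
    intro x hx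
    exact ⟨_, graphMap_of_mem_graph e (hg x hx.2)⟩
  conv_lhs => rw [himg]
  refine (hl.hausdorffMeasure_image_le zero_le_one _).trans ?_
  rw [ENNReal.rpow_one, hausdorffMeasure_real]

/-- Isometries preserve Lebesgue measure, so Fubini holds in the coordinates given by e. -/
theorem lintegral_plane (g : Plane → ℝ≥0∞) (hg : Measurable g) :
    ∫⁻ x, g x = ∫⁻ t : ℝ, ∫⁻ s : ℝ, g (e.symm !₂[t, s]) := by
  have h1 : Measurable fun a : Fin 2 → ℝ => g (e.symm (WithLp.toLp 2 a)) :=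
    (hg.comp e.symm.continuous.measurable).comp (PiLp.volume_preserving_toLp (Fin 2)).measurable
  have h2 : Measurable fun q : ℝ × ℝ => g (e.symm !₂[q.1, q.2]) :=
    h1.comp (MeasurableEquiv.measurable (MeasurableEquiv.finTwoArrow (α := ℝ)).symm)
  calc ∫⁻ x, g x = ∫⁻ x, g (e.symm x) := (e.symm.measurePreserving.lintegral_comp hg).symm
    _ = ∫⁻ a : Fin 2 → ℝ, g (e.symm (WithLp.toLp 2 a)) :=
        ((PiLp.volume_preserving_toLp (Fin 2)).lintegral_comp
          (hg.comp e.symm.continuous.measurable)).symm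
    _ = ∫⁻ q : ℝ × ℝ, g (e.symm !₂[q.1, q.2]) :=
        (((volume_preserving_finTwoArrow ℝ).symm _).lintegral_comp h1).symm
    _ = _ := by
        rw [Measure.volume_eq_prod, lintegral_prod _ h2.aemeasurable]

/-- The integral over the region above a graph, in graph coordinates. -/
theorem lintegral_graphMap_le {Ω : Set Plane} (hΩ : MeasurableSet Ω) {T : Set ℝ} {r : ℝ}
    (hT : MeasurableSet T)
    (h : ∀ t ∈ T, ∀ s ∈ Set.Ioo 0 r,
      graphMap e γ t + s • e.symm (EuclideanSpace.single 1 1) ∈ Ω)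
    (g : Plane → ℝ≥0∞) (hg : Measurable g) :
    ∫⁻ t in T, ∫⁻ s in Set.Ioo 0 r,
      g (graphMap e γ t + s • e.symm (EuclideanSpace.single 1 1)) ≤ ∫⁻ x in Ω, g x := by
  calc ∫⁻ t in T, ∫⁻ s in Set.Ioo 0 r,
        g (graphMap e γ t + s • e.symm (EuclideanSpace.single 1 1))
      ≤ ∫⁻ t in T, ∫⁻ s : ℝ, Ω.indicator g (e.symm !₂[t, s]) := by
        refine setLIntegral_mono' hT fun t ht => ?_
        calc ∫⁻ s in Set.Ioo 0 r, g (graphMap e γ t + s • e.symm (EuclideanSpace.single 1 1))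
            ≤ ∫⁻ s in Set.Ioo 0 r, Ω.indicator g (e.symm !₂[t, γ t + s]) := by
              refine setLIntegral_mono' measurableSet_Ioo fun s hs => ?_
              rw [← graphMap_add, Set.indicator_of_mem (h t ht s hs)]
          _ ≤ ∫⁻ s : ℝ, Ω.indicator g (e.symm !₂[t, γ t + s]) := setLIntegral_le_lintegral _ _
          _ = ∫⁻ s : ℝ, Ω.indicator g (e.symm !₂[t, s]) :=
              lintegral_add_left_eq_self (μ := volume)
                (fun s => Ω.indicator g (e.symm !₂[t, s])) (γ t)
    _ ≤ ∫⁻ t : ℝ, ∫⁻ s : ℝ, Ω.indicator g (e.symm !₂[t, s]) := setLIntegral_le_lintegral _ _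
    _ = ∫⁻ x in Ω, g x := by
        rw [← lintegral_plane e _ (hg.indicator hΩ), lintegral_indicator hΩ]

end GraphMap

/-- Compare f(x) with f(x + s v) and average over s ∈ (0, r); taken at boundary points with v
pointing inwards, this is the trace inequality on one line. -/
theorem mul_enorm_sq_le {f : Plane → ℝ} (hf : ContDiff ℝ 1 f) {v : Plane} (hv : ‖v‖ = 1)
    (x : Plane) (r : ℝ) :
    ENNReal.ofReal r * ‖f x‖ₑ ^ 2 ≤ 2 * (∫⁻ s in Set.Ioo 0 r, ‖f (x + s • v)‖ₑ ^ 2) +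
      2 * ENNReal.ofReal r ^ 2 * ∫⁻ s in Set.Ioo 0 r, ‖fderiv ℝ f (x + s • v)‖ₑ ^ 2 := by
  have hfc := hf.continuous
  have hvv : ‖v‖ₑ = 1 := by rw [← ofReal_norm, hv, ENNReal.ofReal_one]
  have hpt : ∀ s ∈ Set.Ioo 0 r, ‖f x‖ₑ ^ 2 ≤ 2 * ‖f (x + s • v)‖ₑ ^ 2 +
      2 * (ENNReal.ofReal r * ∫⁻ s in Set.Ioo 0 r, ‖fderiv ℝ f (x + s • v)‖ₑ ^ 2) := by
    intro s hs
    calc ‖f x‖ₑ ^ 2 = ‖f (x + s • v) - (f (x + s • v) - f x)‖ₑ ^ 2 := by rw [sub_sub_cancel]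
      _ ≤ (‖f (x + s • v)‖ₑ + ‖f (x + s • v) - f x‖ₑ) ^ 2 := by gcongr; exact enorm_sub_le
      _ ≤ 2 * ‖f (x + s • v)‖ₑ ^ 2 + 2 * ‖f (x + s • v) - f x‖ₑ ^ 2 := ENNReal.add_sq_le _ _
      _ ≤ _ := by
        gcongr
        refine (enorm_sub_smul_sq_le hf x v hs.1.le).trans ?_
        rw [hvv, one_pow, one_mul]
        gcongr
        · exact hs.2.le
        · exact hs.2
  calc ENNReal.ofReal r * ‖f x‖ₑ ^ 2 = ∫⁻ _ in Set.Ioo 0 r, ‖f x‖ₑ ^ 2 := by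
        rw [setLIntegral_const, Real.volume_Ioo, sub_zero, mul_comm]
    _ ≤ ∫⁻ s in Set.Ioo 0 r, (2 * ‖f (x + s • v)‖ₑ ^ 2 +
          2 * (ENNReal.ofReal r * ∫⁻ s in Set.Ioo 0 r, ‖fderiv ℝ f (x + s • v)‖ₑ ^ 2)) :=
        setLIntegral_mono' measurableSet_Ioo hpt
    _ = _ := by
        have m1 : Measurable fun s : ℝ => ‖f (x + s • v)‖ₑ ^ 2 :=
          (by fun_prop : Continuous fun s : ℝ => f (x + s • v)).enorm.measurable.pow_const 2
        rw [lintegral_add_left (m1.const_mul _), lintegral_const_mul _ m1, setLIntegral_const,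
          Real.volume_Ioo, sub_zero]
        ring

/-- The trace inequality near a boundary point; the length of the boundary is locally finite. -/
theorem HasLipschitzBoundary.exists_local_trace_bound {Ω : Set Plane}
    (hΩ : HasLipschitzBoundary Ω) (ho : IsOpen Ω) {p : Plane} (hp : p ∈ frontier Ω) :
    ∃ r > 0, μH[1] (frontier Ω ∩ Metric.ball p r) ≠ ⊤ ∧ ∃ C : ℝ≥0∞, C ≠ ⊤ ∧
      ∀ f : Plane → ℝ, ContDiff ℝ 1 f →
        ∫⁻ x in frontier Ω ∩ Metric.ball p r, ‖f x‖ₑ ^ 2 ∂μH[1] ≤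
          C * ((∫⁻ x in Ω, ‖f x‖ₑ ^ 2) + ∫⁻ x in Ω, ‖fderiv ℝ f x‖ₑ ^ 2) := by
  obtain ⟨r, hr, e, γ, K, hγ, hin, hgr⟩ := hΩ.exists_chart ho hp
  set S := frontier Ω ∩ Metric.ball p r
  have hS : MeasurableSet S := isClosed_frontier.measurableSet.inter measurableSet_ball
  have hgS : ∀ x ∈ S, (e x) 1 = γ ((e x) 0) := fun x hx => hgr x hx.1 hx.2
  have hle := hausdorffMeasure_restrict_le e hγ hgS
  have hm : Measurable (graphMap e γ) := (lipschitzWith_graphMap e hγ).continuous.measurable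
  set T := graphMap e γ ⁻¹' S
  have hT : MeasurableSet T := hm hS
  -- The parameter t is a coordinate of e(`graphMap e γ t`), and the isometry e keeps this within r
  -- of e p, so T is bounded.
  have hTfin : volume T ≠ ⊤ := by
    refine (lt_of_le_of_lt (measure_mono ?_) (measure_ball_lt_top (x := (e p) 0) (r := r))).ne
    intro t ht
    have h1 : dist (graphMap e γ t) p < r := ht.2
    rw [← e.dist_map, dist_eq_norm] at h1
    have h2 := (PiLp.norm_apply_le (e (graphMap e γ t) - e p) 0).trans_lt h1
    unfold graphMap at h2
    rw [e.apply_symm_apply] at h2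
    simpa [Real.dist_eq] using h2
  have hinT : ∀ t ∈ T, ∀ s ∈ Set.Ioo 0 r,
      graphMap e γ t + s • e.symm (EuclideanSpace.single 1 1) ∈ Ω := fun t ht s hs =>
    hin _ (frontier_subset_closure ht.1) ht.2 s hs
  refine ⟨r, hr, ?_, ((1 + K : ℝ≥0) : ℝ≥0∞) * ((ENNReal.ofReal r)⁻¹ *
    (2 + 2 * ENNReal.ofReal r ^ 2)), ?_, fun f hf => ?_⟩
  · have := hle Set.univ
    rw [Measure.restrict_apply_univ, Measure.smul_apply, Measure.map_apply hm MeasurableSet.univ,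
      Set.preimage_univ, Measure.restrict_apply_univ, smul_eq_mul] at this
    exact (this.trans_lt (ENNReal.mul_lt_top ENNReal.coe_lt_top hTfin.lt_top)).ne
  · refine ENNReal.mul_ne_top ENNReal.coe_ne_top (ENNReal.mul_ne_top ?_ ?_)
    · exact ENNReal.inv_ne_top.2 (ENNReal.ofReal_pos.2 hr).ne'
    · exact ENNReal.add_ne_top.2 ⟨by norm_num, ENNReal.mul_ne_top (by norm_num)
        (ENNReal.pow_ne_top ENNReal.ofReal_ne_top)⟩
  have hfc := hf.continuous
  have hdc : Continuous (fderiv ℝ f) := hf.continuous_fderiv (by simp)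
  have mf : Measurable fun x => ‖f x‖ₑ ^ 2 := hfc.enorm.measurable.pow_const 2
  have md : Measurable fun x => ‖fderiv ℝ f x‖ₑ ^ 2 := hdc.enorm.measurable.pow_const 2
  have h1 := lintegral_graphMap_le e ho.measurableSet hT hinT _ mf
  have h2 := lintegral_graphMap_le e ho.measurableSet hT hinT _ md
  set v := e.symm (EuclideanSpace.single 1 (1 : ℝ))
  have hadd : Measurable fun q : ℝ × ℝ => graphMap e γ q.1 + q.2 • v :=
    (hm.comp measurable_fst).add (measurable_snd.smul_const v)
  have h3 : ENNReal.ofReal r * ∫⁻ t in T, ‖f (graphMap e γ t)‖ₑ ^ 2 ≤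
      2 * (∫⁻ x in Ω, ‖f x‖ₑ ^ 2) +
        2 * ENNReal.ofReal r ^ 2 * ∫⁻ x in Ω, ‖fderiv ℝ f x‖ₑ ^ 2 := by
    calc ENNReal.ofReal r * ∫⁻ t in T, ‖f (graphMap e γ t)‖ₑ ^ 2
        = ∫⁻ t in T, ENNReal.ofReal r * ‖f (graphMap e γ t)‖ₑ ^ 2 :=
          (lintegral_const_mul _ (mf.comp hm)).symm
      _ ≤ ∫⁻ t in T, (2 * (∫⁻ s in Set.Ioo 0 r, ‖f (graphMap e γ t + s • v)‖ₑ ^ 2) +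
            2 * ENNReal.ofReal r ^ 2 *
              ∫⁻ s in Set.Ioo 0 r, ‖fderiv ℝ f (graphMap e γ t + s • v)‖ₑ ^ 2) :=
          lintegral_mono fun t => mul_enorm_sq_le hf (norm_symm_single e) _ r
      _ = 2 * (∫⁻ t in T, ∫⁻ s in Set.Ioo 0 r, ‖f (graphMap e γ t + s • v)‖ₑ ^ 2) +
            2 * ENNReal.ofReal r ^ 2 *
              ∫⁻ t in T, ∫⁻ s in Set.Ioo 0 r, ‖fderiv ℝ f (graphMap e γ t + s • v)‖ₑ ^ 2 := by
          have m1 : Measurable fun t =>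
              ∫⁻ s in Set.Ioo 0 r, ‖f (graphMap e γ t + s • v)‖ₑ ^ 2 :=
            (mf.comp hadd).lintegral_prod_right'
          have m2 : Measurable fun t =>
              ∫⁻ s in Set.Ioo 0 r, ‖fderiv ℝ f (graphMap e γ t + s • v)‖ₑ ^ 2 :=
            (md.comp hadd).lintegral_prod_right'
          rw [lintegral_add_left (m1.const_mul _), lintegral_const_mul _ m1,
            lintegral_const_mul _ m2]
      _ ≤ _ := by gcongr
  have hr0 : ENNReal.ofReal r ≠ 0 := (ENNReal.ofReal_pos.2 hr).ne'
  calc ∫⁻ x in S, ‖f x‖ₑ ^ 2 ∂μH[1]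
      ≤ ((1 + K : ℝ≥0) : ℝ≥0∞) * ∫⁻ t in T, ‖f (graphMap e γ t)‖ₑ ^ 2 := by
        refine (lintegral_mono' hle le_rfl).trans_eq ?_
        rw [lintegral_smul_measure, lintegral_map mf hm, smul_eq_mul]
    _ = ((1 + K : ℝ≥0) : ℝ≥0∞) * ((ENNReal.ofReal r)⁻¹ *
          (ENNReal.ofReal r * ∫⁻ t in T, ‖f (graphMap e γ t)‖ₑ ^ 2)) := by
        rw [← mul_assoc (ENNReal.ofReal r)⁻¹, ENNReal.inv_mul_cancel hr0 ENNReal.ofReal_ne_top,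
          one_mul]
    _ ≤ ((1 + K : ℝ≥0) : ℝ≥0∞) * ((ENNReal.ofReal r)⁻¹ * ((2 + 2 * ENNReal.ofReal r ^ 2) *
          ((∫⁻ x in Ω, ‖f x‖ₑ ^ 2) + ∫⁻ x in Ω, ‖fderiv ℝ f x‖ₑ ^ 2))) := by
        gcongr ((1 + K : ℝ≥0) : ℝ≥0∞) * ((ENNReal.ofReal r)⁻¹ * ?_)
        refine h3.trans ?_
        rw [mul_add]
        gcongr
        · exact le_self_add
        · exact le_add_self
    _ = _ := by ring

/-- The trace inequality; the boundary has finite length. -/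
theorem HasLipschitzBoundary.exists_trace_bound {Ω : Set Plane}
    (hΩ : HasLipschitzBoundary Ω) (ho : IsOpen Ω) (hb : Bornology.IsBounded Ω) :
    μH[1] (frontier Ω) ≠ ⊤ ∧ ∃ C : ℝ≥0∞, C ≠ ⊤ ∧ ∀ f : Plane → ℝ, ContDiff ℝ 1 f →
      ∫⁻ x in frontier Ω, ‖f x‖ₑ ^ 2 ∂μH[1] ≤
        C * ((∫⁻ x in Ω, ‖f x‖ₑ ^ 2) + ∫⁻ x in Ω, ‖fderiv ℝ f x‖ₑ ^ 2) := by
  have hcomp : IsCompact (frontier Ω) :=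
    hb.isCompact_closure.of_isClosed_subset isClosed_frontier frontier_subset_closure
  choose! r hr hfin C hC h using
    fun p (hp : p ∈ frontier Ω) => hΩ.exists_local_trace_bound ho hp
  obtain ⟨t, ht, hcov⟩ := hcomp.elim_nhds_subcover (fun p => Metric.ball p (r p))
    fun p hp => Metric.ball_mem_nhds p (hr p hp)
  have hcov' : frontier Ω ⊆ ⋃ p ∈ t, frontier Ω ∩ Metric.ball p (r p) := by
    intro x hx
    obtain ⟨p, hp, hxp⟩ := Set.mem_iUnion₂.1 (hcov hx)
    exact Set.mem_biUnion hp ⟨hx, hxp⟩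
  refine ⟨?_, ∑ p ∈ t, C p, ?_, fun f hf => ?_⟩
  · refine ((measure_mono hcov').trans_lt ((measure_biUnion_finset_le _ _).trans_lt ?_)).ne
    exact ENNReal.sum_lt_top.2 fun p hp => (hfin p (ht p hp)).lt_top
  · exact (ENNReal.sum_lt_top.2 fun p hp => (hC p (ht p hp)).lt_top).ne
  · refine (lintegral_mono_set hcov').trans ((lintegral_biUnion_finset_le _ _ _).trans ?_)
    rw [Finset.sum_mul]
    exact Finset.sum_le_sum fun p hp => h p (ht p hp) f hf

end Graetz

/-! ### Transfer from smooth functions to their closure -/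

namespace Graetz

namespace Data

variable (G : Data)

instance : IsFiniteMeasure G.len :=
  ⟨by
    rw [Measure.restrict_apply_univ]
    exact (G.lipschitz.exists_trace_bound G.isOpen G.isBounded).1.lt_top⟩

variable {G}

theorem enorm_sq_of_ae_eq {F : Type*} [NormedAddCommGroup F] {m : Measure Plane} {s : Lp F 2 m}
    {f : Plane → F} (h : s =ᵐ[m] f) : ‖s‖ₑ ^ 2 = ∫⁻ x, ‖f x‖ₑ ^ 2 ∂m := by
  rw [Lp.enorm_sq_eq_lintegral]
  exact lintegral_congr_ae (h.mono fun x hx => by simp only [hx])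

theorem enorm_gradient (f : Plane → ℝ) (x : Plane) : ‖gradient f x‖ₑ = ‖fderiv ℝ f x‖ₑ := by
  unfold gradient
  rw [← ofReal_norm, ← ofReal_norm, LinearIsometryEquiv.norm_map]

theorem enorm_sq_of_ae_eq_gradient {m : Measure Plane} {s : Lp Plane 2 m} {f : Plane → ℝ}
    (h : s =ᵐ[m] gradient f) : ‖s‖ₑ ^ 2 = ∫⁻ x, ‖fderiv ℝ f x‖ₑ ^ 2 ∂m := by
  rw [enorm_sq_of_ae_eq h]
  simp only [enorm_gradient]

variable (G)

/-- The integral over a measurable set, as a functional on `L²`. -/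
noncomputable def setMean {Q : Set Plane} (hQ : MeasurableSet Q) : Lp ℝ 2 G.vol →L[ℝ] ℝ :=
  innerSL ℝ (indicatorConstLp 2 hQ (measure_ne_top G.vol Q) (1 : ℝ))

variable {G}

theorem setMean_apply {Q : Set Plane} (hQ : MeasurableSet Q) (s : Lp ℝ 2 G.vol) :
    G.setMean hQ s = ∫ x in Q, s x ∂G.vol :=
  L2.inner_indicatorConstLp_one hQ _ s

theorem vol_restrict {Q : Set Plane} (hQ : MeasurableSet Q) (hQΩ : Q ⊆ G.Ω) :
    G.vol.restrict Q = volume.restrict Q := by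
  rw [Measure.restrict_restrict hQ, Set.inter_eq_left.2 hQΩ]

theorem setMean_eq {Q : Set Plane} (hQ : MeasurableSet Q) (hQΩ : Q ⊆ G.Ω) {s : Lp ℝ 2 G.vol}
    {f : Plane → ℝ} (h : s =ᵐ[G.vol] f) : G.setMean hQ s = ∫ x in Q, f x := by
  rw [setMean_apply, ← vol_restrict hQ hQΩ]
  exact integral_congr_ae (ae_restrict_of_ae h)

variable (G)

/-- The trace is bounded by the norm of `H¹`. -/
theorem exists_trace_le : ∃ C : ℝ, 0 ≤ C ∧ ∀ t ∈ G.smoothTriples.topologicalClosure,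
    ‖t.2.2‖ ^ 2 ≤ C * (‖t.1‖ ^ 2 + ‖t.2.1‖ ^ 2) := by
  obtain ⟨-, C, hC, h⟩ := G.lipschitz.exists_trace_bound G.isOpen G.isBounded
  refine ⟨C.toReal, ENNReal.toReal_nonneg, fun t ht => ?_⟩
  -- The inequality defines a closed set, so it is enough to have it for smooth triples. The same
  -- device gives the other bounds on the closure.
  have hc : IsClosed {t : G.Triple | ‖t.2.2‖ ^ 2 ≤ C.toReal * (‖t.1‖ ^ 2 + ‖t.2.1‖ ^ 2)} :=
    isClosed_le (by fun_prop) (by fun_prop)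
  refine closure_minimal (fun t ht => ?_) hc ht
  obtain ⟨f, hf, h1, h2, h3⟩ := ht
  have := h f (hf.of_le (by exact_mod_cast le_top))
  rw [← enorm_sq_of_ae_eq h1, ← enorm_sq_of_ae_eq_gradient h2, ← enorm_sq_of_ae_eq h3,
    ← ofReal_norm, ← ofReal_norm, ← ofReal_norm, ← ENNReal.ofReal_pow (norm_nonneg _),
    ← ENNReal.ofReal_pow (norm_nonneg _), ← ENNReal.ofReal_pow (norm_nonneg _),
    ← ENNReal.ofReal_add (by positivity) (by positivity), ← ENNReal.ofReal_toReal hC,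
    ← ENNReal.ofReal_mul ENNReal.toReal_nonneg] at this
  exact (ENNReal.ofReal_le_ofReal_iff (by positivity)).1 this

/-- The norm of `L²` is controlled by finitely many functionals and a small multiple of the norm of
the gradient. -/
theorem exists_norm_le {ε : ℝ} (hε : 0 < ε) :
    ∃ (s : Finset (Fin 2 → ℤ)) (ℓ : (Fin 2 → ℤ) → Lp ℝ 2 G.vol →L[ℝ] ℝ),
      ∀ t ∈ G.smoothTriples.topologicalClosure,
        ‖t.1‖ ^ 2 ≤ ∑ n ∈ s, (ℓ n t.1) ^ 2 + ε * ‖t.2.1‖ ^ 2 := by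
  classical
  obtain ⟨s, Q, C, hC, hQ, h⟩ := G.lipschitz.exists_bound G.isOpen G.isBounded hε
  let ℓ : (Fin 2 → ℤ) → Lp ℝ 2 G.vol →L[ℝ] ℝ := fun n =>
    if hn : n ∈ s then √C.toReal • G.setMean (hQ n hn).1 else 0
  refine ⟨s, ℓ, fun t ht => ?_⟩
  have hc : IsClosed {t : G.Triple | ‖t.1‖ ^ 2 ≤ ∑ n ∈ s, (ℓ n t.1) ^ 2 + ε * ‖t.2.1‖ ^ 2} :=
    isClosed_le (by fun_prop) (by fun_prop)
  refine closure_minimal (fun t ht => ?_) hc ht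
  obtain ⟨f, hf, h1, h2, h3⟩ := ht
  have h4 := h f (hf.of_le (by exact_mod_cast le_top))
  have h5 : C * ∑ n ∈ s, ‖∫ x in Q n, f x‖ₑ ^ 2 = ENNReal.ofReal (∑ n ∈ s, (ℓ n t.1) ^ 2) := by
    rw [ENNReal.ofReal_sum_of_nonneg fun n _ => sq_nonneg _, Finset.mul_sum]
    refine Finset.sum_congr rfl fun n hn => ?_
    have : ℓ n t.1 = √C.toReal * ∫ x in Q n, f x := by
      simp only [ℓ, hn, dite_true, smul_apply, smul_eq_mul]
      rw [setMean_eq (hQ n hn).1 (hQ n hn).2 h1]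
    rw [this, mul_pow, Real.sq_sqrt ENNReal.toReal_nonneg,
      ENNReal.ofReal_mul ENNReal.toReal_nonneg, ENNReal.ofReal_toReal hC, ← sq_abs,
      ENNReal.ofReal_pow (abs_nonneg _), ← Real.norm_eq_abs, ofReal_norm]
  rw [h5, ← enorm_sq_of_ae_eq h1, ← enorm_sq_of_ae_eq_gradient h2, ← ofReal_norm, ← ofReal_norm,
    ← ENNReal.ofReal_pow (norm_nonneg _), ← ENNReal.ofReal_pow (norm_nonneg _),
    ← ENNReal.ofReal_mul hε.le, ← ENNReal.ofReal_add (Finset.sum_nonneg fun n _ => sq_nonneg _)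
      (by positivity)] at h4
  exact (ENNReal.ofReal_le_ofReal_iff
    (add_nonneg (Finset.sum_nonneg fun n _ => sq_nonneg _) (by positivity))).1 h4

/-- The constant `k`, with its gradient and trace. -/
noncomputable def constTriple (k : ℝ) : G.Triple :=
  (MemLp.toLp (fun _ => k) (memLp_const k), 0, MemLp.toLp (fun _ => k) (memLp_const k))

theorem constTriple_fst (k : ℝ) : (G.constTriple k).1 =ᵐ[G.vol] fun _ => k :=
  MemLp.coeFn_toLp (memLp_const k)

theorem constTriple_trace (k : ℝ) : (G.constTriple k).2.2 =ᵐ[G.len] fun _ => k :=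
  MemLp.coeFn_toLp (memLp_const k)

theorem constTriple_mem (k : ℝ) : G.constTriple k ∈ G.smoothTriples := by
  refine ⟨fun _ => k, contDiff_const, G.constTriple_fst k, ?_, G.constTriple_trace k⟩
  filter_upwards [Lp.coeFn_zero Plane 2 G.vol] with x hx
  have : gradient (fun _ : Plane => k) x = 0 := by simp [gradient]
  rw [this]
  exact hx

variable {G}

/-- An element with vanishing gradient vanishes on each ball on which it has mean zero. -/
theorem ae_eq_zero_of_setMean_eq_zero {t : G.Triple} (ht : t ∈ G.smoothTriples.topologicalClosure)
    (hg : t.2.1 = 0) {p : Plane} {r : ℝ} (hr : 0 < r) (hp : Metric.ball p r ⊆ G.Ω)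
    (hm : G.setMean (measurableSet_ball (x := p) (ε := r)) t.1 = 0) :
    ∀ᵐ x ∂volume.restrict (Metric.ball p r), t.1 x = 0 := by
  set Q := Metric.ball p r
  have hQ : MeasurableSet Q := measurableSet_ball
  have hQ0 : volume Q ≠ 0 := (Metric.measure_ball_pos volume p hr).ne'
  have hQt : volume Q ≠ ⊤ := measure_ball_lt_top.ne
  let R := LpToLpRestrictCLM Plane ℝ ℝ G.vol 2 Q
  -- The gradient constant of `poincare_convex` for a ball of radius r, whose points are less than
  -- 2r apart.
  let C : ℝ≥0∞ := 2 * (volume (Metric.ball (0 : Plane) (2 * r)) * ENNReal.ofReal (2 * r) ^ 2)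
  have hC : C ≠ ⊤ := ENNReal.mul_ne_top (by norm_num)
    (ENNReal.mul_ne_top measure_ball_lt_top.ne (ENNReal.pow_ne_top ENNReal.ofReal_ne_top))
  have hc : IsClosed {t : G.Triple | volume.real Q * ‖R t.1‖ ^ 2 ≤
      2 * (G.setMean hQ t.1) ^ 2 + C.toReal * ‖t.2.1‖ ^ 2} :=
    isClosed_le (by fun_prop) (by fun_prop)
  have key : volume.real Q * ‖R t.1‖ ^ 2 ≤
      2 * (G.setMean hQ t.1) ^ 2 + C.toReal * ‖t.2.1‖ ^ 2 := by
    refine closure_minimal (fun t ht => ?_) hc ht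
    obtain ⟨f, hf, h1, h2, h3⟩ := ht
    have h4 := poincare_convex (hf.of_le (by exact_mod_cast le_top)) hQ (convex_ball p r)
      (R := 2 * r) (fun x hx y hy => by
        have h5 := Metric.mem_ball.1 hx
        have h6 := Metric.mem_ball.1 hy
        linarith [dist_triangle_right y x p]) hQ0
    have hR : R t.1 =ᵐ[G.vol.restrict Q] f :=
      (LpToLpRestrictCLM_coeFn ℝ Q t.1).trans (ae_restrict_of_ae h1)
    have e1 : ‖R t.1‖ₑ ^ 2 = ∫⁻ x in Q, ‖f x‖ₑ ^ 2 := by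
      rw [enorm_sq_of_ae_eq hR, vol_restrict hQ hp]
    have e2 : ∫⁻ x in Q, ‖fderiv ℝ f x‖ₑ ^ 2 ≤ ‖t.2.1‖ₑ ^ 2 := by
      rw [enorm_sq_of_ae_eq_gradient h2]
      exact lintegral_mono_set hp
    have h5 : volume Q * ‖R t.1‖ₑ ^ 2 ≤ 2 * ‖G.setMean hQ t.1‖ₑ ^ 2 + C * ‖t.2.1‖ₑ ^ 2 := by
      rw [e1, setMean_eq hQ hp h1]
      refine h4.trans ?_
      rw [← mul_assoc (volume _), ← mul_assoc 2]
      gcongr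
    have e3 : 2 * ‖G.setMean hQ t.1‖ₑ ^ 2 = ENNReal.ofReal (2 * (G.setMean hQ t.1) ^ 2) := by
      rw [← ofReal_norm, ← ENNReal.ofReal_pow (norm_nonneg _), Real.norm_eq_abs, sq_abs,
        ENNReal.ofReal_mul (by norm_num), ENNReal.ofReal_ofNat]
    rw [e3, ← ofReal_norm, ← ofReal_norm, ← ENNReal.ofReal_pow (norm_nonneg _),
      ← ENNReal.ofReal_pow (norm_nonneg _), ← ENNReal.ofReal_toReal hC,
      ← ENNReal.ofReal_toReal hQt,
      ← ENNReal.ofReal_mul ENNReal.toReal_nonneg, ← ENNReal.ofReal_mul ENNReal.toReal_nonneg,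
      ← ENNReal.ofReal_add (by positivity)
        (mul_nonneg ENNReal.toReal_nonneg (by positivity))] at h5
    exact (ENNReal.ofReal_le_ofReal_iff (add_nonneg (by positivity)
      (mul_nonneg ENNReal.toReal_nonneg (by positivity)))).1 h5
  rw [hm, hg, norm_zero] at key
  have hv : 0 < volume.real Q := ENNReal.toReal_pos hQ0 hQt
  have hR0 : R t.1 = 0 := by
    rw [← norm_eq_zero]
    by_contra hne
    have : 0 < ‖R t.1‖ ^ 2 := by positivity
    nlinarith
  have h1 := LpToLpRestrictCLM_coeFn ℝ Q t.1
  rw [show LpToLpRestrictCLM Plane ℝ ℝ G.vol 2 Q t.1 = 0 from hR0] at h1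
  rw [← vol_restrict hQ hp]
  filter_upwards [h1, Lp.coeFn_zero ℝ 2 (G.vol.restrict Q)] with x hx hx0
  rw [← hx, hx0, Pi.zero_apply]

/-- Subtract the mean over the ball, so that the previous lemma applies. -/
theorem exists_ball_ae_const {t : G.Triple} (ht : t ∈ G.smoothTriples.topologicalClosure)
    (hg : t.2.1 = 0) {p : Plane} (hp : p ∈ G.Ω) :
    ∃ r > 0, Metric.ball p r ⊆ G.Ω ∧
      ∃ k : ℝ, ∀ᵐ x ∂volume.restrict (Metric.ball p r), t.1 x = k := by
  obtain ⟨r, hr, hrΩ⟩ := Metric.isOpen_iff.1 G.isOpen p hp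
  have hQ : MeasurableSet (Metric.ball p r) := measurableSet_ball
  have hv : 0 < volume.real (Metric.ball p r) :=
    ENNReal.toReal_pos (Metric.measure_ball_pos volume p hr).ne' measure_ball_lt_top.ne
  set k : ℝ := G.setMean hQ t.1 / volume.real (Metric.ball p r)
  refine ⟨r, hr, hrΩ, k, ?_⟩
  have h0 := ae_eq_zero_of_setMean_eq_zero (t := t - G.constTriple k)
    (Submodule.sub_mem _ ht (Submodule.le_topologicalClosure _ (G.constTriple_mem k)))
    (by change t.2.1 - 0 = 0; rw [hg, sub_zero]) hr hrΩ (by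
      change G.setMean hQ (t.1 - (G.constTriple k).1) = 0
      rw [map_sub, setMean_eq hQ hrΩ (G.constTriple_fst k), setIntegral_const,
        smul_eq_mul, mul_div_cancel₀ _ hv.ne', sub_self])
  have h1 : ∀ᵐ x ∂volume.restrict (Metric.ball p r),
      (t - G.constTriple k).1 x = t.1 x - k := by
    rw [← vol_restrict hQ hrΩ]
    refine ae_restrict_of_ae ?_
    filter_upwards [Lp.coeFn_sub t.1 (G.constTriple k).1, G.constTriple_fst k] with x hx hx2
    refine Eq.trans hx ?_
    rw [Pi.sub_apply, hx2]
  filter_upwards [h0, h1] with x hx hx1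
  linarith

/-- An element with vanishing gradient is constant. -/
theorem exists_ae_const {t : G.Triple} (ht : t ∈ G.smoothTriples.topologicalClosure)
    (hg : t.2.1 = 0) : ∃ k : ℝ, ∀ᵐ x ∂G.vol, t.1 x = k := by
  choose! r hr hrΩ κ hκ using fun p (hp : p ∈ G.Ω) => exists_ball_ae_const ht hg hp
  -- The two balls overlap in a nonempty open set, of positive measure, where both constants are the
  -- value of t almost everywhere.
  have hloc : ∀ p ∈ G.Ω, ∀ q ∈ Metric.ball p (r p), κ q = κ p := by
    intro p hp q hq
    have hqΩ := hrΩ p hp hq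
    have hop : IsOpen (Metric.ball p (r p) ∩ Metric.ball q (r q)) :=
      Metric.isOpen_ball.inter Metric.isOpen_ball
    have hpos := hop.measure_pos volume ⟨q, hq, Metric.mem_ball_self (hr q hqΩ)⟩
    have h1 := ae_restrict_of_ae_restrict_of_subset Set.inter_subset_left (hκ p hp)
      (s := Metric.ball p (r p) ∩ Metric.ball q (r q))
    have h2 := ae_restrict_of_ae_restrict_of_subset Set.inter_subset_right (hκ q hqΩ)
      (s := Metric.ball p (r p) ∩ Metric.ball q (r q))
    have : (ae (volume.restrict (Metric.ball p (r p) ∩ Metric.ball q (r q)))).NeBot := by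
      rw [ae_neBot]
      intro h0
      rw [Measure.restrict_eq_zero] at h0
      exact hpos.ne' h0
    obtain ⟨x, hx1, hx2⟩ := (h1.and h2).exists
    rw [← hx1, ← hx2]
  obtain ⟨p₀, hp₀⟩ := G.isConnected.nonempty
  -- The local constant is locally constant in p, and Ω is connected.
  have hconst : ∀ p ∈ G.Ω, κ p = κ p₀ := by
    have hU : IsOpen {p ∈ G.Ω | κ p = κ p₀} := by
      refine Metric.isOpen_iff.2 fun p hp => ⟨r p, hr p hp.1, fun q hq => ?_⟩
      exact ⟨hrΩ p hp.1 hq, (hloc p hp.1 q hq).trans hp.2⟩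
    have hV : IsOpen {p ∈ G.Ω | κ p ≠ κ p₀} := by
      refine Metric.isOpen_iff.2 fun p hp => ⟨r p, hr p hp.1, fun q hq => ?_⟩
      exact ⟨hrΩ p hp.1 hq, fun h => hp.2 ((hloc p hp.1 q hq).symm.trans h)⟩
    intro p hp
    by_contra hne
    obtain ⟨q, -, hq1, hq2⟩ := G.isConnected.isPreconnected _ _ hU hV
      (fun q hq => (em (κ q = κ p₀)).imp (fun h => ⟨hq, h⟩) fun h => ⟨hq, h⟩)
      ⟨p₀, hp₀, hp₀, rfl⟩ ⟨p, hp, hp, hne⟩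
    exact hq2.2 hq1.2
  refine ⟨κ p₀, ?_⟩
  rw [ae_restrict_iff' G.isOpen.measurableSet, ae_iff]
  -- The choice of balls is uncountable, so null sets are combined through local nullity.
  refine measure_null_of_locally_null _ fun p hp => ?_
  have hpΩ : p ∈ G.Ω := by
    by_contra h
    exact hp fun h' => absurd h' h
  have h1 := hκ p hpΩ
  rw [ae_restrict_iff' measurableSet_ball, ae_iff] at h1
  refine ⟨_, ?_, h1⟩
  filter_upwards [self_mem_nhdsWithin, mem_nhdsWithin_of_mem_nhds
    (Metric.ball_mem_nhds p (hr p hpΩ))] with x hx hxb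
  intro h
  refine hx fun _ => ?_
  rw [h hxb, hconst p hpΩ]

/-! ### Weak gradients, test functions and density -/

/-- The gradient of a smooth function is its weak gradient. -/
theorem isWeakGradient_of_contDiff {f : Plane → ℝ} (hf : ContDiff ℝ (⊤ : ℕ∞) f)
    {s : Lp ℝ 2 G.vol} {g : Lp Plane 2 G.vol} (hs : s =ᵐ[G.vol] f) (hg : g =ᵐ[G.vol] gradient f) :
    G.IsWeakGradient s g := by
  intro η hη hc ht v
  have hη1 : Continuous fun x => fderiv ℝ η x v :=
    (hη.continuous_fderiv (by simp)).clm_apply continuous_const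
  have hf1 : Continuous fun x => fderiv ℝ f x v :=
    (hf.continuous_fderiv (by simp)).clm_apply continuous_const
  have hcη : HasCompactSupport fun x => fderiv ℝ η x v := hc.fderiv_apply ℝ v
  have l : ∫ x, s x * fderiv ℝ η x v ∂G.vol = ∫ x, f x * fderiv ℝ η x v := by
    rw [integral_congr_ae (hs.mono fun x hx => by
      simp only [hx] : (fun x => s x * fderiv ℝ η x v) =ᵐ[G.vol] fun x => f x * fderiv ℝ η x v)]
    refine setIntegral_eq_integral_of_forall_compl_eq_zero fun x hx => ?_
    have : fderiv ℝ η x = 0 := image_eq_zero_of_notMem_tsupport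
      fun h => hx (ht (tsupport_fderiv_subset ℝ h))
    rw [this, zero_apply, mul_zero]
  have r : ∫ x, inner ℝ (g x) v * η x ∂G.vol = ∫ x, fderiv ℝ f x v * η x := by
    rw [integral_congr_ae (hg.mono fun x hx => by
      simp only [hx, gradient, InnerProductSpace.toDual_symm_apply] :
      (fun x => inner ℝ (g x) v * η x) =ᵐ[G.vol] fun x => fderiv ℝ f x v * η x)]
    refine setIntegral_eq_integral_of_forall_compl_eq_zero fun x hx => ?_
    rw [image_eq_zero_of_notMem_tsupport fun h => hx (ht h), mul_zero]
  rw [l, r]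
  refine integral_mul_fderiv_eq_neg_fderiv_mul_of_integrable ?_ ?_ ?_
    (fun x _ => (hf.differentiable (by simp)) x) (fun x _ => (hη.differentiable (by simp)) x)
  · exact (hf1.mul hη.continuous).integrable_of_hasCompactSupport hc.mul_left
  · exact (hf.continuous.mul hη1).integrable_of_hasCompactSupport hcη.mul_left
  · exact (hf.continuous.mul hη.continuous).integrable_of_hasCompactSupport hc.mul_left

variable (G) in
/-- Test functions are elements of `V`. -/
theorem exists_mem_V_of_hasCompactSupport {η : Plane → ℝ} (hη : ContDiff ℝ (⊤ : ℕ∞) η)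
    (hc : HasCompactSupport η) (ht : tsupport η ⊆ G.Ω) :
    ∃ s : G.V, G.fn s =ᵐ[G.vol] η := by
  have m1 : MemLp η 2 G.vol := hη.continuous.memLp_of_hasCompactSupport hc
  have cg : Continuous (gradient η) :=
    (LinearIsometryEquiv.continuous _).comp (hη.continuous_fderiv (by simp))
  have sg : HasCompactSupport (gradient η) :=
    (hc.fderiv ℝ).comp_left (map_zero (InnerProductSpace.toDual ℝ Plane).symm)
  have m2 : MemLp (gradient η) 2 G.vol := cg.memLp_of_hasCompactSupport sg
  have z : ∀ᵐ x ∂G.len, (0 : Lp ℝ 2 G.len) x = 0 := Lp.coeFn_zero _ _ _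
  let t : G.Triple := (m1.toLp η, m2.toLp (gradient η), 0)
  have hmem : t ∈ G.smoothTriples := by
    refine ⟨η, hη, m1.coeFn_toLp, m2.coeFn_toLp, ?_⟩
    filter_upwards [z, ae_restrict_mem isClosed_frontier.measurableSet] with x hx hxf
    change (0 : Lp ℝ 2 G.len) x = η x
    rw [G.isOpen.frontier_eq] at hxf
    rw [hx, image_eq_zero_of_notMem_tsupport (f := η) fun h => hxf.2 (ht h)]
  refine ⟨⟨t, isWeakGradient_of_contDiff hη m1.coeFn_toLp m2.coeFn_toLp,
    Submodule.le_topologicalClosure _ hmem,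
    ae_mono (Measure.restrict_mono G.ΓD_subset le_rfl) z, fun k => ?_⟩, m1.coeFn_toLp⟩
  filter_upwards [G.ae_face k z, G.ae_face_add k z] with x h1 h2
  exact h2.trans h1.symm

/-- `V` is dense in `L²`. -/
theorem eq_zero_of_forall_integral_mul_fn {f : Lp ℝ 2 G.vol}
    (h : ∀ v : G.V, ∫ x, f x * G.fn v x ∂G.vol = 0) : f = 0 := by
  have hloc : LocallyIntegrableOn f G.Ω volume :=
    IntegrableOn.locallyIntegrableOn ((Lp.memLp f).integrable (by norm_num))
  have h0 := G.isOpen.ae_eq_zero_of_integral_contDiff_smul_eq_zero hloc fun η hη hc ht => by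
    obtain ⟨s, hs⟩ := G.exists_mem_V_of_hasCompactSupport (hη.of_le le_rfl) hc ht
    rw [← setIntegral_eq_integral_of_forall_compl_eq_zero (s := G.Ω), ← h s]
    · refine integral_congr_ae (hs.mono fun x hx => ?_)
      simp only [hx, smul_eq_mul, mul_comm]
    · intro x hx
      rw [image_eq_zero_of_notMem_tsupport fun h => hx (ht h), zero_smul]
  refine (Lp.eq_zero_iff_ae_eq_zero).2 ?_
  exact (ae_restrict_iff' G.isOpen.measurableSet).2 h0

/-- The derivative of a test function has integral zero, so g is orthogonal to all test fields with
constant direction. -/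
theorem IsWeakGradient.eq_zero_of_ae_const {s : Lp ℝ 2 G.vol} {g : Lp Plane 2 G.vol}
    (h : G.IsWeakGradient s g) {k : ℝ} (hs : ∀ᵐ x ∂G.vol, s x = k) : g = 0 := by
  have hg : ∀ v : Plane, ∀ᵐ x ∂G.vol, inner ℝ (g x) v = 0 := by
    intro v
    have hloc : LocallyIntegrableOn (fun x => inner ℝ (g x) v) G.Ω volume :=
      IntegrableOn.locallyIntegrableOn (((Lp.memLp g).inner_const v).integrable (by norm_num))
    refine (ae_restrict_iff' G.isOpen.measurableSet).2
      (G.isOpen.ae_eq_zero_of_integral_contDiff_smul_eq_zero hloc fun η hη hc ht => ?_)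
    have h1 := h η (hη.of_le le_rfl) hc ht v
    have h2 : ∫ x, s x * fderiv ℝ η x v ∂G.vol = k * ∫ x, fderiv ℝ η x v := by
      rw [integral_congr_ae (hs.mono fun x hx => by
        simp only [hx] : (fun x => s x * fderiv ℝ η x v) =ᵐ[G.vol] fun x => k * fderiv ℝ η x v),
        integral_const_mul]
      congr 1
      refine setIntegral_eq_integral_of_forall_compl_eq_zero fun x hx => ?_
      have : fderiv ℝ η x = 0 := image_eq_zero_of_notMem_tsupport
        fun h => hx (ht (tsupport_fderiv_subset ℝ h))
      rw [this, zero_apply]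
    have h3 : ∫ x, fderiv ℝ η x v = 0 := by
      have c1 : Continuous fun x => fderiv ℝ η x v :=
        (hη.continuous_fderiv (by simp)).clm_apply continuous_const
      have := integral_mul_fderiv_eq_neg_fderiv_mul_of_integrable (𝕜 := ℝ)
        (μ := (volume : Measure Plane)) (f := fun _ : Plane => (1 : ℝ)) (g := η) (v := v) (by simp)
        (by simpa using c1.integrable_of_hasCompactSupport (hc.fderiv_apply ℝ v))
        (by simpa using hη.continuous.integrable_of_hasCompactSupport hc)
        (by fun_prop) (fun x _ => (hη.differentiable (by simp)) x)
      simpa using this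
    rw [h2, h3, mul_zero, zero_eq_neg] at h1
    rw [← h1, ← setIntegral_eq_integral_of_forall_compl_eq_zero (s := G.Ω)]
    · exact integral_congr_ae (Filter.Eventually.of_forall fun x => by
        simp only [smul_eq_mul, mul_comm])
    · intro x hx
      rw [image_eq_zero_of_notMem_tsupport fun h => hx (ht h), zero_smul]
  refine (Lp.eq_zero_iff_ae_eq_zero).2 ?_
  filter_upwards [hg (EuclideanSpace.single 0 1), hg (EuclideanSpace.single 1 1)] with x h0 h1
  ext i
  fin_cases i
  · simpa [EuclideanSpace.inner_single_right] using h0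
  · simpa [EuclideanSpace.inner_single_right] using h1

/-! ### The space V and the null vectors of the energy -/

theorem fn_coe (s : G.V) : (s : G.Triple).1 = G.fn s := rfl

theorem norm_trace_sq_le : ∃ C : ℝ, 0 ≤ C ∧ ∀ s : G.V,
    ‖G.trace s‖ ^ 2 ≤ C * (‖G.fn s‖ ^ 2 + ‖G.grad s‖ ^ 2) := by
  obtain ⟨C, hC, h⟩ := G.exists_trace_le
  exact ⟨C, hC, fun s => h s s.2.2.1⟩

/-- A function determines its weak gradient, and then the trace inequality determines its trace, so
the triples of V really are functions. -/
theorem eq_zero_of_fn_eq_zero {s : G.V} (h : G.fn s = 0) : s = 0 := by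
  have hg : G.grad s = 0 := by
    refine IsWeakGradient.eq_zero_of_ae_const s.2.1 (k := 0) ?_
    rw [fn_coe, h]
    exact Lp.coeFn_zero _ _ _
  have ht : G.trace s = 0 := by
    obtain ⟨C, hC, hle⟩ := norm_trace_sq_le (G := G)
    have := hle s
    rw [h, hg] at this
    simpa using this
  exact Subtype.ext (Prod.ext h (Prod.ext hg ht))

theorem exists_ae_const_of_grad_eq_zero {s : G.V} (h : G.grad s = 0) :
    ∃ k : ℝ, ∀ᵐ x ∂G.vol, G.fn s x = k :=
  exists_ae_const s.2.2.1 h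

theorem grad_eq_zero_of_ae_const {s : G.V} {k : ℝ} (h : ∀ᵐ x ∂G.vol, G.fn s x = k) :
    G.grad s = 0 :=
  IsWeakGradient.eq_zero_of_ae_const s.2.1 h

/-- The trace of a constant function is that constant. -/
theorem trace_ae_eq_const {s : G.V} {k : ℝ} (h : ∀ᵐ x ∂G.vol, G.fn s x = k) :
    ∀ᵐ x ∂G.len, G.trace s x = k := by
  obtain ⟨C, hC, hle⟩ := G.exists_trace_le
  have h1 := hle (s - G.constTriple k) (Submodule.sub_mem _ s.2.2.1
    (Submodule.le_topologicalClosure _ (G.constTriple_mem k)))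
  have e1 : ((s : G.Triple) - G.constTriple k).1 = 0 := by
    change G.fn s - (G.constTriple k).1 = 0
    rw [sub_eq_zero]
    refine Lp.ext ?_
    filter_upwards [h, G.constTriple_fst k] with x hx hk
    rw [hx, hk]
  have e2 : ((s : G.Triple) - G.constTriple k).2.1 = 0 := by
    change G.grad s - 0 = 0
    rw [grad_eq_zero_of_ae_const h, sub_zero]
  rw [e1, e2] at h1
  have e3 : G.trace s - (G.constTriple k).2.2 = 0 := by
    have : ‖((s : G.Triple) - G.constTriple k).2.2‖ ^ 2 ≤ 0 := by simpa using h1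
    exact norm_eq_zero.1 (pow_eq_zero_iff two_ne_zero |>.1 (this.antisymm (sq_nonneg _)))
  rw [sub_eq_zero] at e3
  rw [e3]
  exact G.constTriple_trace k

theorem wInner_zero_left {F : Type*} [NormedAddCommGroup F] [InnerProductSpace ℝ F]
    {m m' : Measure Plane} {w : Plane → ℝ} {f g : Lp F 2 m} (h : ∀ᵐ x ∂m', f x = 0) :
    wInner m' w f g = 0 := by
  refine integral_eq_zero_of_ae (h.mono fun x hx => ?_)
  simp only [hx, inner_zero_left, mul_zero, Pi.zero_apply]

theorem ae_eq_zero_of_wInner_self {F : Type*} [NormedAddCommGroup F] [InnerProductSpace ℝ F]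
    {m m' : Measure Plane} {w : Plane → ℝ} {f : Lp F 2 m} (hm : m' ≤ m)
    (hw : AEStronglyMeasurable w m') (hb : ∃ M, ∀ᵐ x ∂m', ‖w x‖ ≤ M) (hpos : ∀ᵐ x ∂m', 0 < w x)
    (h : wInner m' w f f = 0) : ∀ᵐ x ∂m', f x = 0 := by
  have h1 := (integral_eq_zero_iff_of_nonneg_ae (hpos.mono fun x hx =>
    mul_nonneg hx.le real_inner_self_nonneg) (wInner_integrable hm hw hb f f)).1 h
  filter_upwards [h1, hpos] with x hx hx0
  exact inner_self_eq_zero.1 ((mul_eq_zero.1 hx).resolve_left hx0.ne')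

theorem ae_pos {m : Measure Plane} {w : Plane → ℝ}
    (h : ∃ a b : ℝ, 0 < a ∧ ∀ᵐ x ∂m, a ≤ w x ∧ w x ≤ b) : ∀ᵐ x ∂m, 0 < w x := by
  obtain ⟨a, b, ha, hw⟩ := h
  exact hw.mono fun x hx => ha.trans_le hx.1

theorem eq_zero_of_mass_eq_zero {u : Lp ℝ 2 G.vol} (h : wInner G.vol G.c u u = 0) : u = 0 :=
  Lp.eq_zero_iff_ae_eq_zero.2 (ae_eq_zero_of_wInner_self le_rfl G.c_meas (norm_bound G.c_bounds).1
    (ae_pos G.c_bounds) h)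

theorem energy_self_eq_zero_iff {s : G.V} : G.energy s s = 0 ↔
    G.grad s = 0 ∧ ∀ᵐ x ∂(μH[1].restrict G.ΓR), G.trace s x = 0 := by
  constructor
  · intro h
    have h1 := wInner_nonneg (norm_bound G.σ_bounds).2 (G.grad s)
    have h2 := wInner_nonneg G.a_nonneg (G.trace s)
    unfold energy at h
    refine ⟨Lp.eq_zero_iff_ae_eq_zero.2 (ae_eq_zero_of_wInner_self le_rfl G.σ_meas
      (norm_bound G.σ_bounds).1 (ae_pos G.σ_bounds) (by linarith)),
      ae_eq_zero_of_wInner_self G.robin_le G.a_meas G.a_norm_bound ?_ (by linarith)⟩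
    obtain ⟨M, hM⟩ := G.a_bounds
    exact hM.mono fun x hx => hx.1
  · rintro ⟨h1, h2⟩
    unfold energy
    rw [wInner_zero_left h2, wInner_zero_left (Lp.eq_zero_iff_ae_eq_zero.1 h1), add_zero]

theorem energy_eq_zero_of_self {s : G.V} (h : G.energy s s = 0) (v : G.V) : G.energy s v = 0 := by
  obtain ⟨h1, h2⟩ := energy_self_eq_zero_iff.1 h
  unfold energy
  rw [wInner_zero_left h2, wInner_zero_left (Lp.eq_zero_iff_ae_eq_zero.1 h1), add_zero]

theorem energy_self_eq_zero_iff_of_notControlled (hG : G.NotControlled) {s : G.V} :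
    G.energy s s = 0 ↔ ∃ k : ℝ, ∀ᵐ x ∂G.vol, G.fn s x = k := by
  have hR : G.ΓR = ∅ := (Set.union_empty_iff.1 hG).2
  rw [energy_self_eq_zero_iff]
  constructor
  · exact fun h => exists_ae_const_of_grad_eq_zero h.1
  · rintro ⟨k, hk⟩
    refine ⟨grad_eq_zero_of_ae_const hk, ?_⟩
    rw [hR, Measure.restrict_empty]
    exact ae_zero.le Filter.eventually_bot

/-- Zero energy makes s constant with constant trace. The trace vanishes on Γ_D by definition of V
and on Γ_R by positivity of a, and `nondegenerate` gives this set positive length. -/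
theorem eq_zero_of_energy_self (hG : ¬ G.NotControlled) {s : G.V} (h : G.energy s s = 0) :
    s = 0 := by
  obtain ⟨h1, h2⟩ := energy_self_eq_zero_iff.1 h
  obtain ⟨k, hk⟩ := exists_ae_const_of_grad_eq_zero h1
  have ht := trace_ae_eq_const hk
  have hpos := G.nondegenerate (Set.nonempty_iff_ne_empty.2 hG)
  have h0 : ∀ᵐ x ∂(μH[1].restrict (G.ΓD ∪ G.ΓR)), G.trace s x = 0 :=
    (ae_restrict_union_iff _ _ _).2 ⟨s.2.2.2.1, h2⟩
  have h3 : ∀ᵐ x ∂(μH[1].restrict (G.ΓD ∪ G.ΓR)), G.trace s x = k :=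
    ae_mono (Measure.restrict_mono (Set.union_subset G.ΓD_subset G.ΓR_subset) le_rfl) ht
  have hne : (ae ((μH[1] : Measure Plane).restrict (G.ΓD ∪ G.ΓR))).NeBot := by
    rw [ae_neBot, Ne, Measure.restrict_eq_zero]
    exact hpos.ne'
  obtain ⟨x, hx0, hx⟩ := (h0.and h3).exists
  refine eq_zero_of_fn_eq_zero (Lp.eq_zero_iff_ae_eq_zero.2 (hk.mono fun y hy => ?_))
  rw [hy, ← hx, hx0]
  rfl

theorem pair_eq_zero_iff {u : Lp ℝ 2 G.vol} {s : G.V} :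
    G.pair u s = 0 ↔ u = 0 ∧ G.energy s s = 0 := by
  rw [← inner_self_eq_zero (𝕜 := ℝ), inner_pair]
  constructor
  · intro h
    have h1 := G.mass_nonneg u
    have h2 := G.energy_nonneg s
    exact ⟨eq_zero_of_mass_eq_zero (by linarith), by linarith⟩
  · rintro ⟨rfl, h⟩
    rw [h, wInner_zero_left (Lp.coeFn_zero _ _ _), add_zero]

/-- The constant function `1`, if the constants are not controlled. -/
theorem exists_fn_eq_one (hG : G.NotControlled) : ∃ s : G.V, G.fn s = G.one := by
  have hD : G.ΓD = ∅ := (Set.union_empty_iff.1 hG).1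
  have hz : gradient (fun _ : Plane => (1 : ℝ)) = 0 := by
    ext1 x
    simp [gradient]
  refine ⟨⟨G.constTriple 1, isWeakGradient_of_contDiff contDiff_const (G.constTriple_fst 1) ?_,
    Submodule.le_topologicalClosure _ (G.constTriple_mem 1), ?_, fun k => ?_⟩, rfl⟩
  · rw [hz]
    exact Lp.coeFn_zero _ _ _
  · rw [hD, Measure.restrict_empty]
    exact ae_zero.le Filter.eventually_bot
  · filter_upwards [G.ae_face k (G.constTriple_trace 1), G.ae_face_add k (G.constTriple_trace 1)]
      with x h1 h2
    exact h2.trans h1.symm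

theorem exists_seq_tendsto_ae {m : Measure Plane} {z : ℕ → Lp ℝ 2 m} {z₀ : Lp ℝ 2 m}
    (h : Filter.Tendsto z Filter.atTop (nhds z₀)) : ∃ ns : ℕ → ℕ, StrictMono ns ∧
      ∀ᵐ x ∂m, Filter.Tendsto (fun i => z (ns i) x) Filter.atTop (nhds (z₀ x)) :=
  (tendstoInMeasure_of_tendsto_Lp h).exists_seq_tendsto_ae

theorem isClosed_isWeakGradient :
    IsClosed {t : Lp ℝ 2 G.vol × Lp Plane 2 G.vol | G.IsWeakGradient t.1 t.2} := by
  have : {t : Lp ℝ 2 G.vol × Lp Plane 2 G.vol | G.IsWeakGradient t.1 t.2} =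
      ⋂ (η : Plane → ℝ) (_ : ContDiff ℝ (⊤ : ℕ∞) η) (_ : HasCompactSupport η)
        (_ : tsupport η ⊆ G.Ω) (v : Plane), {t : Lp ℝ 2 G.vol × Lp Plane 2 G.vol |
          ∫ x, t.1 x * fderiv ℝ η x v ∂G.vol = -∫ x, inner ℝ (t.2 x) v * η x ∂G.vol} := by
    ext t
    simp only [Set.mem_iInter]
    rfl
  rw [this]
  refine isClosed_iInter fun η => isClosed_iInter fun hη => isClosed_iInter fun hc =>
    isClosed_iInter fun ht => isClosed_iInter fun v => ?_
  have c1 : Continuous fun x => fderiv ℝ η x v :=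
    (hη.continuous_fderiv (by simp)).clm_apply continuous_const
  have m1 : MemLp (fun x => fderiv ℝ η x v) 2 G.vol :=
    c1.memLp_of_hasCompactSupport (hc.fderiv_apply ℝ v)
  have m2 : MemLp (fun x => η x • v) 2 G.vol :=
    (hη.continuous.smul continuous_const).memLp_of_hasCompactSupport hc.smul_right
  have e1 : ∀ s : Lp ℝ 2 G.vol, ∫ x, s x * fderiv ℝ η x v ∂G.vol = inner ℝ (m1.toLp _) s := by
    intro s
    rw [L2.inner_def]
    refine integral_congr_ae ?_
    filter_upwards [m1.coeFn_toLp] with x hx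
    rw [hx]
    rfl
  have e2 : ∀ g : Lp Plane 2 G.vol,
      ∫ x, inner ℝ (g x) v * η x ∂G.vol = inner ℝ (m2.toLp _) g := by
    intro g
    rw [L2.inner_def]
    refine integral_congr_ae ?_
    filter_upwards [m2.coeFn_toLp] with x hx
    rw [hx, real_inner_smul_left, real_inner_comm, mul_comm]
  simp only [e1, e2]
  exact isClosed_eq (by fun_prop) (by fun_prop)

variable (G) in
-- The boundary conditions pass to L² limits along a subsequence converging almost everywhere;
-- translation of a face preserves null sets.
theorem isClosed_V : IsClosed (G.V : Set G.Triple) := by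
  refine IsSeqClosed.isClosed fun t t₀ ht hlim => ?_
  have hl1 : Filter.Tendsto (fun n => ((t n).1, (t n).2.1)) Filter.atTop
      (nhds (t₀.1, t₀.2.1)) :=
    ((continuous_fst.prodMk (continuous_fst.comp continuous_snd)).tendsto t₀).comp hlim
  have hl2 : Filter.Tendsto (fun n => (t n).2.2) Filter.atTop (nhds t₀.2.2) :=
    ((continuous_snd.comp continuous_snd).tendsto t₀).comp hlim
  obtain ⟨ns, -, hns⟩ := exists_seq_tendsto_ae hl2
  refine ⟨isClosed_isWeakGradient.isSeqClosed (fun n => (ht n).1) hl1,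
    G.smoothTriples.isClosed_topologicalClosure.isSeqClosed (fun n => (ht n).2.1) hlim, ?_,
    fun k => ?_⟩
  · filter_upwards [ae_mono (Measure.restrict_mono G.ΓD_subset le_rfl) hns,
      ae_all_iff.2 fun n => (ht n).2.2.1] with x hx h0
    simp only [h0] at hx
    exact tendsto_nhds_unique hx tendsto_const_nhds
  · filter_upwards [G.ae_face k hns, G.ae_face_add k hns,
      ae_all_iff.2 fun n => (ht n).2.2.2 k] with x hx hx' h0
    simp only [h0] at hx'
    exact tendsto_nhds_unique hx' hx

instance : CompleteSpace G.V := (G.isClosed_V).completeSpace_coe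

end Data

end Graetz

/-! ### Compactness criteria and lower bounds -/

/-- An operator that is small up to finite-rank perturbations is compact. -/
theorem isCompactOperator_of_forall_norm_sq_le {E F : Type*} [NormedAddCommGroup E]
    [NormedSpace ℝ E] [NormedAddCommGroup F] [NormedSpace ℝ F] [CompleteSpace F] (T : E →L[ℝ] F)
    (h : ∀ ε > 0, ∃ (n : ℕ) (A : E →L[ℝ] EuclideanSpace ℝ (Fin n)),
      ∀ x, ‖T x‖ ^ 2 ≤ ‖A x‖ ^ 2 + ε * ‖x‖ ^ 2) : IsCompactOperator T := by
  refine (isCompactOperator_iff_isCompact_closure_image_closedBall T.toLinearMap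
    zero_lt_one).2 ?_
  refine TotallyBounded.isCompact_of_isClosed (TotallyBounded.closure ?_) isClosed_closure
  refine Metric.totallyBounded_iff.2 fun δ hδ => ?_
  -- Two points of the ball are at most 2 apart, so nearby values of A give ‖T(x - y)‖² ≤ (δ/2)² + 4
  -- δ²/16 < δ².
  obtain ⟨n, A, hA⟩ := h (δ ^ 2 / 16) (by positivity)
  have hb : Bornology.IsBounded (A '' Metric.closedBall 0 1) :=
    A.lipschitz.isBounded_image Metric.isBounded_closedBall
  obtain ⟨t, ht, htf, hcov⟩ := (hb.isCompact_closure.totallyBounded.subset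
    subset_closure).exists_subset
    (Metric.dist_mem_uniformity (half_pos hδ))
  have ht' : ∀ y ∈ t, ∃ x ∈ Metric.closedBall (0 : E) 1, A x = y := fun y hy => ht hy
  choose! p hp hpt using ht'
  refine ⟨(fun y => T (p y)) '' t, htf.image _, ?_⟩
  rintro _ ⟨x, hx, rfl⟩
  obtain ⟨y, hy, hxy⟩ := Set.mem_iUnion₂.1 (hcov ⟨x, hx, rfl⟩)
  refine Set.mem_iUnion₂.2 ⟨T (p y), ⟨y, hy, rfl⟩, ?_⟩
  rw [Metric.mem_ball, dist_eq_norm]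
  change ‖T x - T (p y)‖ < δ
  have h1 := hA (x - p y)
  have h2 : ‖A (x - p y)‖ < δ / 2 := by
    rw [map_sub, hpt y hy, ← dist_eq_norm]
    exact hxy
  have h3 : ‖x - p y‖ ≤ 2 := by
    have := norm_sub_le x (p y)
    have h4 := mem_closedBall_zero_iff.1 hx
    have h5 := mem_closedBall_zero_iff.1 (hp y hy)
    linarith
  rw [← map_sub]
  refine lt_of_pow_lt_pow_left₀ 2 hδ.le ?_
  have h6 : ‖A (x - p y)‖ ^ 2 < (δ / 2) ^ 2 := by gcongr
  have h7 : ‖x - p y‖ ^ 2 ≤ 2 ^ 2 := by gcongr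
  nlinarith [sq_nonneg δ, mul_le_mul_of_nonneg_left h7 (by positivity : 0 ≤ δ ^ 2 / 16)]

/-- An injective operator that is bounded below up to a compact operator is bounded below. -/
theorem exists_norm_le_of_isCompactOperator {E F H : Type*} [NormedAddCommGroup E]
    [NormedSpace ℝ E] [CompleteSpace E] [NormedAddCommGroup F] [NormedSpace ℝ F]
    [NormedAddCommGroup H] [NormedSpace ℝ H] {T : E →L[ℝ] F} (hT : IsCompactOperator T)
    (A : E →L[ℝ] H) (hA : ∀ x, A x = 0 → x = 0) {C : ℝ} (h : ∀ x, ‖x‖ ≤ C * (‖T x‖ + ‖A x‖)) :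
    ∃ c : ℝ, ∀ x, ‖x‖ ≤ c * ‖A x‖ := by
  by_contra! hn
  -- If no bound holds, there are unit vectors with A x → 0.
  have hx : ∀ n : ℕ, ∃ x : E, ‖x‖ = 1 ∧ (n : ℝ) * ‖A x‖ < 1 := by
    intro n
    obtain ⟨x, hx⟩ := hn n
    have hx0 : 0 < ‖x‖ := lt_of_le_of_lt (by positivity) hx
    refine ⟨‖x‖⁻¹ • x, ?_, ?_⟩
    · rw [norm_smul, norm_inv, norm_norm, inv_mul_cancel₀ hx0.ne']
    · rw [map_smul, norm_smul, norm_inv, norm_norm]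
      calc (n : ℝ) * (‖x‖⁻¹ * ‖A x‖) = ‖x‖⁻¹ * (n * ‖A x‖) := by ring
        _ < ‖x‖⁻¹ * ‖x‖ := by gcongr
        _ = 1 := inv_mul_cancel₀ hx0.ne'
  choose x hx1 hxA using hx
  have hA0 : Filter.Tendsto (fun n => A (x n)) Filter.atTop (nhds 0) := by
    refine squeeze_zero_norm' (a := fun n : ℕ => 1 / (n : ℝ)) ?_ tendsto_one_div_atTop_nhds_zero_nat
    filter_upwards [Filter.eventually_gt_atTop 0] with n hn0
    have : (0 : ℝ) < n := by exact_mod_cast hn0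
    rw [le_div_iff₀ this, mul_comm]
    exact (hxA n).le
  have hcomp := (isCompactOperator_iff_isCompact_closure_image_closedBall T.toLinearMap
    zero_lt_one).1 hT
  obtain ⟨y, -, φ, hφ, hlim⟩ := hcomp.tendsto_subseq (x := fun n => T (x n)) fun n =>
    subset_closure ⟨x n, mem_closedBall_zero_iff.2 (hx1 n).le, rfl⟩
  have hAφ := hA0.comp hφ.tendsto_atTop
  -- Along a subsequence T x converges, so the assumed estimate, applied to differences, makes x
  -- itself Cauchy; its limit is a unit vector in the kernel of A.
  have hc : CauchySeq (x ∘ φ) := by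
    have e : ∀ i j, dist ((x ∘ φ) i) ((x ∘ φ) j) ≤
        C * (dist (T (x (φ i))) (T (x (φ j))) + dist (A (x (φ i))) (A (x (φ j)))) := by
      intro i j
      rw [dist_eq_norm, dist_eq_norm, dist_eq_norm, ← map_sub, ← map_sub]
      exact h _
    have c1 := cauchySeq_iff_tendsto_dist_atTop_0.1 hlim.cauchySeq
    have c2 := cauchySeq_iff_tendsto_dist_atTop_0.1 hAφ.cauchySeq
    refine cauchySeq_iff_tendsto_dist_atTop_0.2
      (squeeze_zero (fun _ => dist_nonneg) (fun n => e n.1 n.2) ?_)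
    simpa using (c1.add c2).const_mul C
  obtain ⟨z, hz⟩ := cauchySeq_tendsto_of_complete hc
  have h1 : A z = 0 := tendsto_nhds_unique ((A.continuous.tendsto z).comp hz) hAφ
  have h2 : ‖z‖ = 1 := by
    refine tendsto_nhds_unique hz.norm ?_
    simp only [Function.comp_apply, hx1]
    exact tendsto_const_nhds
  rw [hA z h1, norm_zero] at h2
  exact zero_ne_one h2

/-- A surjective operator that is bounded below has a continuous inverse. -/
theorem exists_rightInverse_of_norm_le {E H : Type*} [NormedAddCommGroup E] [NormedSpace ℝ E]
    [CompleteSpace E] [NormedAddCommGroup H] [NormedSpace ℝ H] (A : E →L[ℝ] H) {c : ℝ}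
    (h : ∀ x, ‖x‖ ≤ c * ‖A x‖) (hA : Function.Surjective A) :
    CompleteSpace H ∧ ∃ Q : H →L[ℝ] E, ∀ y, A (Q y) = y := by
  have hinj : Function.Injective A := by
    refine (injective_iff_map_eq_zero A).2 fun x hx => ?_
    have := h x
    rw [hx, norm_zero, mul_zero] at this
    exact norm_le_zero_iff.1 this
  let e := LinearEquiv.ofBijective A.toLinearMap ⟨hinj, hA⟩
  let Q : H →L[ℝ] E := e.symm.toLinearMap.mkContinuous c fun y => by
    have := h (e.symm y)
    rwa [show A (e.symm y) = y from e.apply_symm_apply y] at this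
  let E' : E ≃L[ℝ] H := ContinuousLinearEquiv.equivOfInverse A Q e.symm_apply_apply
    e.apply_symm_apply
  exact ⟨(completeSpace_congr (e := E'.toEquiv) E'.isUniformEmbedding).1 inferInstance, Q,
    e.apply_symm_apply⟩

/-! ### The norms of V and ℋ; completeness of ℋ -/

namespace Graetz

theorem integral_norm_mul_norm_le {F : Type*} [NormedAddCommGroup F] {m : Measure Plane}
    (f g : Lp F 2 m) : ∫ x, ‖f x‖ * ‖g x‖ ∂m ≤ ‖f‖ * ‖g‖ := by
  have hf := (Lp.memLp f).norm
  have hg := (Lp.memLp g).norm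
  have e : inner ℝ (hf.toLp _) (hg.toLp _) = ∫ x, ‖f x‖ * ‖g x‖ ∂m := by
    rw [L2.inner_def]
    refine integral_congr_ae ?_
    filter_upwards [hf.coeFn_toLp, hg.coeFn_toLp] with x h1 h2
    rw [h1, h2, mul_comm]
    rfl
  have n : ∀ f : Lp F 2 m, ‖(Lp.memLp f).norm.toLp _‖ = ‖f‖ := by
    intro f
    rw [Lp.norm_toLp, eLpNorm_norm, Lp.norm_def]
  rw [← e, ← n f, ← n g]
  exact real_inner_le_norm _ _

section WInner

variable {F : Type*} [NormedAddCommGroup F] [InnerProductSpace ℝ F] {m m' : Measure Plane}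
  {w : Plane → ℝ}

theorem abs_wInner_le (hm : m' ≤ m) {M : ℝ} (hM : 0 ≤ M) (hb : ∀ᵐ x ∂m', ‖w x‖ ≤ M)
    (f g : Lp F 2 m) : |wInner m' w f g| ≤ M * (‖f‖ * ‖g‖) := by
  have hi : Integrable (fun x => ‖f x‖ * ‖g x‖) m :=
    (Lp.memLp f).norm.integrable_mul (Lp.memLp g).norm
  calc |wInner m' w f g| ≤ ∫ x, M * (‖f x‖ * ‖g x‖) ∂m' := by
        rw [← Real.norm_eq_abs]
        refine norm_integral_le_of_norm_le ((hi.mono_measure hm).const_mul M) ?_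
        filter_upwards [hb] with x hx
        rw [norm_mul]
        exact mul_le_mul hx (norm_inner_le_norm (f x) (g x)) (norm_nonneg _) hM
    _ = M * ∫ x, ‖f x‖ * ‖g x‖ ∂m' := integral_const_mul _ _
    _ ≤ M * ∫ x, ‖f x‖ * ‖g x‖ ∂m := by
        exact mul_le_mul_of_nonneg_left
          (integral_mono_measure hm (ae_of_all _ fun x => by positivity) hi) hM
    _ ≤ M * (‖f‖ * ‖g‖) := by
        gcongr
        exact integral_norm_mul_norm_le f g

theorem exists_abs_wInner_le (hm : m' ≤ m) (hb : ∃ M, ∀ᵐ x ∂m', ‖w x‖ ≤ M) :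
    ∃ M : ℝ, 0 ≤ M ∧ ∀ f g : Lp F 2 m, |wInner m' w f g| ≤ M * (‖f‖ * ‖g‖) := by
  obtain ⟨M, hM⟩ := hb
  exact ⟨max M 0, le_max_right _ _, abs_wInner_le hm (le_max_right _ _)
    (hM.mono fun x hx => hx.trans (le_max_left _ _))⟩

theorem exists_norm_sq_le_wInner (hw : AEStronglyMeasurable w m)
    (hb : ∃ a b : ℝ, 0 < a ∧ ∀ᵐ x ∂m, a ≤ w x ∧ w x ≤ b) :
    ∃ C : ℝ, 0 ≤ C ∧ ∀ f : Lp F 2 m, ‖f‖ ^ 2 ≤ C * wInner m w f f := by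
  have hb' := (Data.norm_bound hb).1
  obtain ⟨a, b, ha, h⟩ := hb
  refine ⟨a⁻¹, by positivity, fun f => ?_⟩
  rw [← div_eq_inv_mul, le_div_iff₀ ha, ← real_inner_self_eq_norm_sq, L2.inner_def, mul_comm,
    ← integral_const_mul]
  refine integral_mono_ae ((L2.integrable_inner (𝕜 := ℝ) f f).const_mul a)
    (wInner_integrable le_rfl hw hb' f f) ?_
  filter_upwards [h] with x hx
  exact mul_le_mul_of_nonneg_right hx.1 real_inner_self_nonneg

end WInner

namespace Data

variable (G : Data)

theorem h_norm_bound : ∃ M, ∀ᵐ x ∂G.vol, ‖G.h x‖ ≤ M :=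
  ⟨_, ae_le_lpNorm_exponent_top G.h_memLp⟩

/-- `fn` as a continuous map. -/
noncomputable def fnL : G.V →L[ℝ] Lp ℝ 2 G.vol :=
  ContinuousLinearMap.fst ℝ (Lp ℝ 2 G.vol) (Lp Plane 2 G.vol × Lp ℝ 2 G.len) ∘L G.V.subtypeL

variable {G}

theorem norm_grad_le (s : G.V) : ‖G.grad s‖ ≤ ‖s‖ :=
  (norm_fst_le (s : G.Triple).2).trans (norm_snd_le (s : G.Triple))

theorem norm_trace_le (s : G.V) : ‖G.trace s‖ ≤ ‖s‖ :=
  (norm_snd_le (s : G.Triple).2).trans (norm_snd_le (s : G.Triple))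

theorem norm_eq_max (s : G.V) : ‖s‖ = max ‖G.fn s‖ (max ‖G.grad s‖ ‖G.trace s‖) := rfl

/-- The embedding of `V` into `L²` is compact. -/
theorem isCompactOperator_fnL : IsCompactOperator G.fnL := by
  refine isCompactOperator_of_forall_norm_sq_le _ fun ε hε => ?_
  obtain ⟨s, ℓ, h⟩ := G.exists_norm_le hε
  let e := s.equivFin
  refine ⟨s.card, (EuclideanSpace.equiv (Fin s.card) ℝ).symm.toContinuousLinearMap ∘L
    ContinuousLinearMap.pi fun i => ℓ (e.symm i) ∘L G.fnL, fun x => ?_⟩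
  refine (h x x.2.2.1).trans (add_le_add (le_of_eq ?_) ?_)
  · rw [EuclideanSpace.norm_sq_eq, ← Finset.sum_coe_sort, ← e.symm.sum_comp]
    refine Finset.sum_congr rfl fun i _ => ?_
    rw [Real.norm_eq_abs, sq_abs]
    rfl
  · gcongr
    exact norm_grad_le x

theorem exists_energy_le : ∃ M : ℝ, 0 ≤ M ∧ ∀ s s' : G.V, |G.energy s s'| ≤ M * (‖s‖ * ‖s'‖) := by
  obtain ⟨M₁, h₁, hσ⟩ := exists_abs_wInner_le (F := Plane) (m := G.vol) le_rfl
    (norm_bound G.σ_bounds).1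
  obtain ⟨M₂, h₂, ha⟩ := exists_abs_wInner_le (F := ℝ) G.robin_le G.a_norm_bound
  refine ⟨M₁ + M₂, by positivity, fun s s' => ?_⟩
  rw [add_mul]
  refine (abs_add_le _ _).trans (add_le_add ((hσ _ _).trans ?_) ((ha _ _).trans ?_))
  · gcongr <;> exact norm_grad_le _
  · gcongr <;> exact norm_trace_le _

theorem norm_pair_sq (u : Lp ℝ 2 G.vol) (s : G.V) :
    ‖G.pair u s‖ ^ 2 = wInner G.vol G.c u u + G.energy s s := by
  rw [← real_inner_self_eq_norm_sq, inner_pair]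

variable (G) in
/-- `pair` as a linear map. -/
noncomputable def pairₗ : Lp ℝ 2 G.vol × G.V →ₗ[ℝ] G.Hilb :=
  (SeparationQuotient.mkCLM ℝ G.PreH).toLinearMap ∘ₗ G.ofPair.toLinearMap

theorem pairₗ_apply (x : Lp ℝ 2 G.vol × G.V) : G.pairₗ x = G.pair x.1 x.2 := rfl

theorem exists_norm_pair_le : ∃ C : ℝ, ∀ x : Lp ℝ 2 G.vol × G.V, ‖G.pairₗ x‖ ≤ C * ‖x‖ := by
  obtain ⟨M₁, h₁, hc⟩ := exists_abs_wInner_le (F := ℝ) (m := G.vol) le_rfl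
    (norm_bound G.c_bounds).1
  obtain ⟨M₂, h₂, he⟩ := G.exists_energy_le
  refine ⟨√(M₁ + M₂), fun x => ?_⟩
  refine le_of_sq_le_sq ?_ (by positivity)
  rw [pairₗ_apply, norm_pair_sq, mul_pow, Real.sq_sqrt (by positivity), add_mul, sq]
  refine add_le_add ((le_abs_self _).trans ((hc _ _).trans ?_))
    ((le_abs_self _).trans ((he _ _).trans ?_))
  · gcongr <;> exact norm_fst_le x
  · gcongr <;> exact norm_snd_le x

variable (G) in
/-- `pair` as a continuous linear map. -/
noncomputable def pairL : Lp ℝ 2 G.vol × G.V →L[ℝ] G.Hilb :=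
  G.pairₗ.mkContinuousOfExistsBound G.exists_norm_pair_le

theorem exists_norm_le_pair : ∃ C : ℝ, 0 ≤ C ∧ ∀ (u : Lp ℝ 2 G.vol) (s : G.V),
    ‖u‖ ≤ C * ‖G.pair u s‖ ∧ ‖G.grad s‖ ≤ C * ‖G.pair u s‖ := by
  obtain ⟨C₁, h₁, hc⟩ := exists_norm_sq_le_wInner (F := ℝ) G.c_meas G.c_bounds
  obtain ⟨C₂, h₂, hσ⟩ := exists_norm_sq_le_wInner (F := Plane) G.σ_meas G.σ_bounds
  refine ⟨√(C₁ + C₂), by positivity, fun u s => ?_⟩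
  have a1 := G.mass_nonneg u
  have a2 := wInner_nonneg (norm_bound G.σ_bounds).2 (G.grad s)
  have a3 := wInner_nonneg G.a_nonneg (G.trace s)
  constructor <;> refine le_of_sq_le_sq ?_ (by positivity) <;>
    rw [mul_pow, norm_pair_sq, Real.sq_sqrt (by positivity), energy]
  · refine (hc u).trans ?_
    gcongr <;> linarith
  · refine (hσ (G.grad s)).trans ?_
    gcongr <;> linarith

/-- The norm of ℋ controls u and the gradient, and the trace inequality controls the trace; only the
L² norm of s is missing, and it is compact on V. -/
theorem exists_norm_le_fn_add_pair : ∃ C : ℝ, ∀ x : Lp ℝ 2 G.vol × G.V,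
    ‖x‖ ≤ C * (‖G.fn x.2‖ + ‖G.pair x.1 x.2‖) := by
  obtain ⟨C, hC, h⟩ := G.exists_norm_le_pair
  obtain ⟨C', hC', h'⟩ := norm_trace_sq_le (G := G)
  refine ⟨1 + C + √C' * (1 + C), fun ⟨u, s⟩ => ?_⟩
  obtain ⟨h1, h2⟩ := h u s
  have h3 : ‖G.trace s‖ ≤ √C' * (‖G.fn s‖ + ‖G.grad s‖) := by
    refine le_of_sq_le_sq ((h' s).trans ?_) (by positivity)
    rw [mul_pow, Real.sq_sqrt hC']
    gcongr
    nlinarith [norm_nonneg (G.fn s), norm_nonneg (G.grad s)]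
  have n1 := norm_nonneg (G.fn s)
  have n2 := norm_nonneg (G.pair u s)
  have n3 := Real.sqrt_nonneg C'
  have h4 : √C' * (‖G.fn s‖ + ‖G.grad s‖) ≤ √C' * ((1 + C) * (‖G.fn s‖ + ‖G.pair u s‖)) := by
    gcongr
    nlinarith [mul_nonneg hC n1]
  have e : (1 + C + √C' * (1 + C)) * (‖G.fn s‖ + ‖G.pair u s‖) =
      (1 + C) * (‖G.fn s‖ + ‖G.pair u s‖) +
        √C' * ((1 + C) * (‖G.fn s‖ + ‖G.pair u s‖)) := by ring
  have h5 : 0 ≤ √C' * ((1 + C) * (‖G.fn s‖ + ‖G.pair u s‖)) := by positivity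
  have h6 := mul_nonneg hC n1
  have h7 := mul_nonneg hC n2
  change max ‖u‖ ‖s‖ ≤ _
  rw [norm_eq_max, e]
  refine max_le (by nlinarith) (max_le (by nlinarith) (max_le (by nlinarith) (by nlinarith)))

variable (G) in
/-- Each class of `V` modulo the elements of zero energy has exactly one representative orthogonal
to `ρ` in `L²`. -/
structure IsNormalization (ρ : Lp ℝ 2 G.vol) : Prop where
  eq_zero : ∀ s : G.V, inner ℝ ρ (G.fn s) = 0 → G.energy s s = 0 → s = 0
  exists_rep : ∀ s : G.V, ∃ s' : G.V, inner ℝ ρ (G.fn s') = 0 ∧ G.energy (s - s') (s - s') = 0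

theorem pair_sub (u u' : Lp ℝ 2 G.vol) (s s' : G.V) :
    G.pair u s - G.pair u' s' = G.pair (u - u') (s - s') := rfl

theorem pair_add (u u' : Lp ℝ 2 G.vol) (s s' : G.V) :
    G.pair u s + G.pair u' s' = G.pair (u + u') (s + s') := rfl

theorem pair_smul (r : ℝ) (u : Lp ℝ 2 G.vol) (s : G.V) :
    r • G.pair u s = G.pair (r • u) (r • s) := rfl

theorem pair_eq_pair_iff {u u' : Lp ℝ 2 G.vol} {s s' : G.V} :
    G.pair u s = G.pair u' s' ↔ u = u' ∧ G.energy (s - s') (s - s') = 0 := by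
  rw [← sub_eq_zero, pair_sub, pair_eq_zero_iff, sub_eq_zero]

theorem exists_eq_pair (x : G.Hilb) : ∃ u s, x = G.pair u s := by
  obtain ⟨p, rfl⟩ := SeparationQuotient.surjective_mk x
  exact ⟨(G.ofPair.symm p).1, (G.ofPair.symm p).2, rfl⟩

variable (G) in
/-- The elements of `V` orthogonal to `ρ`. -/
noncomputable def normalized (ρ : Lp ℝ 2 G.vol) : Submodule ℝ G.V :=
  LinearMap.ker (innerSL ℝ ρ ∘L G.fnL).toLinearMap

instance (ρ : Lp ℝ 2 G.vol) : CompleteSpace (G.normalized ρ) :=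
  (innerSL ℝ ρ ∘L G.fnL).isClosed_ker.completeSpace_coe

variable (G) in
/-- The inclusion of the normalized pairs. -/
noncomputable def inclusion (ρ : Lp ℝ 2 G.vol) :
    Lp ℝ 2 G.vol × G.normalized ρ →L[ℝ] Lp ℝ 2 G.vol × G.V :=
  (ContinuousLinearMap.id ℝ _).prodMap (G.normalized ρ).subtypeL

variable (G) in
/-- `pair`, restricted to the normalized pairs. -/
noncomputable def normalizedPair (ρ : Lp ℝ 2 G.vol) :
    Lp ℝ 2 G.vol × G.normalized ρ →L[ℝ] G.Hilb :=
  G.pairL ∘L G.inclusion ρ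

theorem normalizedPair_apply {ρ : Lp ℝ 2 G.vol} (x : Lp ℝ 2 G.vol × G.normalized ρ) :
    G.normalizedPair ρ x = G.pair x.1 x.2 := rfl

/-- The normalization makes `pair` injective, so the compact term `fn` can be removed from
`exists_norm_le_fn_add_pair`. With surjectivity, ℋ is isomorphic to a complete space. -/
theorem IsNormalization.exists_norm_le {ρ : Lp ℝ 2 G.vol} (hρ : G.IsNormalization ρ) :
    ∃ c : ℝ, ∀ x, ‖x‖ ≤ c * ‖G.normalizedPair ρ x‖ := by
  obtain ⟨C, hC⟩ := G.exists_norm_le_fn_add_pair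
  let T : Lp ℝ 2 G.vol × G.normalized ρ →L[ℝ] Lp ℝ 2 G.vol :=
    G.fnL ∘L (ContinuousLinearMap.snd ℝ (Lp ℝ 2 G.vol) G.V ∘L G.inclusion ρ)
  have hT : IsCompactOperator T := isCompactOperator_fnL.comp_clm _
  refine exists_norm_le_of_isCompactOperator (E := Lp ℝ 2 G.vol × G.normalized ρ) hT
    (G.normalizedPair ρ) (fun x h => ?_) (C := C) fun x => ?_
  · rw [normalizedPair_apply, pair_eq_zero_iff] at h
    exact Prod.ext h.1 (Subtype.ext (hρ.eq_zero _ x.2.2 h.2))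
  · exact hC (G.inclusion ρ x)

theorem IsNormalization.surjective {ρ : Lp ℝ 2 G.vol} (hρ : G.IsNormalization ρ) :
    Function.Surjective (G.normalizedPair ρ) := by
  intro y
  obtain ⟨u, s, rfl⟩ := exists_eq_pair y
  obtain ⟨s', hs', h⟩ := hρ.exists_rep s
  exact ⟨(u, ⟨s', hs'⟩), Eq.symm (pair_eq_pair_iff.2 ⟨rfl, h⟩)⟩

/-- The components of an element of `ℋ` in a normalization depend continuously on it. -/
theorem IsNormalization.exists_components {ρ : Lp ℝ 2 G.vol} (hρ : G.IsNormalization ρ) :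
    CompleteSpace G.Hilb ∧ ∃ (uL : G.Hilb →L[ℝ] Lp ℝ 2 G.vol) (sL : G.Hilb →L[ℝ] G.V),
      (∀ x, G.pair (uL x) (sL x) = x) ∧ ∀ x, inner ℝ ρ (G.fn (sL x)) = 0 := by
  obtain ⟨c, hc⟩ := hρ.exists_norm_le
  obtain ⟨hcomplete, Q, hQ⟩ := exists_rightInverse_of_norm_le
    (E := Lp ℝ 2 G.vol × G.normalized ρ) (G.normalizedPair ρ) hc hρ.surjective
  exact ⟨hcomplete, ContinuousLinearMap.fst ℝ _ _ ∘L Q,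
    (G.normalized ρ).subtypeL ∘L ContinuousLinearMap.snd ℝ _ _ ∘L Q, hQ, fun x => (Q x).2.2⟩

end Data

end Graetz

/-! ### Compactness of adjoints and rank one operators -/

/-- An operator whose square is dominated by a compact operator is compact. -/
theorem isCompactOperator_of_norm_sq_le {E F H : Type*} [NormedAddCommGroup E]
    [NormedSpace ℝ E] [NormedAddCommGroup F] [NormedSpace ℝ F] [CompleteSpace F]
    [NormedAddCommGroup H] [NormedSpace ℝ H] {T : E →L[ℝ] F} {S : E →L[ℝ] H}
    (hS : IsCompactOperator S) (h : ∀ x, ‖T x‖ ^ 2 ≤ ‖S x‖ * ‖x‖) : IsCompactOperator T := by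
  refine (isCompactOperator_iff_isCompact_closure_image_closedBall T.toLinearMap
    zero_lt_one).2 ?_
  refine TotallyBounded.isCompact_of_isClosed (TotallyBounded.closure ?_) isClosed_closure
  refine Metric.totallyBounded_iff.2 fun δ hδ => ?_
  have hb : IsCompact (closure (S '' Metric.closedBall 0 1)) :=
    (isCompactOperator_iff_isCompact_closure_image_closedBall S.toLinearMap zero_lt_one).1 hS
  obtain ⟨t, ht, htf, hcov⟩ := (hb.totallyBounded.subset subset_closure).exists_subset
    (Metric.dist_mem_uniformity (by positivity : 0 < δ ^ 2 / 4))
  have ht' : ∀ y ∈ t, ∃ x ∈ Metric.closedBall (0 : E) 1, S x = y := fun y hy => ht hy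
  choose! p hp hpt using ht'
  refine ⟨(fun y => T (p y)) '' t, htf.image _, ?_⟩
  rintro _ ⟨x, hx, rfl⟩
  obtain ⟨y, hy, hxy⟩ := Set.mem_iUnion₂.1 (hcov ⟨x, hx, rfl⟩)
  refine Set.mem_iUnion₂.2 ⟨T (p y), ⟨y, hy, rfl⟩, ?_⟩
  rw [Metric.mem_ball, dist_eq_norm]
  change ‖T x - T (p y)‖ < δ
  have h1 := h (x - p y)
  have h2 : ‖S (x - p y)‖ < δ ^ 2 / 4 := by
    rw [map_sub, hpt y hy, ← dist_eq_norm]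
    exact hxy
  have h3 : ‖x - p y‖ ≤ 2 := by
    have := norm_sub_le x (p y)
    have h4 := mem_closedBall_zero_iff.1 hx
    have h5 := mem_closedBall_zero_iff.1 (hp y hy)
    linarith
  rw [← map_sub]
  refine lt_of_pow_lt_pow_left₀ 2 hδ.le ?_
  have h6 : ‖S (x - p y)‖ * ‖x - p y‖ ≤ δ ^ 2 / 4 * 2 := by gcongr
  nlinarith [sq_pos_of_pos hδ]

/-- ‖T* x‖² = (T T* x | x), so T* is dominated by the compact operator T T*. -/
theorem ContinuousLinearMap.isCompactOperator_adjoint {E : Type*} [NormedAddCommGroup E]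
    [InnerProductSpace ℝ E] [CompleteSpace E] {T : E →L[ℝ] E} (hT : IsCompactOperator T) :
    IsCompactOperator (adjoint T) := by
  refine isCompactOperator_of_norm_sq_le (S := T ∘L adjoint T) (hT.comp_clm _) fun x => ?_
  rw [← real_inner_self_eq_norm_sq, adjoint_inner_right]
  exact real_inner_le_norm _ _

theorem isCompactOperator_smulRight {E : Type*} [NormedAddCommGroup E] [NormedSpace ℝ E]
    (f : E →L[ℝ] ℝ) (u : E) : IsCompactOperator (f.smulRight u) :=
  ((isCompactOperator_id_iff_finiteDimensional (𝕜 := ℝ) (E := ℝ)).2 inferInstance).comp_clm f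
    |>.clm_comp (ContinuousLinearMap.toSpanSingleton ℝ u)

/-! ### The operator 𝒜 as a symmetric relation -/

namespace Graetz

namespace Data

variable {G : Data}

theorem massH_add (u u' v : Lp ℝ 2 G.vol) :
    wInner G.vol G.h (u + u') v = wInner G.vol G.h u v + wInner G.vol G.h u' v :=
  wInner_add le_rfl G.h_memLp.aestronglyMeasurable G.h_norm_bound u u' v

theorem massH_smul (r : ℝ) (u v : Lp ℝ 2 G.vol) :
    wInner G.vol G.h (r • u) v = r * wInner G.vol G.h u v :=
  wInner_smul le_rfl u v r

theorem mass_add (u u' v : Lp ℝ 2 G.vol) :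
    wInner G.vol G.c (u + u') v = wInner G.vol G.c u v + wInner G.vol G.c u' v :=
  wInner_add le_rfl G.c_meas (norm_bound G.c_bounds).1 u u' v

theorem mass_smul (r : ℝ) (u v : Lp ℝ 2 G.vol) :
    wInner G.vol G.c (r • u) v = r * wInner G.vol G.c u v :=
  wInner_smul le_rfl u v r

theorem integral_mul_eq_of_ae {f w u : Lp ℝ 2 G.vol}
    (h : ∀ᵐ x ∂G.vol, f x = G.h x * w x - G.c x * u x) (v : Lp ℝ 2 G.vol) :
    ∫ x, f x * v x ∂G.vol = wInner G.vol G.h w v - wInner G.vol G.c u v := by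
  unfold wInner
  rw [← integral_sub
    (wInner_integrable le_rfl G.h_memLp.aestronglyMeasurable G.h_norm_bound w v)
    (wInner_integrable le_rfl G.c_meas (norm_bound G.c_bounds).1 u v)]
  refine integral_congr_ae (h.mono fun x hx => ?_)
  simp only [hx, RCLike.inner_apply, conj_trivial]
  ring

theorem exists_ae_eq_source (w u : Lp ℝ 2 G.vol) :
    ∃ f : Lp ℝ 2 G.vol, ∀ᵐ x ∂G.vol, f x = G.h x * w x - G.c x * u x := by
  have h1 : MemLp (fun x => G.h x * w x) 2 G.vol := (Lp.memLp w).mul G.h_memLp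
  have hc : MemLp G.c ⊤ G.vol := by
    obtain ⟨M, hM⟩ := (norm_bound G.c_bounds).1
    exact memLp_top_of_bound G.c_meas M hM
  have h2 : MemLp (fun x => G.c x * u x) 2 G.vol := (Lp.memLp u).mul hc
  exact ⟨(h1.sub h2).toLp _, (h1.sub h2).coeFn_toLp⟩

/-- The graph of `𝒜` in terms of bilinear forms. -/
theorem isA_iff {φ φ' : G.Hilb} : G.IsA φ φ' ↔ ∃ (s w : G.V) (u : Lp ℝ 2 G.vol),
    φ = G.pair (G.fn w) s ∧ φ' = G.pair u w ∧ ∀ v : G.V, G.energy s v =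
      wInner G.vol G.c u (G.fn v) - wInner G.vol G.h (G.fn w) (G.fn v) := by
  constructor
  · rintro ⟨s, w, f, u, h1, h2, h3, h4⟩
    refine ⟨s, w, u, h1, h2, fun v => ?_⟩
    rw [h3 v, integral_mul_eq_of_ae (w := G.fn w) (u := u) ?_, neg_sub]
    filter_upwards [h4, ae_pos G.c_bounds] with x hx hc
    rw [hx, mul_inv_cancel_left₀ hc.ne']
    ring
  · rintro ⟨s, w, u, h1, h2, h3⟩
    obtain ⟨f, hf⟩ := exists_ae_eq_source (G.fn w) u
    refine ⟨s, w, f, u, h1, h2, fun v => ?_, ?_⟩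
    · rw [h3 v, integral_mul_eq_of_ae hf, neg_sub]
    · filter_upwards [hf, ae_pos G.c_bounds] with x hx hc
      rw [hx, sub_sub_cancel, inv_mul_cancel_left₀ hc.ne']

theorem divEq_hL2_iff {s : G.V} :
    G.DivEq s G.hL2 ↔ ∀ v, G.energy s v = -wInner G.vol G.h G.one (G.fn v) := by
  have : ∀ v : Lp ℝ 2 G.vol, ∫ x, G.hL2 x * v x ∂G.vol = wInner G.vol G.h G.one v := by
    intro v
    refine integral_congr_ae ?_
    filter_upwards [(G.h_memLp.mono_exponent le_top : MemLp G.h 2 G.vol).coeFn_toLp,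
      (memLp_const (1 : ℝ) : MemLp (fun _ => (1 : ℝ)) 2 G.vol).coeFn_toLp] with x h1 h2
    rw [show G.hL2 x = G.h x from h1, show G.one x = 1 from h2, RCLike.inner_apply, conj_trivial,
      mul_one]
  simp only [DivEq, this]

variable (G) in
/-- The graph of `𝒜`. -/
def graph : Submodule ℝ (G.Hilb × G.Hilb) where
  carrier := {p | G.IsA p.1 p.2}
  zero_mem' := by
    refine isA_iff.2 ⟨0, 0, 0, rfl, rfl, fun v => ?_⟩
    rw [map_zero, wInner_zero_left (Lp.coeFn_zero _ _ _), wInner_zero_left (Lp.coeFn_zero _ _ _),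
      sub_zero]
    simpa using G.energy_smul 0 0 v
  add_mem' := by
    rintro ⟨x, x'⟩ ⟨y, y'⟩ hx hy
    obtain ⟨s, w, u, h1, h2, h3⟩ := isA_iff.1 hx
    obtain ⟨s', w', u', h1', h2', h3'⟩ := isA_iff.1 hy
    refine isA_iff.2 ⟨s + s', w + w', u + u', ?_, ?_, fun v => ?_⟩
    · rw [Prod.fst_add, h1, h1', map_add]
      rfl
    · rw [Prod.snd_add, h2, h2']
      rfl
    · rw [energy_add, h3, h3', map_add, mass_add, massH_add]
      ring
  smul_mem' := by
    rintro r ⟨x, x'⟩ hx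
    obtain ⟨s, w, u, h1, h2, h3⟩ := isA_iff.1 hx
    refine isA_iff.2 ⟨r • s, r • w, r • u, ?_, ?_, fun v => ?_⟩
    · rw [Prod.smul_fst, h1, map_smul]
      rfl
    · rw [Prod.smul_snd, h2]
      rfl
    · rw [energy_smul, h3, map_smul, mass_smul, massH_smul]
      ring

theorem mem_graph {x y : G.Hilb} : (x, y) ∈ G.graph ↔ G.IsA x y := Iff.rfl

/-- Test the weak equation of each pair with the first component of the other; the energies and the
terms with h cancel. -/
theorem isA_symm {x x' y y' : G.Hilb} (hx : G.IsA x x') (hy : G.IsA y y') :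
    inner ℝ x' y = inner ℝ x y' := by
  obtain ⟨s, w, u, rfl, rfl, h1⟩ := isA_iff.1 hx
  obtain ⟨t, z, v, rfl, rfl, h2⟩ := isA_iff.1 hy
  have e1 := h1 z
  have e2 := h2 w
  rw [inner_pair, inner_pair]
  rw [G.energy_comm t w, wInner_comm v, wInner_comm (G.fn z)] at e2
  linarith

/-- With zero argument the weak equation says that c u is orthogonal to all test functions, which
are dense in L². -/
theorem eq_zero_of_isA_zero {y : G.Hilb} (h : G.IsA 0 y) : y = 0 := by
  obtain ⟨s, w, u, h0, rfl, h1⟩ := isA_iff.1 h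
  obtain ⟨hw, hs⟩ := pair_eq_zero_iff.1 h0.symm
  obtain ⟨f, hf⟩ := exists_ae_eq_source (G.fn w) u
  have hf0 : f = 0 := eq_zero_of_forall_integral_mul_fn fun v => by
    rw [integral_mul_eq_of_ae hf, ← neg_eq_zero, neg_sub, ← h1 v, energy_eq_zero_of_self hs]
  have hu : u = 0 := by
    refine Lp.eq_zero_iff_ae_eq_zero.2 ?_
    rw [hw] at hf
    filter_upwards [hf, Lp.eq_zero_iff_ae_eq_zero.1 hf0, Lp.coeFn_zero ℝ 2 G.vol,
      ae_pos G.c_bounds] with x h1 h2 h3 h4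
    rw [h2, h3] at h1
    have : G.c x * u x = 0 := by simpa using h1.symm
    exact (mul_eq_zero.1 this).resolve_left h4.ne'
  rw [hu, eq_zero_of_fn_eq_zero hw]
  rfl

/-- Testing the weak equation with w, whose function is u, expresses the cross energy by ∫ c u u' -
∫ h u², and only the last term survives. -/
theorem isA_flip {u : Lp ℝ 2 G.vol} {s : G.V} {y : G.Hilb} (h : G.IsA (G.pair u s) y) :
    2 * inner ℝ (G.P (G.pair u s)) y - inner ℝ (G.pair u s) y = wInner G.vol G.h u u := by
  obtain ⟨t, w, v, h0, rfl, h1⟩ := isA_iff.1 h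
  obtain ⟨rfl, -⟩ := pair_eq_pair_iff.1 h0
  rw [h0, P_pair, inner_pair, inner_pair, h1 w, wInner_comm v]
  have : G.energy 0 w = 0 := by simpa using G.energy_smul 0 0 w
  rw [this]
  ring

theorem P_idem (x : G.Hilb) : G.P (G.P x) = G.P x := by
  obtain ⟨u, s, rfl⟩ := exists_eq_pair x
  rfl

theorem energy_zero_left (v : G.V) : G.energy 0 v = 0 := by simpa using G.energy_smul 0 0 v

theorem energy_zero_right (v : G.V) : G.energy v 0 = 0 := by
  rw [energy_comm, energy_zero_left]

theorem P_symm (x y : G.Hilb) : inner ℝ (G.P x) y = inner ℝ x (G.P y) := by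
  obtain ⟨u, s, rfl⟩ := exists_eq_pair x
  obtain ⟨u', s', rfl⟩ := exists_eq_pair y
  rw [P_pair, P_pair, inner_pair, inner_pair, energy_zero_left, energy_zero_right]

theorem massH_add_right (u v v' : Lp ℝ 2 G.vol) :
    wInner G.vol G.h u (v + v') = wInner G.vol G.h u v + wInner G.vol G.h u v' := by
  rw [wInner_comm, massH_add, wInner_comm v, wInner_comm v']

theorem massH_smul_right (r : ℝ) (u v : Lp ℝ 2 G.vol) :
    wInner G.vol G.h u (r • v) = r * wInner G.vol G.h u v := by
  rw [wInner_comm, massH_smul, wInner_comm v]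

theorem mass_add_right (u v v' : Lp ℝ 2 G.vol) :
    wInner G.vol G.c u (v + v') = wInner G.vol G.c u v + wInner G.vol G.c u v' := by
  rw [wInner_comm, mass_add, wInner_comm v, wInner_comm v']

theorem mass_smul_right (r : ℝ) (u v : Lp ℝ 2 G.vol) :
    wInner G.vol G.c u (r • v) = r * wInner G.vol G.c u v := by
  rw [wInner_comm, mass_smul, wInner_comm v]

theorem isNormalization_of_controlled (hG : ¬ G.NotControlled) : G.IsNormalization 0 where
  eq_zero _ _ h := eq_zero_of_energy_self hG h
  exists_rep s := ⟨s, inner_zero_left _, by rw [sub_self, energy_zero_left]⟩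

theorem exists_fn_eq_smul_one (hG : G.NotControlled) {v : G.V} (hv : G.energy v v = 0) :
    ∃ k : ℝ, G.fn v = k • G.one := by
  obtain ⟨k, hk⟩ := (energy_self_eq_zero_iff_of_notControlled hG).1 hv
  refine ⟨k, Lp.ext ?_⟩
  filter_upwards [hk, Lp.coeFn_smul k G.one,
    (memLp_const (1 : ℝ) : MemLp (fun _ => (1 : ℝ)) 2 G.vol).coeFn_toLp] with x h1 h2 h3
  rw [h1, h2, Pi.smul_apply, show G.one x = 1 from h3, smul_eq_mul, mul_one]

theorem energy_self_of_fn_eq_smul_one (hG : G.NotControlled) {v : G.V} {k : ℝ}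
    (hv : G.fn v = k • G.one) : G.energy v v = 0 := by
  refine (energy_self_eq_zero_iff_of_notControlled hG).2 ⟨k, ?_⟩
  rw [hv]
  filter_upwards [Lp.coeFn_smul k G.one,
    (memLp_const (1 : ℝ) : MemLp (fun _ => (1 : ℝ)) 2 G.vol).coeFn_toLp] with x h2 h3
  rw [h2, Pi.smul_apply, show G.one x = 1 from h3, smul_eq_mul, mul_one]

/-- The null vectors are the constants, and a multiple of 1 can be subtracted to achieve
orthogonality to ρ exactly because (ρ | 1) ≠ 0. -/
theorem isNormalization_of_notControlled (hG : G.NotControlled) {ρ : Lp ℝ 2 G.vol}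
    (hρ : inner ℝ ρ G.one ≠ 0) : G.IsNormalization ρ where
  eq_zero s h1 h2 := by
    obtain ⟨k, hk⟩ := exists_fn_eq_smul_one hG h2
    rw [hk, real_inner_smul_right] at h1
    refine eq_zero_of_fn_eq_zero ?_
    rw [hk, (mul_eq_zero.1 h1).resolve_right hρ, zero_smul]
  exists_rep s := by
    obtain ⟨e, he⟩ := exists_fn_eq_one hG
    refine ⟨s - (inner ℝ ρ (G.fn s) / inner ℝ ρ G.one) • e, ?_, ?_⟩
    · rw [map_sub, map_smul, he, inner_sub_right, real_inner_smul_right, div_mul_cancel₀ _ hρ,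
        sub_self]
    · rw [sub_sub_cancel]
      exact energy_self_of_fn_eq_smul_one hG (by rw [map_smul, he])

theorem vol_ne_zero : G.vol ≠ 0 := by
  rw [Ne, Measure.restrict_eq_zero]
  exact (G.isOpen.measure_pos volume G.isConnected.nonempty).ne'

theorem one_ne_zero : G.one ≠ 0 := by
  intro h
  have h1 : (ae G.vol).NeBot := ae_neBot.2 vol_ne_zero
  obtain ⟨x, hx, hx'⟩ := ((Lp.eq_zero_iff_ae_eq_zero.1 h).and
    (memLp_const (1 : ℝ) : MemLp (fun _ => (1 : ℝ)) 2 G.vol).coeFn_toLp).exists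
  rw [show G.one x = 1 from hx'] at hx
  exact _root_.one_ne_zero hx

theorem one_ae : ∀ᵐ x ∂G.vol, G.one x = 1 :=
  (memLp_const (1 : ℝ) : MemLp (fun _ => (1 : ℝ)) 2 G.vol).coeFn_toLp

theorem integral_h_eq : ∫ x in G.Ω, G.h x = wInner G.vol G.h G.one G.one := by
  refine integral_congr_ae (one_ae.mono fun x hx => ?_)
  simp [hx]

theorem inner_hL2 (v : Lp ℝ 2 G.vol) : inner ℝ G.hL2 v = wInner G.vol G.h G.one v := by
  rw [L2.inner_def]
  refine integral_congr_ae ?_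
  filter_upwards [(G.h_memLp.mono_exponent le_top : MemLp G.h 2 G.vol).coeFn_toLp, one_ae]
    with x h1 h2
  rw [show G.hL2 x = G.h x from h1, h2]
  simp [mul_comm]

variable (G) in
/-- The form `∫ h u u'` on `L²`. -/
noncomputable def flowForm : Lp ℝ 2 G.vol →L[ℝ] Lp ℝ 2 G.vol →L[ℝ] ℝ :=
  LinearMap.mkContinuousOfExistsBound₂ (LinearMap.mk₂ ℝ
    (fun x y => wInner G.vol G.h x y)
    (fun x x' y => massH_add x x' y)
    (fun r x y => massH_smul r x y)
    (fun x y y' => massH_add_right x y y')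
    (fun r x y => massH_smul_right r x y))
    (by
      obtain ⟨M, -, hM⟩ := exists_abs_wInner_le (F := ℝ) (m := G.vol) le_rfl G.h_norm_bound
      refine ⟨M, fun x y => ?_⟩
      rw [mul_assoc]
      exact hM x y)

/-! ### The compact partial inverse of 𝒜 -/

variable (G) in
/-- A continuous choice of representatives of the elements of `ℋ`, with second component orthogonal
to `ρ`. -/
structure Components (ρ : Lp ℝ 2 G.vol) where
  norm : G.IsNormalization ρ
  uL : G.Hilb →L[ℝ] Lp ℝ 2 G.vol
  sL : G.Hilb →L[ℝ] G.V
  pair_eq : ∀ x, G.pair (uL x) (sL x) = x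
  inner_eq : ∀ x, inner ℝ ρ (G.fn (sL x)) = 0

namespace Components

variable {ρ : Lp ℝ 2 G.vol} (C : G.Components ρ)

theorem uL_pair (u : Lp ℝ 2 G.vol) (s : G.V) : C.uL (G.pair u s) = u :=
  (pair_eq_pair_iff.1 (C.pair_eq (G.pair u s))).1

theorem sL_pair (u : Lp ℝ 2 G.vol) {s : G.V} (hs : inner ℝ ρ (G.fn s) = 0) :
    C.sL (G.pair u s) = s := by
  have h1 := (pair_eq_pair_iff.1 (C.pair_eq (G.pair u s))).2
  refine sub_eq_zero.1 (C.norm.eq_zero _ ?_ h1)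
  rw [map_sub, inner_sub_right, C.inner_eq, hs, sub_zero]

theorem P_apply (x : G.Hilb) : G.P x = G.pair (C.uL x) 0 := by
  conv_lhs => rw [← C.pair_eq x]
  rfl

/-- The operator `(u, s) ↦ (s, 0)`. -/
noncomputable def shift : G.Hilb →L[ℝ] G.Hilb :=
  G.pairL ∘L (ContinuousLinearMap.inl ℝ (Lp ℝ 2 G.vol) G.V ∘L (G.fnL ∘L C.sL))

theorem shift_apply (x : G.Hilb) : C.shift x = G.pair (G.fn (C.sL x)) 0 := rfl

theorem isCompactOperator_shift : IsCompactOperator C.shift :=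
  ((isCompactOperator_fnL.comp_clm C.sL).clm_comp
    (G.pairL ∘L ContinuousLinearMap.inl ℝ (Lp ℝ 2 G.vol) G.V))

theorem shift_pair (u : Lp ℝ 2 G.vol) {s : G.V} (hs : inner ℝ ρ (G.fn s) = 0) :
    C.shift (G.pair u s) = G.pair (G.fn s) 0 := by
  rw [shift_apply, C.sL_pair u hs]

theorem shift_of_P {x : G.Hilb} (hx : G.P x = x) : C.shift x = 0 := by
  rw [C.P_apply] at hx
  rw [← hx, C.shift_pair _ (by rw [map_zero, inner_zero_right]), map_zero]
  rfl

theorem uL_shift (x : G.Hilb) : C.uL (C.shift x) = G.fn (C.sL x) := by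
  rw [shift_apply, uL_pair]

theorem uL_P (x : G.Hilb) : C.uL (G.P x) = C.uL x := by
  rw [C.P_apply, uL_pair]

theorem inner_pair_zero (x : G.Hilb) (v : Lp ℝ 2 G.vol) :
    inner ℝ x (G.pair v 0) = wInner G.vol G.c (C.uL x) v := by
  obtain ⟨u, s, rfl⟩ := exists_eq_pair x
  rw [inner_pair, energy_zero_right, add_zero, uL_pair]

variable [CompleteSpace G.Hilb]

/-- The operator that represents the form `∫ h u u'`. -/
noncomputable def D : G.Hilb →L[ℝ] G.Hilb :=
  InnerProductSpace.continuousLinearMapOfBilin (𝕜 := ℝ) (G.flowForm.bilinearComp C.uL C.uL)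

theorem inner_D (x y : G.Hilb) :
    inner ℝ (C.D x) y = wInner G.vol G.h (C.uL x) (C.uL y) :=
  InnerProductSpace.continuousLinearMapOfBilin_apply _ x y

theorem D_symm (x y : G.Hilb) : inner ℝ (C.D x) y = inner ℝ x (C.D y) := by
  rw [inner_D, real_inner_comm, inner_D, wInner_comm]

open ContinuousLinearMap in
-- The shift vanishes on the range of P, so its adjoint maps into the kernel of P.
theorem uL_adjoint_shift (x : G.Hilb) : C.uL (adjoint C.shift x) = 0 := by
  have h : inner ℝ (G.P (adjoint C.shift x)) (G.P (adjoint C.shift x)) = 0 := by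
    rw [P_symm, P_idem, adjoint_inner_left, C.shift_of_P (P_idem _), inner_zero_right]
  rw [inner_self_eq_zero, C.P_apply, pair_eq_zero_iff] at h
  exact h.1

open ContinuousLinearMap in
theorem adjoint_shift_apply (x : G.Hilb) :
    adjoint C.shift x = G.pair 0 (C.sL (adjoint C.shift x)) := by
  conv_lhs => rw [← C.pair_eq (adjoint C.shift x), uL_adjoint_shift]

open ContinuousLinearMap in
-- The adjoint of the shift is (u, s) ↦ (0, -Δ_σ⁻¹(c u)), tested with normalized functions only;
-- this obtains the inverse of the elliptic operator without solving an equation.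
theorem energy_adjoint_shift (x : G.Hilb) {v : G.V} (hv : inner ℝ ρ (G.fn v) = 0) :
    G.energy (C.sL (adjoint C.shift x)) v = inner ℝ x (G.pair (G.fn v) 0) := by
  have h := adjoint_inner_left C.shift (G.pair 0 v) x
  rw [C.shift_pair 0 hv, adjoint_shift_apply, inner_pair,
    wInner_zero_left (Lp.coeFn_zero _ _ _), zero_add] at h
  exact h

open ContinuousLinearMap in
/-- The partial inverse of `𝒜`, up to a correction of finite rank. -/
noncomputable def T₀ : G.Hilb →L[ℝ] G.Hilb :=
  -- In formulas, (u, s) ↦ (s, Δ_σ⁻¹(h s - c u)); the form of the sum shows symmetry and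
  -- compactness.
  C.shift + (adjoint C.shift - adjoint C.shift ∘L (C.D ∘L C.shift))

open ContinuousLinearMap in
theorem T₀_apply (x : G.Hilb) :
    C.T₀ x = C.shift x + adjoint C.shift (x - C.D (C.shift x)) := by
  rw [map_sub]
  rfl

open ContinuousLinearMap in
theorem isCompactOperator_T₀ : IsCompactOperator C.T₀ :=
  C.isCompactOperator_shift.add ((isCompactOperator_adjoint C.isCompactOperator_shift).sub
    ((isCompactOperator_adjoint C.isCompactOperator_shift).comp_clm (C.D ∘L C.shift)))

open ContinuousLinearMap in
theorem T₀_symm (x y : G.Hilb) : inner ℝ (C.T₀ x) y = inner ℝ x (C.T₀ y) := by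
  rw [T₀_apply, T₀_apply, inner_add_left, inner_add_right, adjoint_inner_left,
    adjoint_inner_right, inner_sub_left, inner_sub_right, D_symm]
  ring

/-- For x = (u, 0) the image is of the form (0, ·). This identity makes vectors of the range of P
isotropic for T₀. -/
theorem inner_T₀_of_P {x : G.Hilb} (hx : G.P x = x) : inner ℝ (C.T₀ x) x = 0 := by
  rw [T₀_apply, inner_add_left, ContinuousLinearMap.adjoint_inner_left, C.shift_of_P hx,
    inner_zero_left, inner_zero_right, add_zero]

open ContinuousLinearMap in
theorem energy_T₀ (x : G.Hilb) {v : G.V} (hv : inner ℝ ρ (G.fn v) = 0) :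
    G.energy (C.sL (adjoint C.shift (x - C.D (C.shift x)))) v =
      wInner G.vol G.c (C.uL x) (G.fn v) - wInner G.vol G.h (G.fn (C.sL x)) (G.fn v) := by
  rw [C.energy_adjoint_shift _ hv, inner_sub_left, inner_D, uL_shift, uL_pair, inner_pair_zero]

theorem exists_T₀_eq (x : G.Hilb) : ∃ s : G.V, C.T₀ x = G.pair (G.fn (C.sL x)) s ∧
    ∀ v : G.V, inner ℝ ρ (G.fn v) = 0 → G.energy s v =
      wInner G.vol G.c (C.uL x) (G.fn v) - wInner G.vol G.h (G.fn (C.sL x)) (G.fn v) := by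
  refine ⟨_, ?_, fun v hv => C.energy_T₀ x hv⟩
  refine (C.T₀_apply x).trans ((congrArg _ (C.adjoint_shift_apply _)).trans ?_)
  refine (congrArg (· + _) (C.shift_apply x)).trans ?_
  rw [pair_add, add_zero, zero_add]

/-- `T₀` solves the equation for normalized test functions only. The null vector e, a constant, is
added to the first component so that the equation also holds for null test functions (`h2`) without
disturbing the normalized ones (`h1`). -/
theorem isA_T₀_add {x : G.Hilb} {e : G.V} (he : G.energy e e = 0)
    (h1 : ∀ v : G.V, inner ℝ ρ (G.fn v) = 0 → wInner G.vol G.h (G.fn e) (G.fn v) = 0)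
    (h2 : ∀ v : G.V, G.energy v v = 0 →
      wInner G.vol G.h (G.fn (C.sL x) + G.fn e) (G.fn v) = wInner G.vol G.c (C.uL x) (G.fn v)) :
    G.IsA (C.T₀ x + G.pair (G.fn e) 0) x := by
  obtain ⟨s, hs, key⟩ := C.exists_T₀_eq x
  refine isA_iff.2 ⟨s, C.sL x + e, C.uL x, ?_, ?_, fun v => ?_⟩
  · rw [hs, pair_add, map_add, add_zero]
  · refine (C.pair_eq x).symm.trans (pair_eq_pair_iff.2 ⟨rfl, ?_⟩)
    have : C.sL x - (C.sL x + e) = (-1 : ℝ) • e := by module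
    rw [this, energy_smul, energy_comm, energy_smul, he]
    ring
  -- Split the test function into a null vector and a normalized one; the energy does not see the
  -- null part.
  · obtain ⟨v', hv', hvv⟩ := C.norm.exists_rep v
    have e1 : v = (v - v') + v' := by abel
    have e2 := h2 _ hvv
    have e3 : G.energy s v = G.energy s v' := by
      rw [e1, energy_comm, energy_add, energy_eq_zero_of_self hvv, zero_add, energy_comm]
    have e4 : G.fn v = G.fn (v - v') + G.fn v' := by rw [map_sub, sub_add_cancel]
    have e5 := massH_add (G.fn (C.sL x)) (G.fn e) (G.fn v')
    rw [h1 v' hv'] at e5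
    have e6 := mass_add_right (C.uL x) (G.fn (v - v')) (G.fn v')
    have e7 := massH_add_right (G.fn (C.sL x) + G.fn e) (G.fn (v - v')) (G.fn v')
    rw [e3, key v' hv', e4, map_add]
    linarith

/-- The spectral frame given by a compact partial inverse of `𝒜`. -/
noncomputable def frame (T : G.Hilb →L[ℝ] G.Hilb) (K : Submodule ℝ G.Hilb)
    (hK : FiniteDimensional ℝ K) (hT : IsCompactOperator T)
    (hT_symm : ∀ x y, inner ℝ (T x) y = inner ℝ x (T y)) (hT_graph : ∀ x ∈ Kᗮ, G.IsA (T x) x)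
    (hT_kernel : ∀ x ∈ K, T x = 0) (hK_graph : ∀ x ∈ K, G.IsA x 0) : SpectralFrame G.Hilb where
  graph := G.graph
  P := G.P
  D := C.D
  T := T
  K := K
  finite_kernel := hK
  P_idem := P_idem
  P_symm := P_symm
  D_symm := C.D_symm
  D_P x y := by rw [inner_D, inner_D, uL_P, uL_P]
  graph_symm _ _ _ _ := isA_symm
  graph_flip x y h := by
    have h' : G.IsA (G.pair (C.uL x) (C.sL x)) y := by rwa [C.pair_eq]
    have := isA_flip h'
    rwa [C.pair_eq, ← inner_D] at this
  graph_zero _ := eq_zero_of_isA_zero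
  T_compact := hT
  T_symm := hT_symm
  T_graph := hT_graph
  T_kernel := hT_kernel
  kernel_graph := hK_graph

/-- The frame for controlled constants. -/
noncomputable def controlledFrame (hG : ¬ G.NotControlled) : SpectralFrame G.Hilb :=
  C.frame C.T₀ ⊥ inferInstance C.isCompactOperator_T₀ C.T₀_symm
    (fun x _ => by
      have := C.isA_T₀_add (x := x) (e := 0) (G.energy_zero_left 0)
        (fun v _ => by rw [map_zero, wInner_zero_left (Lp.coeFn_zero _ _ _)])
        (fun v hv => by
          rw [eq_zero_of_energy_self hG hv, map_zero, wInner_comm,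
            wInner_zero_left (Lp.coeFn_zero _ _ _), wInner_comm,
            wInner_zero_left (Lp.coeFn_zero _ _ _)])
      rwa [map_zero, show G.pair 0 0 = 0 from rfl, add_zero] at this)
    (fun x hx => by rw [(Submodule.mem_bot ℝ).1 hx, map_zero])
    (fun x hx => by
      rw [(Submodule.mem_bot ℝ).1 hx]
      exact G.graph.zero_mem)

end Components

theorem P_Phi : G.P G.Phi = G.Phi := rfl

theorem Phi_ne_zero : G.Phi ≠ 0 := fun h => one_ne_zero (pair_eq_zero_iff.1 h).1

namespace Components

theorem inner_Phi {ρ : Lp ℝ 2 G.vol} (C : G.Components ρ) (x : G.Hilb) :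
    inner ℝ G.Phi x = wInner G.vol G.c (C.uL x) G.one := by
  rw [real_inner_comm]
  exact C.inner_pair_zero x G.one

theorem uL_Phi {ρ : Lp ℝ 2 G.vol} (C : G.Components ρ) : C.uL G.Phi = G.one := C.uL_pair _ _

variable [CompleteSpace G.Hilb]

/-- The partial inverse of `𝒜` for nonzero total flow. -/
noncomputable def flowT (C : G.Components G.hL2) : G.Hilb →L[ℝ] G.Hilb :=
  -- The second summand is the constant k with k ∫h = ∫ c u, required by solvability of the Neumann
  -- problem. As s is normalized by ∫ h s = 0, no other term enters.
  C.T₀ + (wInner G.vol G.h G.one G.one)⁻¹ • (innerSL ℝ G.Phi).smulRight G.Phi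

theorem flowT_apply (C : G.Components G.hL2) (x : G.Hilb) :
    C.flowT x = C.T₀ x + ((wInner G.vol G.h G.one G.one)⁻¹ * inner ℝ G.Phi x) • G.Phi := by
  rw [mul_smul]
  rfl

theorem isA_flowT (C : G.Components G.hL2) (hG : G.NotControlled)
    (hh : wInner G.vol G.h G.one G.one ≠ 0) (x : G.Hilb) : G.IsA (C.flowT x) x := by
  obtain ⟨e, he⟩ := exists_fn_eq_one hG
  set k := (wInner G.vol G.h G.one G.one)⁻¹ * inner ℝ G.Phi x with hk
  have hke : G.fn (k • e) = k • G.one := by rw [map_smul, he]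
  have h1 := C.isA_T₀_add (x := x) (e := k • e) (energy_self_of_fn_eq_smul_one hG hke)
    (fun v hv => by
      rw [inner_hL2] at hv
      rw [hke, massH_smul, hv, mul_zero])
    (fun v hv => by
      obtain ⟨r, hr⟩ := exists_fn_eq_smul_one hG hv
      have e1 := C.inner_eq x
      rw [inner_hL2, wInner_comm] at e1
      have e2 := massH_add (G.fn (C.sL x)) (k • G.one) G.one
      have e3 : k * wInner G.vol G.h G.one G.one = wInner G.vol G.c (C.uL x) G.one := by
        rw [hk, mul_right_comm, inv_mul_cancel₀ hh, one_mul, C.inner_Phi]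
      rw [e1, massH_smul, zero_add, e3] at e2
      rw [hr, hke, massH_smul_right, mass_smul_right, e2])
  rw [flowT_apply, ← hk, Phi, pair_smul, smul_zero]
  rwa [hke] at h1

/-- The frame for nonzero total flow. -/
noncomputable def flowFrame (C : G.Components G.hL2) (hG : G.NotControlled)
    (hh : wInner G.vol G.h G.one G.one ≠ 0) : SpectralFrame G.Hilb :=
  C.frame C.flowT ⊥ inferInstance
    (C.isCompactOperator_T₀.add ((isCompactOperator_smulRight _ _).smul _))
    (fun x y => by
      rw [flowT_apply, flowT_apply, inner_add_left, inner_add_right, T₀_symm,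
        real_inner_smul_left, real_inner_smul_right, real_inner_comm G.Phi x]
      ring)
    (fun x _ => C.isA_flowT hG hh x)
    (fun x hx => by rw [(Submodule.mem_bot ℝ).1 hx, map_zero])
    (fun x hx => by
      rw [(Submodule.mem_bot ℝ).1 hx]
      exact G.graph.zero_mem)

open ContinuousLinearMap in
/-- The vector `φ₀` that spans the kernel of `𝒜` for vanishing total flow. -/
noncomputable def kernelVector (C : G.Components G.one) : G.Hilb :=
  G.Phi - adjoint C.shift (C.D G.Phi)

open ContinuousLinearMap in
-- Orthogonality to φ₀ is the solvability condition ∫ c u = ∫ h s; for vanishing total flow it does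
-- not depend on the constant in s.
theorem inner_kernelVector (C : G.Components G.one) (x : G.Hilb) :
    inner ℝ C.kernelVector x =
      wInner G.vol G.c (C.uL x) G.one - wInner G.vol G.h (G.fn (C.sL x)) G.one := by
  rw [kernelVector, inner_sub_left, adjoint_inner_left, inner_D, uL_Phi, uL_shift, C.inner_Phi,
    wInner_comm G.one]

open ContinuousLinearMap in
theorem exists_kernelVector_eq (C : G.Components G.one) (hG : G.NotControlled)
    (hh : wInner G.vol G.h G.one G.one = 0) :
    ∃ s : G.V, C.kernelVector = G.pair G.one s ∧ G.DivEq s G.hL2 := by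
  refine ⟨-C.sL (adjoint C.shift (C.D G.Phi)), ?_, divEq_hL2_iff.2 fun v => ?_⟩
  · refine (congrArg (G.Phi - ·) (C.adjoint_shift_apply _)).trans ?_
    rw [Phi, pair_sub, sub_zero, zero_sub]
  · obtain ⟨v', hv', hvv⟩ := C.norm.exists_rep v
    obtain ⟨r, hr⟩ := exists_fn_eq_smul_one hG hvv
    have e1 : v = (v - v') + v' := by abel
    have e3 : ∀ s : G.V, G.energy s v = G.energy s v' := fun s => by
      rw [e1, energy_comm, energy_add, energy_eq_zero_of_self hvv, zero_add, energy_comm]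
    have e4 : G.fn v = r • G.one + G.fn v' := by rw [← hr, map_sub, sub_add_cancel]
    have e5 := C.energy_adjoint_shift (C.D G.Phi) hv'
    rw [inner_D, uL_Phi, uL_pair] at e5
    rw [e3, ← neg_one_smul ℝ, energy_smul, e5, e4, massH_add_right, massH_smul_right, hh]
    ring

theorem isA_T₀ (C : G.Components G.one) (hG : G.NotControlled) {x : G.Hilb}
    (hx : inner ℝ C.kernelVector x = 0) : G.IsA (C.T₀ x) x := by
  have h1 := C.isA_T₀_add (x := x) (e := 0) (G.energy_zero_left 0)
    (fun v _ => by rw [map_zero, wInner_zero_left (Lp.coeFn_zero _ _ _)])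
    (fun v hv => by
      obtain ⟨r, hr⟩ := exists_fn_eq_smul_one hG hv
      rw [inner_kernelVector] at hx
      rw [hr, map_zero, add_zero, massH_smul_right, mass_smul_right, sub_eq_zero.1 hx])
  rwa [map_zero, show G.pair 0 0 = 0 from rfl, add_zero] at h1

theorem isA_kernelVector (C : G.Components G.one) (hG : G.NotControlled)
    (hh : wInner G.vol G.h G.one G.one = 0) : G.IsA C.kernelVector 0 := by
  obtain ⟨s, hs, hd⟩ := C.exists_kernelVector_eq hG hh
  obtain ⟨e, he⟩ := exists_fn_eq_one hG
  refine isA_iff.2 ⟨s, e, 0, by rw [hs, he], ?_, fun v => ?_⟩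
  · refine (pair_eq_zero_iff.2 ⟨rfl, energy_self_of_fn_eq_smul_one hG (k := 1) ?_⟩).symm
    rw [he, one_smul]
  · rw [divEq_hL2_iff.1 hd, he, wInner_zero_left (Lp.coeFn_zero _ _ _), zero_sub]

variable (C : G.Components G.one)

/-- The kernel of `𝒜` for vanishing total flow. -/
noncomputable def kernel : Submodule ℝ G.Hilb := Submodule.span ℝ {C.kernelVector}

instance : FiniteDimensional ℝ C.kernel :=
  inferInstanceAs (FiniteDimensional ℝ (Submodule.span ℝ {C.kernelVector}))

theorem mem_kernel_orthogonal {x : G.Hilb} :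
    x ∈ C.kernelᗮ ↔ inner ℝ C.kernelVector x = 0 :=
  Submodule.mem_orthogonal_singleton_iff_inner_right

/-- The partial inverse of `𝒜` for vanishing total flow. -/
noncomputable def balancedT : G.Hilb →L[ℝ] G.Hilb :=
  -- The inner projection enforces solvability, the outer one makes the operator symmetric; it
  -- changes the value only by an element of the kernel.
  C.kernelᗮ.starProjection ∘L (C.T₀ ∘L C.kernelᗮ.starProjection)

theorem balancedT_apply (x : G.Hilb) :
    C.balancedT x = C.kernelᗮ.starProjection (C.T₀ (C.kernelᗮ.starProjection x)) := rfl

theorem isA_of_mem_kernel (hG : G.NotControlled) (hh : wInner G.vol G.h G.one G.one = 0)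
    {x : G.Hilb} (hx : x ∈ C.kernel) : G.IsA x 0 := by
  obtain ⟨r, rfl⟩ := Submodule.mem_span_singleton.1 hx
  have := G.graph.smul_mem r (mem_graph.2 (C.isA_kernelVector hG hh))
  rwa [Prod.smul_mk, smul_zero] at this

/-- The frame for vanishing total flow. -/
noncomputable def balancedFrame (hG : G.NotControlled)
    (hh : wInner G.vol G.h G.one G.one = 0) : SpectralFrame G.Hilb :=
  C.frame C.balancedT C.kernel inferInstance
    ((C.isCompactOperator_T₀.comp_clm C.kernelᗮ.starProjection).clm_comp
      C.kernelᗮ.starProjection)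
    (fun x y => by
      rw [balancedT_apply, balancedT_apply, Submodule.inner_starProjection_left_eq_right, T₀_symm,
        Submodule.inner_starProjection_left_eq_right])
    (fun x hx => by
      rw [balancedT_apply, Submodule.starProjection_eq_self_iff.2 hx,
        Submodule.starProjection_orthogonal_val]
      have h1 := mem_graph.2 (C.isA_T₀ hG (C.mem_kernel_orthogonal.1 hx))
      have h2 := mem_graph.2 (C.isA_of_mem_kernel hG hh
        (C.kernel.starProjection_apply_mem (C.T₀ x)))
      have h3 := G.graph.sub_mem h1 h2
      rwa [Prod.mk_sub_mk, sub_zero] at h3)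
    (fun x hx => by
      have h0 : C.kernelᗮ.starProjection x = 0 := by
        rw [Submodule.starProjection_orthogonal_val, Submodule.starProjection_eq_self_iff.2 hx,
          sub_self]
      rw [balancedT_apply, h0, map_zero, map_zero])
    (fun x hx => C.isA_of_mem_kernel hG hh hx)

end Components

/-! ### The three cases of the theorem -/

theorem isPhi0_unique {x y : G.Hilb} (hx : G.IsPhi0 x) (hy : G.IsPhi0 y) : x = y := by
  obtain ⟨s, hs, rfl⟩ := hx
  obtain ⟨t, ht, rfl⟩ := hy
  refine pair_eq_pair_iff.2 ⟨rfl, ?_⟩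
  have e1 := hs (s - t)
  rw [← ht (s - t)] at e1
  have e2 := G.energy_add (s - t) t (s - t)
  rw [sub_add_cancel] at e2
  linarith

theorem IsNormalization.exists_complete_components {ρ : Lp ℝ 2 G.vol}
    (h : G.IsNormalization ρ) : CompleteSpace G.Hilb ∧ Nonempty (G.Components ρ) := by
  obtain ⟨hc, uL, sL, h1, h2⟩ := h.exists_components
  exact ⟨hc, ⟨⟨h, uL, sL, h1, h2⟩⟩⟩

variable [CompleteSpace G.Hilb]

theorem piPlus_eq_zero_iff {x : G.Hilb} : G.piPlus x = 0 ↔ x ∈ G.posSpaceᗮ :=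
  Submodule.starProjection_apply_eq_zero_iff _

/-- Testing the weak equation with the constant 1, whose energy vanishes, gives ∫ c u' = ∫ h u: that
is, 𝒜Φ = DΦ in the weak sense. -/
theorem inner_Phi_of_isA (hG : G.NotControlled) {x y : G.Hilb} (h : G.IsA x y)
    {ρ : Lp ℝ 2 G.vol} (C : G.Components ρ) : inner ℝ G.Phi y = inner ℝ (C.D G.Phi) x := by
  obtain ⟨s, w, u, rfl, rfl, h1⟩ := isA_iff.1 h
  obtain ⟨e, he⟩ := exists_fn_eq_one hG
  have e1 := h1 e
  have e2 : G.energy e e = 0 := energy_self_of_fn_eq_smul_one hG (k := 1) (by rw [he, one_smul])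
  rw [energy_comm, energy_eq_zero_of_self e2, he] at e1
  rw [C.inner_Phi, C.inner_D, C.uL_Phi, C.uL_pair, C.uL_pair, wInner_comm G.one]
  linarith

/-- The theorem for controlled constants. -/
theorem controlled_case (C : G.Components 0) (hG : ¬ G.NotControlled) :
    G.compression.IsInvertible ∧ ∀ φ ψ : G.Hilb, G.Solves φ ψ ↔ ψ = G.Bminus (G.P φ) := by
  set S := C.controlledFrame hG
  refine ⟨S.compression_isInvertible, fun φ ψ => ?_⟩
  refine (and_congr_right' piPlus_eq_zero_iff).trans
    (S.solution_iff_of_forall_eq_zero rfl (fun w hP hw => ?_) φ ψ)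
  obtain ⟨p, hp, k, hk, rfl⟩ := S.exists_add_of_mem_neg_orthogonal hw
  rw [(Submodule.mem_bot ℝ).1 hk, add_zero] at hP ⊢
  exact S.eq_zero_of_inner_T_nonpos hp (C.inner_T₀_of_P hP).le

theorem inner_flowT (C : G.Components G.hL2) {w : G.Hilb} (hw : G.P w = w) :
    inner ℝ (C.flowT w) w = (wInner G.vol G.h G.one G.one)⁻¹ * inner ℝ G.Phi w ^ 2 := by
  rw [C.flowT_apply, inner_add_left, C.inner_T₀_of_P hw, real_inner_smul_left, zero_add]
  ring

/-- The theorem for nonzero total flow. -/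
theorem flow_case (C : G.Components G.hL2) (hG : G.NotControlled)
    (hh : wInner G.vol G.h G.one G.one ≠ 0) :
    G.compression.IsInvertible ∧
    (0 < wInner G.vol G.h G.one G.one → ∀ φ : G.Hilb,
      ((∃ ψ, G.Solves φ ψ) ↔ inner ℝ (G.Phi - G.P (G.Bminus G.Phi)) φ = 0) ∧
      (inner ℝ (G.Phi - G.P (G.Bminus G.Phi)) φ = 0 →
        ∀ ψ, G.Solves φ ψ ↔ ψ = G.Bminus (G.P φ))) ∧
    (wInner G.vol G.h G.one G.one < 0 →
      ∀ φ ψ : G.Hilb, G.Solves φ ψ ↔ ψ = G.Bminus (G.P φ)) := by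
  set S := C.flowFrame hG hh
  have hS : ∀ φ ψ : G.Hilb, G.Solves φ ψ ↔ S.P ψ = S.P φ ∧ ψ ∈ S.posᗮ :=
    fun φ ψ => and_congr_right' piPlus_eq_zero_iff
  refine ⟨S.compression_isInvertible, fun hpos φ => ?_, fun hneg φ ψ => ?_⟩
  · simp only [hS]
    refine S.solution_iff_of_inner_eq_zero P_Phi (fun w hP hw h0 => ?_) rfl φ
    obtain ⟨p, hp, k, hk, rfl⟩ := S.exists_add_of_mem_neg_orthogonal hw
    rw [(Submodule.mem_bot ℝ).1 hk, add_zero] at hP h0 ⊢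
    refine S.eq_zero_of_inner_T_nonpos hp ((inner_flowT C hP).trans ?_).le
    rw [h0]
    ring
  · refine (hS φ ψ).trans (S.solution_iff_of_forall_eq_zero rfl (fun w hP hw => ?_) φ ψ)
    obtain ⟨p, hp, k, hk, rfl⟩ := S.exists_add_of_mem_neg_orthogonal hw
    rw [(Submodule.mem_bot ℝ).1 hk, add_zero] at hP ⊢
    -- Negative total flow makes (T w | w) nonpositive even when (Φ | w) ≠ 0, so there is no
    -- obstruction.
    refine S.eq_zero_of_inner_T_nonpos hp ((inner_flowT C hP).trans_le ?_)
    exact mul_nonpos_of_nonpos_of_nonneg (inv_nonpos.2 hneg.le) (sq_nonneg _)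

/-- The theorem for vanishing total flow. -/
theorem balanced_case (C : G.Components G.one) (hG : G.NotControlled)
    (hh : wInner G.vol G.h G.one G.one = 0) :
    G.compression.IsInvertible ∧ inner ℝ (G.Phi - G.P (G.Bminus G.Phi)) G.Phi ≠ 0 ∧
      ∃ φ₀ : G.Hilb, (∀ ξ, G.IsPhi0 ξ ↔ ξ = φ₀) ∧
        ∀ φ ψ : G.Hilb, G.Solves φ ψ ↔
          ψ = G.Bminus (G.P φ) +
            (inner ℝ (G.Phi - G.P (G.Bminus G.Phi)) φ /
              inner ℝ (G.Phi - G.P (G.Bminus G.Phi)) G.Phi) • (φ₀ - G.Bminus G.Phi) := by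
  set S := C.balancedFrame hG hh
  obtain ⟨s, hs, hd⟩ := C.exists_kernelVector_eq hG hh
  have hφ : G.IsPhi0 C.kernelVector := ⟨s, hd, hs⟩
  have hne : inner ℝ (G.Phi - G.P (G.Bminus G.Phi)) G.Phi ≠ 0 :=
    S.inner_defect_ne_zero P_Phi Phi_ne_zero
      ((C.inner_D _ _).trans (by rw [C.uL_Phi, hh])) fun x y h => inner_Phi_of_isA hG h C
  refine ⟨S.compression_isInvertible, hne, C.kernelVector,
    fun ξ => ⟨fun h => isPhi0_unique h hφ, fun h => h ▸ hφ⟩, fun φ ψ => ?_⟩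
  refine (and_congr_right' piPlus_eq_zero_iff).trans
    (S.solution_iff_of_kernel P_Phi (fun w hP hw h0 => ?_) rfl
      (show G.P C.kernelVector = G.Phi by rw [hs, P_pair, Phi]) hne φ ψ)
  have hP' : G.P w = w := hP
  -- As w has vanishing second component, it has the same product with φ₀ as with Φ.
  have hwk : inner ℝ C.kernelVector w = 0 := by
    have e1 := C.uL_shift w
    rw [C.shift_of_P hP', map_zero] at e1
    rw [C.inner_kernelVector, ← e1, wInner_zero_left (Lp.coeFn_zero _ _ _), sub_zero,
      ← C.inner_Phi, h0]
  have hwK : w ∈ C.kernelᗮ := C.mem_kernel_orthogonal.2 hwk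
  obtain ⟨p, hp, k, hk, hpk⟩ := S.exists_add_of_mem_neg_orthogonal hw
  -- Both w and p are orthogonal to the kernel, so the kernel component of w vanishes.
  have hk0 : k = 0 := by
    have e1 : inner ℝ k w = 0 := hwK k hk
    rw [hpk, inner_add_right, real_inner_comm, S.inner_pos_kernel hp hk, zero_add] at e1
    exact inner_self_eq_zero.1 e1
  rw [hk0, add_zero] at hpk
  refine S.eq_zero_of_inner_T_nonpos (hpk ▸ hp) (le_of_eq ?_)
  change inner ℝ (C.balancedT w) w = 0
  rw [C.balancedT_apply, Submodule.starProjection_eq_self_iff.2 hwK,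
    Submodule.inner_starProjection_left_eq_right, Submodule.starProjection_eq_self_iff.2 hwK,
    C.inner_T₀_of_P hP']

end Data

end Graetz

theorem mainTheorem2 (G : Graetz.Data) :
    -- the scalar product is definite on `ℋ` (modulo constants if these are not controlled)
    (¬ G.NotControlled → ∀ u s, G.pair u s = 0 ↔ u = 0 ∧ s = 0) ∧
    (G.NotControlled → ∀ u s, G.pair u s = 0 ↔
      u = 0 ∧ ∃ k : ℝ, ∀ᵐ x ∂G.vol, G.fn s x = k) ∧
    -- `ℋ` is a Hilbert space and `B₋` is well defined
    ∃ _ : CompleteSpace G.Hilb, G.compression.IsInvertible ∧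
    -- total flow positive
    (G.NotControlled → 0 < ∫ x in G.Ω, G.h x → ∀ φ : G.Hilb,
      ((∃ ψ, G.Solves φ ψ) ↔ inner ℝ (G.Phi - G.P (G.Bminus G.Phi)) φ = 0) ∧
      (inner ℝ (G.Phi - G.P (G.Bminus G.Phi)) φ = 0 →
        ∀ ψ, G.Solves φ ψ ↔ ψ = G.Bminus (G.P φ))) ∧
    -- balanced case
    (G.NotControlled → ∫ x in G.Ω, G.h x = 0 →
      inner ℝ (G.Phi - G.P (G.Bminus G.Phi)) G.Phi ≠ 0 ∧
      ∃ φ₀ : G.Hilb, (∀ ξ, G.IsPhi0 ξ ↔ ξ = φ₀) ∧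
        ∀ φ ψ : G.Hilb, G.Solves φ ψ ↔
          ψ = G.Bminus (G.P φ) +
            (inner ℝ (G.Phi - G.P (G.Bminus G.Phi)) φ /
              inner ℝ (G.Phi - G.P (G.Bminus G.Phi)) G.Phi) • (φ₀ - G.Bminus G.Phi)) ∧
    -- every other case
    (¬ (G.NotControlled ∧ 0 ≤ ∫ x in G.Ω, G.h x) →
      ∀ φ ψ : G.Hilb, G.Solves φ ψ ↔ ψ = G.Bminus (G.P φ)) := by
  refine ⟨fun hG u s => ?_, fun hG u s => ?_, ?_⟩
  · rw [Graetz.Data.pair_eq_zero_iff]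
    refine and_congr_right' ⟨fun h => Graetz.Data.eq_zero_of_energy_self hG h, ?_⟩
    rintro rfl
    exact Graetz.Data.energy_zero_left 0
  · rw [Graetz.Data.pair_eq_zero_iff, Graetz.Data.energy_self_eq_zero_iff_of_notControlled hG]
  rw [Graetz.Data.integral_h_eq]
  by_cases hG : G.NotControlled
  · by_cases hh : Graetz.wInner G.vol G.h G.one G.one = 0
    -- Balanced case: h cannot serve as normalizing function, since it is orthogonal to the
    -- constants; use mean zero.
    · have hone : inner ℝ G.one G.one ≠ 0 := fun h =>
        Graetz.Data.one_ne_zero (inner_self_eq_zero.1 h)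
      obtain ⟨hc, ⟨C⟩⟩ :=
        (Graetz.Data.isNormalization_of_notControlled hG hone).exists_complete_components
      obtain ⟨h1, h2⟩ := Graetz.Data.balanced_case C hG hh
      exact ⟨hc, h1, fun _ h => absurd h (by rw [hh]; exact lt_irrefl 0), fun _ _ => h2,
        fun h => absurd ⟨hG, hh.ge⟩ h⟩
    -- Nonzero flow: normalize by ∫ h s = 0, as the construction of `flowT` requires.
    · have hone : inner ℝ G.hL2 G.one ≠ 0 := by rwa [Graetz.Data.inner_hL2]
      obtain ⟨hc, ⟨C⟩⟩ :=
        (Graetz.Data.isNormalization_of_notControlled hG hone).exists_complete_components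
      obtain ⟨h1, h2, h3⟩ := Graetz.Data.flow_case C hG hh
      exact ⟨hc, h1, fun _ => h2, fun _ h => absurd h hh,
        fun h => h3 (lt_of_not_ge fun h' => h ⟨hG, h'⟩)⟩
  · obtain ⟨hc, ⟨C⟩⟩ :=
      (Graetz.Data.isNormalization_of_controlled hG).exists_complete_components
    obtain ⟨h1, h2⟩ := Graetz.Data.controlled_case C hG
    exact ⟨hc, h1, fun h => absurd h hG, fun h => absurd h hG, fun _ => h2⟩
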